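/- **Conventions.** Let $[N]=\{0,\dots,N-1\}$ and $x\in\mathbb R^N$. For real $t\ge 0$, $x^{\rm opt}_t$ is a minimiser of $\|x-y\|_2$ over $y$ with at most $t$ nonzero entries. A matrix $M\in\{0,1\}^{m\times N}$ is *$(K,\alpha)$-coherent* if every column has at least $K$ ones and any two distinct columns have inner product at most $\alpha$. $\mathcal B_N$ is the $(1+\lceil\log_2 N\rceil)\times N$ matrix whose $n$-th column is a one followed by the binary digits of $n$ (least significant first), and $A\circledast B$ is the matrix whose rows are the entrywise products of a row of $A$ and a row of $B$. $M_s$ is the matrix of the rows of $M$ listed in the finite sequence $s$ (with repetition). Fix $\kappa>0$ and write $t=k/\varepsilon$, $T=\max(2,t)$. *Random coherent matrices.* For $\tau\in[0,1)$ let $\ell=\log_{4/e}\frac{3N^2}{1-\tau}$, $\lambda=\ln\frac{3N}{1-\tau}$, $\alpha=\lceil 2\ell\rceil$, $K=\lceil\kappa t\alpha\rceil$, $\mu=K+\lambda+\sqrt{2K\lambda+\lambda^2}$, $m=\lceil\mu^2/\ell\rceil$, $p=\ell/\mu$. $\mathcal R_\tau$ is the set of $(K,\alpha)$-coherent $m\times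 N$ binary matrices with at most $\kappa K$ ones in every column. For fixed $\tau$ these are $(\Theta(k\log N/\varepsilon),\Theta(\log N))$-coherent. *DeVore matrices.* For a prime $P$, $D_P$ is the $P^2\times N$ binary matrix with rows indexed by $(q,r)\in[P]^2$ whose column $j$ has its ones in the rows $(q,Q_j(q)\bmod P)$, $q\in[P]$, where $Q_j$ is the polynomial whose coefficients are the base-$P$ digits of $j$. The $q$-th block is the set of the $P$ rows $(q,r)$. We use any prime $P$ with $B\le P\le 2B$, $B=\lceil \kappa\, t\log_T N\rceil$. *The algorithm.* Input: $(M_{s'}\circledast\mathcal B_N)x$, $M_{\tilde s}$ and $M_{\tilde s}x$. Phase 1: for each row $j$ of $M_{s'}$ form the integer whose $i$-th bit is $1$ iff the measurement of row $j$ restricted to the indices with $i$-th bit $1$ is larger in magnitude than the one restricted to the indices with $i$-th bit $0$; $S$ is the set of the integers in $[N]$ obtained. Phase 2: for $n\in S$ let $w_n$ be a median of the entries of $M_{\tilde s}x$ in the rows having a one in column $n$; the output $z$ agrees with $w$ on the $2k$ nonzero estimates of largest magnitude (all of them if there are fewer; ties broken arbitrarily) and is zero elsewhere. Running time is the number of steps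 on a real random access machine with unit-cost arithmetic on natural and real numbers; the programs below are fixed (independent of all parameters), and return $z$ as a list of index-value pairs. The matrix $M_{\tilde s}$ is given by the lists of its ones in each column in item 1, and by $P$ and its block indices in items 2 and 3. **Theorem.** There are an absolute constant $\kappa\ge 29$ and two programs such that for every $c_0>0$ there is $C>0$ (depending only on $c_0$) with the following property. Let $1\le k<N$, $\varepsilon\in(0,1]$, $\sigma\in[2/3,1)$, $\tau\in[0,1)$, $x\in\mathbb R^N$. An $m\times N$ matrix with independent Bernoulli($p$) entries lies in $\mathcal R_\tau$ with probability at least $\tau$; for $P$ as above $D_P$ is $(P,\lfloor\log_P N\rfloor)$-coherent and $\lfloor\log_P N\rfloor\le C\log_T N$. In each of the following cases, with probability at least $\sigma$ over the independent uniform choices of rows or blocks, every possible output $z$ of the algorithm satisfies $$\|x-z\|_2\le\|x-x^{\rm opt}_k\|_2+\frac{22\,\varepsilon\,\|x-x^{\rm opt}_{k/\varepsilon}\|_1}{\sqrt k}.\qquad(*)$$ 1. *Estimation only.* $M\in\mathcal R_\tau$, $M_{\tilde s}$ consists of $\beta=\lceil\kappa\frac mK\ln\frac{2N}{1-\sigma}\rceil$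 random rows of $M$, and Phase 2 is applied with $S=[N]$. The number of measurements is $\beta\le C\,t\ln\frac N{1-\sigma}$, and with probability at least $\sigma$ one has both $(*)$ and that the first program computes an output in at most $C N\ln\frac N{1-\sigma}$ steps (which is $O(N\log N)$ for fixed $\sigma$). 2. *DeVore matrix for both phases.* $M_{s'}$ consists of $b_1=\lceil\kappa\ln\frac{2t}{1-\sigma}\rceil$ random blocks of $D_P$, $M_{\tilde s}$ of $b_2=\lceil\kappa\ln\frac{2b_1P}{1-\sigma}\rceil$ random blocks of $D_P$. The same holds if each block index is obtained by reducing modulo $P$ the number formed by $\lceil\log_2P\rceil$ fair random bits. The second program always computes an output. If $k\ge c_0\ln N$, then with $f=1+\log_T\frac1{1-\sigma}$ the number of measurements is at most $C\,t\,\ln\frac N{1-\sigma}\,\ln N\cdot f$, the running time is at most $C\,t\,\ln^2\!\frac N{1-\sigma}\cdot f^2$, and $(b_1+b_2)\lceil\log_2P\rceil\le C\ln^2 T\cdot f$ random bits are used. (So for fixed $\sigma,\varepsilon$: $O(k\log^2N)$ measurements and time and, for $k\ge2$, $O(\log^2k)$ random bits.) 3. *Random coherent matrix for identification, DeVore matrix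 for estimation.* $M_{s'}$ consists of $\gamma=\lceil\kappa\frac mK\ln\frac{2t}{1-\sigma}\rceil$ random rows of some $M\in\mathcal R_\tau$, and $M_{\tilde s}$ of $\lceil\kappa\ln\frac{2\gamma}{1-\sigma}\rceil$ random blocks of $D_P$. The second program always computes an output. If $k\ge c_0\ln N$, the number of measurements is at most $C\,t\ln\frac{t}{1-\sigma}\ln N$ and the running time is at most $C\,t\ln\frac{t}{1-\sigma}\ln\frac N{1-\sigma}\cdot f$. (So for fixed $\sigma,\varepsilon$ and $k\ge2$: $O((k\log k)\log N)$.) -/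

import Mathlib

open MeasureTheory ProbabilityTheory

/-! ## Vectors, norms and best `t`-term approximations -/

/-- The `ℓ^p` norm of a real vector. -/
noncomputable def lpNormOf {N : ℕ} (p : ENNReal) [Fact (1 ≤ p)] (v : Fin N → ℝ) : ℝ :=
  ‖(WithLp.toLp p v : PiLp p (fun _ : Fin N => ℝ))‖

/-- `‖y‖₀`, the number of nonzero entries. -/
noncomputable def nonzeroCount {N : ℕ} (y : Fin N → ℝ) : ℕ :=
  (Finset.univ.filter (fun n => y n ≠ 0)).card

/-- `y` is a minimiser of `‖x - y‖₂` among the vectors with at most `t` nonzero entries.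
(Ties may make it non-unique; the norms `‖x - y‖_p` do not depend on the choice.) -/
def IsBestApprox {N : ℕ} (x : Fin N → ℝ) (t : ℝ) (y : Fin N → ℝ) : Prop :=
  (nonzeroCount y : ℝ) ≤ t ∧
    ∀ y' : Fin N → ℝ, (nonzeroCount y' : ℝ) ≤ t → lpNormOf 2 (x - y) ≤ lpNormOf 2 (x - y')

/-- The instance optimal `ℓ₂, ℓ₁` error guarantee; `xk` and `xt` are best `k`-term and best
`k / ε`-term approximations of `x`. -/
def ErrorBound {N : ℕ} (x xk xt : Fin N → ℝ) (k : ℕ) (ε : ℝ) (z : Fin N → ℝ) : Prop :=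
  lpNormOf 2 (x - z) ≤ lpNormOf 2 (x - xk) + 22 * ε * lpNormOf 1 (x - xt) / √(k : ℝ)

/-! ## Binary matrices -/

/-- A `0/1` matrix as a real matrix. -/
def realMat {ι κ : Type*} (A : Matrix ι κ Bool) : Matrix ι κ ℝ :=
  A.map (fun b => if b then 1 else 0)

/-- The number of ones in column `j`. -/
def columnOnes {ι : Type*} [Fintype ι] {N : ℕ} (A : Matrix ι (Fin N) Bool) (j : Fin N) : ℕ :=
  (Finset.univ.filter (fun i => A i j = true)).card

/-- `(K, α)`-coherence: at least `K` ones per column, and inner products of distinct columns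
at most `α`. -/
def IsCoherent {ι : Type*} [Fintype ι] {N : ℕ} (A : Matrix ι (Fin N) Bool) (K α : ℕ) : Prop :=
  (∀ j, K ≤ columnOnes A j) ∧
    ∀ j l, j ≠ l →
      (Finset.univ.filter (fun i => A i j = true ∧ A i l = true)).card ≤ α

/-- The bit-test matrix: row `0` is constantly one, row `i + 1` holds the binary digit of `n`
of weight `2 ^ i`. -/
def bitTest (N : ℕ) : Matrix (Fin (1 + Nat.clog 2 N)) (Fin N) Bool :=
  fun i n => if i.val = 0 then true else n.val.testBit (i.val - 1)

/-- The row tensor product `A ⊛ B`; row `i` is the entrywise product of row `i mod m₁` of `A`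
and row `⌊i / m₁⌋` of `B`. -/
def rowTensor {m₁ m₂ N : ℕ} (A : Matrix (Fin m₁) (Fin N) ℝ) (B : Matrix (Fin m₂) (Fin N) ℝ) :
    Matrix (Fin (m₂ * m₁)) (Fin N) ℝ :=
  fun i j => A i.modNat j * B i.divNat j

/-- `M_s` for a finite sequence `s` of rows (drawn with replacement, rows repeated). -/
def sampleRows {ι : Type*} {b N : ℕ} (A : Matrix ι (Fin N) Bool) (s : Fin b → ι) :
    Matrix (Fin b) (Fin N) Bool :=
  A.submatrix s id

/-- Estimation measurements `M_s x`. -/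
def estMeasurements {b N : ℕ} (A : Matrix (Fin b) (Fin N) Bool) (x : Fin N → ℝ) : Fin b → ℝ :=
  (realMat A).mulVec x

/-- Identification measurements `(M_s ⊛ B_N) x`. -/
def idMeasurements {r N : ℕ} (A : Matrix (Fin r) (Fin N) Bool) (x : Fin N → ℝ) :
    Fin ((1 + Nat.clog 2 N) * r) → ℝ :=
  (rowTensor (realMat A) (realMat (bitTest N))).mulVec x

/-! ## The DeVore matrices -/

/-- The DeVore matrix for the prime `P`: column `j` has its ones in the rows `(p, Q_j(p))`, where
the coefficients of `Q_j` are the base `P` digits of `j` and arithmetic is modulo `P`. -/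
def devore (P N : ℕ) : Matrix (Fin P × Fin P) (Fin N) Bool :=
  fun pr j => decide (Nat.ofDigits pr.1.val (Nat.digits P j.val) % P = pr.2.val)

/-- The rows of the blocks `s 0, s 1, …` of a DeVore matrix, in this order. -/
def blockRows {P b : ℕ} (s : Fin b → Fin P) : Fin (b * P) → Fin P × Fin P :=
  fun i => (s i.divNat, i.modNat)

/-- The submatrix of a DeVore matrix consisting of the given blocks of rows. -/
def devoreBlocks {P b : ℕ} (N : ℕ) (s : Fin b → Fin P) : Matrix (Fin (b * P)) (Fin N) Bool :=
  sampleRows (devore P N) (blockRows s)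

/-- A block index read off from `w` bits: the binary number they form, reduced modulo `P`. -/
def blockOfBits {P w : ℕ} (hP : 0 < P) (v : Fin w → Bool) : Fin P :=
  ⟨(∑ i : Fin w, if v i then 2 ^ i.val else 0) % P, Nat.mod_lt _ hP⟩

/-! ## The random near-optimal coherent matrices -/

/-- `log_{4/e} (3 N² / (1 - τ))`. -/
noncomputable def bernLogTerm (N : ℕ) (τ : ℝ) : ℝ :=
  Real.logb (4 / Real.exp 1) (3 * (N : ℝ) ^ 2 / (1 - τ))

/-- The expected number of ones per column,
`K + ln (3N/(1-τ)) + √(2 K ln (3N/(1-τ)) + ln² (3N/(1-τ)))`. -/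
noncomputable def bernMean (N K : ℕ) (τ : ℝ) : ℝ :=
  K + Real.log (3 * N / (1 - τ)) +
    √(2 * K * Real.log (3 * N / (1 - τ)) + Real.log (3 * N / (1 - τ)) ^ 2)

/-- The probability of a one in each entry. -/
noncomputable def bernProb (N K : ℕ) (τ : ℝ) : ℝ := bernLogTerm N τ / bernMean N K τ

/-- The number of rows. -/
noncomputable def bernRows (N K : ℕ) (τ : ℝ) : ℕ := ⌈bernMean N K τ ^ 2 / bernLogTerm N τ⌉₊

/-- The coherence parameter `α = Θ(log N)` (for fixed `τ`). -/
noncomputable def bernAlpha (N : ℕ) (τ : ℝ) : ℕ := ⌈2 * bernLogTerm N τ⌉₊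

/-- The parameter `K = Θ(t log N)` (for fixed `τ`), where `t = k / ε`. -/
noncomputable def bernK (κ t : ℝ) (N : ℕ) (τ : ℝ) : ℕ := ⌈κ * t * bernAlpha N τ⌉₊

/-- The law of an `m × N` matrix with independent Bernoulli(`p`) entries. -/
noncomputable def bernLaw (m N : ℕ) (p : ℝ) : Measure (Fin m × Fin N → Bool) :=
  Measure.pi (fun _ => bernoulliMeasure true false (Set.projIcc (0 : ℝ) 1 zero_le_one p))

/-- A `(K, α)`-coherent matrix all of whose columns have `Θ(K)` ones. -/
def IsBalancedCoherent {m N : ℕ} (κ : ℝ) (A : Matrix (Fin m) (Fin N) Bool) (K α : ℕ) : Prop :=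
  IsCoherent A K α ∧ ∀ j, (columnOnes A j : ℝ) ≤ κ * K

/-! ## Sample sizes -/

/-- The number `⌈κ ρ ln (2 q / (1 - σ))⌉` of random choices used to treat `q` indices, where
`ρ = m / K` for single rows and `ρ = 1` for blocks of rows of a DeVore matrix. -/
noncomputable def sampleSize (κ ρ q σ : ℝ) : ℕ := ⌈κ * ρ * Real.log (2 * q / (1 - σ))⌉₊

/-- `log_{t} u`, the base being replaced by `2` when it is smaller. -/
noncomputable def logBase (t u : ℝ) : ℝ := Real.logb (max 2 t) u

/-- The scale `⌈κ t log_t N⌉` of the prime in a DeVore matrix. -/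
noncomputable def devoreScale (κ t : ℝ) (N : ℕ) : ℕ := ⌈κ * t * logBase t N⌉₊

/-! ## The recovery algorithm -/

/-- The `i`-th row of the `j`-th bit test measurements, i.e. the entry of `(M_s ⊛ B_N) x` that
belongs to row `i` of `B_N` and row `j` of `M_s`. -/
def idEntry {q r : ℕ} (y : Fin (q * r) → ℝ) (i : Fin q) (j : Fin r) : ℝ :=
  y (finProdFinEquiv (i, j))

open Classical in
/-- Phase 1, the index read off from row `j`: bit `i` is one when the measurement restricted to
indices whose bit `i` is one exceeds the complementary measurement in magnitude. -/
noncomputable def foundIndex {L r : ℕ} (y : Fin ((1 + L) * r) → ℝ) (j : Fin r) : ℕ :=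
  ∑ i : Fin L,
    if |idEntry y 0 j - idEntry y (Fin.natAdd 1 i) j| < |idEntry y (Fin.natAdd 1 i) j|
    then 2 ^ i.val else 0

open Classical in
/-- Phase 1, the set of all identified indices (those that index a coordinate). -/
noncomputable def identified {L r : ℕ} (N : ℕ) (y : Fin ((1 + L) * r) → ℝ) : Finset (Fin N) :=
  Finset.univ.filter (fun n => ∃ j, foundIndex y j = n.val)

/-- `v` is a median of the multiset `s` (no constraint when `s` is empty). -/
def IsMedian (s : Multiset ℝ) (v : ℝ) : Prop :=
  s.card ≤ 2 * s.countP (fun u => u ≤ v) ∧ s.card ≤ 2 * s.countP (fun u => v ≤ u)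

/-- The multiset of the measurements whose row has a one in column `n`. -/
def columnValues {b N : ℕ} (A : Matrix (Fin b) (Fin N) Bool) (y : Fin b → ℝ) (n : Fin N) :
    Multiset ℝ :=
  (Finset.univ.filter (fun i => A i n = true)).val.map y

open Classical in
/-- Phase 2: `z` is a possible output for the index set `S`: estimate every `n ∈ S` by a median,
and keep the `2 k` largest nonzero estimates (all of them if there are fewer), ties being broken
in any way. -/
def IsEstimate {b N : ℕ} (A : Matrix (Fin b) (Fin N) Bool) (y : Fin b → ℝ)
    (S : Finset (Fin N)) (k : ℕ) (z : Fin N → ℝ) : Prop :=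
  ∃ w : Fin N → ℝ, (∀ n ∈ S, IsMedian (columnValues A y n) (w n)) ∧
    ∃ T ⊆ S.filter (fun n => w n ≠ 0),
      T.card = min (2 * k) (S.filter (fun n => w n ≠ 0)).card ∧
      (∀ i ∈ T, ∀ j ∈ S.filter (fun n => w n ≠ 0), j ∉ T → |w j| ≤ |w i|) ∧
      z = fun n => if n ∈ T then w n else 0

/-- The whole recovery algorithm: `z` is a possible output for the estimation matrix `A`, the
estimation measurements `y` and the identification measurements `u`. -/
def IsRecovery {b L r N : ℕ} (A : Matrix (Fin b) (Fin N) Bool) (y : Fin b → ℝ)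
    (u : Fin ((1 + L) * r) → ℝ) (k : ℕ) (z : Fin N → ℝ) : Prop :=
  IsEstimate A y (identified N u) k z

/-- Every possible output of the algorithm on the measurements of `x` by the identification matrix
`B` (combined with bit tests) and the estimation matrix `A` satisfies the error guarantee. -/
def RecoverySucceeds {r b N : ℕ} (B : Matrix (Fin r) (Fin N) Bool)
    (A : Matrix (Fin b) (Fin N) Bool) (x xk xt : Fin N → ℝ) (k : ℕ) (ε : ℝ) : Prop :=
  ∀ z, IsRecovery A (estMeasurements A x) (idMeasurements B x) k z → ErrorBound x xk xt k ε z

/-- The same with `S = [N]` and without identification. -/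
def EstimationSucceeds {b N : ℕ} (A : Matrix (Fin b) (Fin N) Bool)
    (x xk xt : Fin N → ℝ) (k : ℕ) (ε : ℝ) : Prop :=
  ∀ z, IsEstimate A (estMeasurements A x) Finset.univ k z → ErrorBound x xk xt k ε z

/-! ## A real random access machine with unit cost arithmetic

The memory consists of arrays of natural numbers and arrays of real numbers. The array used by an
instruction is named in the program text, the position in the array is computed. -/

structure RamState where
  nat : ℕ → ℕ → ℕ
  real : ℕ → ℕ → ℝ

/-- Natural number expressions: `get a e` is the entry at position `e` of array `a`. -/
inductive NatExpr where
  | const (c : ℕ)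
  | get (a : ℕ) (e : NatExpr)
  | add (e f : NatExpr)
  | sub (e f : NatExpr)
  | mul (e f : NatExpr)
  | div (e f : NatExpr)
  | mod (e f : NatExpr)

def NatExpr.eval (s : RamState) : NatExpr → ℕ
  | .const c => c
  | .get a e => s.nat a (e.eval s)
  | .add e f => e.eval s + f.eval s
  | .sub e f => e.eval s - f.eval s
  | .mul e f => e.eval s * f.eval s
  | .div e f => e.eval s / f.eval s
  | .mod e f => e.eval s % f.eval s

/-- The cost of evaluating an expression is the number of operations in it. -/
def NatExpr.cost : NatExpr → ℕ
  | .const _ => 1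
  | .get _ e => e.cost + 1
  | .add e f => e.cost + f.cost + 1
  | .sub e f => e.cost + f.cost + 1
  | .mul e f => e.cost + f.cost + 1
  | .div e f => e.cost + f.cost + 1
  | .mod e f => e.cost + f.cost + 1

inductive RealExpr where
  | ofNat (e : NatExpr)
  | get (a : ℕ) (e : NatExpr)
  | add (e f : RealExpr)
  | sub (e f : RealExpr)
  | mul (e f : RealExpr)
  | div (e f : RealExpr)

noncomputable def RealExpr.eval (s : RamState) : RealExpr → ℝ
  | .ofNat e => (e.eval s : ℝ)
  | .get a e => s.real a (e.eval s)
  | .add e f => e.eval s + f.eval s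
  | .sub e f => e.eval s - f.eval s
  | .mul e f => e.eval s * f.eval s
  | .div e f => e.eval s / f.eval s

def RealExpr.cost : RealExpr → ℕ
  | .ofNat e => e.cost + 1
  | .get _ e => e.cost + 1
  | .add e f => e.cost + f.cost + 1
  | .sub e f => e.cost + f.cost + 1
  | .mul e f => e.cost + f.cost + 1
  | .div e f => e.cost + f.cost + 1

/-- Tests. -/
inductive RamTest where
  | natLt (e f : NatExpr)
  | natEq (e f : NatExpr)
  | realLt (e f : RealExpr)
  | not (b : RamTest)
  | and (b c : RamTest)

def RamTest.Holds (s : RamState) : RamTest → Prop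
  | .natLt e f => e.eval s < f.eval s
  | .natEq e f => e.eval s = f.eval s
  | .realLt e f => e.eval s < f.eval s
  | .not b => ¬ b.Holds s
  | .and b c => b.Holds s ∧ c.Holds s

def RamTest.cost : RamTest → ℕ
  | .natLt e f => e.cost + f.cost + 1
  | .natEq e f => e.cost + f.cost + 1
  | .realLt e f => e.cost + f.cost + 1
  | .not b => b.cost + 1
  | .and b c => b.cost + c.cost + 1

/-- Commands; `call i` runs the `i`-th procedure of the program. -/
inductive RamCmd where
  | nop
  | setNat (a : ℕ) (pos e : NatExpr)
  | setReal (a : ℕ) (pos : NatExpr) (e : RealExpr)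
  | seq (c d : RamCmd)
  | branch (b : RamTest) (c d : RamCmd)
  | loop (b : RamTest) (c : RamCmd)
  | call (i : ℕ)

def RamState.setNat (s : RamState) (a i v : ℕ) : RamState :=
  { s with nat := Function.update s.nat a (Function.update (s.nat a) i v) }

noncomputable def RamState.setReal (s : RamState) (a i : ℕ) (v : ℝ) : RamState :=
  { s with real := Function.update s.real a (Function.update (s.real a) i v) }

/-- A program: finitely many (possibly recursive) procedures and a main command. -/
structure RamProgram where
  procs : List RamCmd
  main : RamCmd

/-- `RamExec procs c s s' T`: started in state `s`, command `c` halts in state `s'` after exactly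
`T` steps. -/
inductive RamExec (procs : List RamCmd) : RamCmd → RamState → RamState → ℕ → Prop where
  | nop (s : RamState) : RamExec procs .nop s s 1
  | setNat (s : RamState) (a : ℕ) (pos e : NatExpr) :
      RamExec procs (.setNat a pos e) s (s.setNat a (pos.eval s) (e.eval s))
        (pos.cost + e.cost + 1)
  | setReal (s : RamState) (a : ℕ) (pos : NatExpr) (e : RealExpr) :
      RamExec procs (.setReal a pos e) s (s.setReal a (pos.eval s) (e.eval s))
        (pos.cost + e.cost + 1)
  | seq {c d : RamCmd} {s s' s'' : RamState} {T T' : ℕ} :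
      RamExec procs c s s' T → RamExec procs d s' s'' T' →
      RamExec procs (.seq c d) s s'' (T + T')
  | branchTrue {b : RamTest} {c d : RamCmd} {s s' : RamState} {T : ℕ} :
      b.Holds s → RamExec procs c s s' T → RamExec procs (.branch b c d) s s' (b.cost + T + 1)
  | branchFalse {b : RamTest} {c d : RamCmd} {s s' : RamState} {T : ℕ} :
      ¬ b.Holds s → RamExec procs d s s' T → RamExec procs (.branch b c d) s s' (b.cost + T + 1)
  | loopStop {b : RamTest} {c : RamCmd} {s : RamState} :
      ¬ b.Holds s → RamExec procs (.loop b c) s s (b.cost + 1)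
  | loopStep {b : RamTest} {c : RamCmd} {s s' s'' : RamState} {T T' : ℕ} :
      b.Holds s → RamExec procs c s s' T → RamExec procs (.loop b c) s' s'' T' →
      RamExec procs (.loop b c) s s'' (b.cost + T + T' + 1)
  | call {i : ℕ} {c : RamCmd} {s s' : RamState} {T : ℕ} :
      procs[i]? = some c → RamExec procs c s s' T → RamExec procs (.call i) s s' (T + 1)

/-- The sparse vector that a final state represents: the number of listed pairs is in position `0`
of array `3`, their indices are in array `4`, and their values are in real array `2`. -/
noncomputable def RamState.output (s : RamState) (N : ℕ) : Fin N → ℝ :=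
  fun n => ∑ i ∈ Finset.range (s.nat 3 0), if s.nat 4 i = n.val then s.real 2 i else 0

/-- On input `s` the program halts after exactly `T` steps with output `z`. -/
def RamProgram.Runs (prog : RamProgram) {N : ℕ} (s : RamState) (T : ℕ) (z : Fin N → ℝ) : Prop :=
  ∃ s' : RamState, RamExec prog.procs prog.main s s' T ∧ s'.output N = z

/-- A finite vector as the content of an array, followed by zeros. -/
def arrayOf {R : Type*} [Zero R] {n : ℕ} (y : Fin n → R) : ℕ → R :=
  fun i => if h : i < n then y ⟨i, h⟩ else 0

/-- For each column of `A` the increasing list of the rows with a one in it. -/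
def columnLists {b N : ℕ} (A : Matrix (Fin b) (Fin N) Bool) : List (List ℕ) :=
  List.ofFn (fun n : Fin N => ((List.finRange b).filter (fun i => A i n)).map Fin.val)

/-- Input of Phase 2 alone: the numbers `N, k, b`, the matrix in compressed column format (the
rows of the ones in column `n` are the entries of array `2` from position `(array 1)[n]` up to and
excluding position `(array 1)[n + 1]`), and the measurements `y`. -/
def estimationInput {b N : ℕ} (k : ℕ) (A : Matrix (Fin b) (Fin N) Bool) (y : Fin b → ℝ) :
    RamState where
  nat := fun a => match a with
    | 0 => arrayOf ![N, k, b]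
    | 1 => fun n => ((columnLists A).take n).flatten.length
    | 2 => fun i => (columnLists A).flatten.getD i 0
    | _ => fun _ => 0
  real := fun a => match a with
    | 0 => arrayOf y
    | _ => fun _ => 0

/-- Input of the whole algorithm when estimation uses blocks of a DeVore matrix: the numbers
`N, k, r, P, b`, the block indices, and both measurement vectors. -/
def recoveryInput {r P b : ℕ} (N k : ℕ) (s : Fin b → Fin P)
    (u : Fin ((1 + Nat.clog 2 N) * r) → ℝ) (y : Fin (b * P) → ℝ) : RamState where
  nat := fun a => match a with
    | 0 => arrayOf ![N, k, r, P, b]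
    | 1 => arrayOf (fun i => (s i).val)
    | _ => fun _ => 0
  real := fun a => match a with
    | 0 => arrayOf u
    | 1 => arrayOf y
    | _ => fun _ => 0

/-! Let `δ = ε ‖x - xt‖₁ / k` be the noise level and `U` the support of `xt`, so that `U` has at
most `t = k / ε` elements and the entries of `x` outside `U` have total magnitude at most `δ t`. A
row with a one in column `n` is bad for `n` if the other entries it measures have total magnitude
above `δ`. Such a row either meets another column of `U`, and by coherence at most `α t` rows do, or
it collects more than `δ` from outside `U`, and double counting the outside mass shows that again at
most `α t` rows do (`badCount_le`). Since `K` exceeds `α t` by a large constant factor, only a small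
fraction of the ones of each column lies in bad rows. A good row measures `x n` up to `δ`. Hence a
median over a majority of good rows is within `δ` of `x n` (`abs_sub_le_of_isMedian`), and if `|x n|
> δ`, one good row already spells out the binary digits of `n` (`foundIndex_eq_of_isGoodRow`).
Keeping the `2 k` largest estimates then costs at most `4 δ √k` more than the best `k` terms
(`lpNormOf_sub_le_of_isEstimate`).

Sampling rows or blocks preserves the majority of good rows for a given index up to an exponentially
small probability (`card_good_le_bad_le`). At most `2 t` entries exceed `δ`, and identification need
only succeed for these; estimation need only succeed for the indices found, of which there are at
most as many as identification rows, and which are fixed before the second sample is drawn. The two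
union bounds thus run over these index sets instead of all of `[N]`, which is what makes few samples
suffice.

The DeVore matrices are coherent because two distinct polynomials of degree at most `log_P N` over
the field with `P` elements agree in at most `log_P N` points (`card_ofDigits_eq_le`). For the
Bernoulli matrices the numbers of ones in columns and in pairs of columns are binomial, and
exponential moments together with a union bound give the claim (`ofReal_le_bernLaw`). If `k ≥ c₀ ln
N`, then `P` and the number of identification rows of the DeVore matrix are polynomially bounded in
`t` (and in `1 + log_T (1 / (1 - σ))`), so their logarithms are controlled by `ln T` and `ln (1 / (1
- σ))`.

The running times rest on selection in linear time by medians of groups of five (`selectBody_spec`),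
used for the medians and for the threshold of the `2 k` largest estimates. Programs are analysed
through total correctness statements with step bounds, `Reaches`, loop invariants, and syntactically
checked frames. -/

/-! ## Reasoning about programs -/

/-- Started in `s`, command `c` halts within `B` steps in a state satisfying `Q`. -/
def Reaches (procs : List RamCmd) (c : RamCmd) (s : RamState) (B : ℕ)
    (Q : RamState → Prop) : Prop :=
  ∃ s' T, RamExec procs c s s' T ∧ T ≤ B ∧ Q s'

namespace Reaches

variable {procs : List RamCmd} {c d : RamCmd} {s : RamState} {B B' : ℕ}
  {Q R : RamState → Prop}

theorem mono (h : Reaches procs c s B R) (hB : B ≤ B') (hQ : ∀ s', R s' → Q s') :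
    Reaches procs c s B' Q := by
  obtain ⟨s', T, h1, h2, h3⟩ := h
  exact ⟨s', T, h1, h2.trans hB, hQ _ h3⟩

theorem seq (h : Reaches procs c s B R) (h' : ∀ s', R s' → Reaches procs d s' B' Q) :
    Reaches procs (.seq c d) s (B + B') Q := by
  obtain ⟨s', T, h1, h2, h3⟩ := h
  obtain ⟨s'', T', h1', h2', h3'⟩ := h' s' h3
  exact ⟨s'', T + T', .seq h1 h1', by omega, h3'⟩

theorem branch {b : RamTest} (hB : b.cost + B + 1 ≤ B') (ht : b.Holds s → Reaches procs c s B Q)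
    (hf : ¬ b.Holds s → Reaches procs d s B Q) :
    Reaches procs (.branch b c d) s B' Q := by
  by_cases h : b.Holds s
  · obtain ⟨s', T, h1, h2, h3⟩ := ht h
    exact ⟨s', _, .branchTrue h h1, by omega, h3⟩
  · obtain ⟨s', T, h1, h2, h3⟩ := hf h
    exact ⟨s', _, .branchFalse h h1, by omega, h3⟩

theorem call {i : ℕ} (hc : procs[i]? = some c) (h : Reaches procs c s B Q) :
    Reaches procs (.call i) s (B + 1) Q := by
  obtain ⟨s', T, h1, h2, h3⟩ := h
  exact ⟨s', _, .call hc h1, by omega, h3⟩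

theorem loop_seq_of_not {b : RamTest} (hb : ¬ b.Holds s) (h : Reaches procs d s B Q) :
    Reaches procs (.seq (.loop b c) d) s (b.cost + 1 + B) Q := by
  obtain ⟨s', T, h1, h2, h3⟩ := h
  exact ⟨s', _, .seq (.loopStop hb) h1, by omega, h3⟩

/-- Unrolling one round leaves the same loop followed by `d`. For a recursive body of this shape the
rest of the execution is again the whole body, so an induction hypothesis about the body applies to
it and the number of rounds need not be known. -/
theorem loop_seq_of_holds {b : RamTest} (hb : b.Holds s)
    (h : Reaches procs c s B fun s' => Reaches procs (.seq (.loop b c) d) s' B' Q) :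
    Reaches procs (.seq (.loop b c) d) s (b.cost + 1 + B + B') Q := by
  obtain ⟨s', T, h1, h2, s'', T', h1', h2', h3⟩ := h
  cases h1' with
  | seq hl hd => exact ⟨_, _, .seq (.loopStep hb h1 hl) hd, by omega, h3⟩

/-- `I j` holds before round `j`, and `f j` pays for that round; the trailing `b.cost + 1` is the
final failing test. Shifting `I` and `f` by one turns the rest of the loop into a loop of one round
less. -/
theorem loop {b : RamTest} (I : ℕ → RamState → Prop) (f : ℕ → ℕ) (n : ℕ)
    (hstep : ∀ j < n, ∀ s, I j s → b.Holds s ∧ Reaches procs c s (f j) (I (j + 1)))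
    (hend : ∀ s, I n s → ¬ b.Holds s) (h0 : I 0 s) :
    Reaches procs (.loop b c) s (∑ j ∈ Finset.range n, (f j + b.cost + 1) + b.cost + 1) (I n) := by
  induction n generalizing I f s with
  | zero => exact ⟨s, _, .loopStop (hend s h0), by simp, h0⟩
  | succ n ih =>
    obtain ⟨hb, s', T, h1, h2, h3⟩ := hstep 0 (by omega) s h0
    obtain ⟨s'', T', h1', h2', h3'⟩ := ih (s := s') (fun j => I (j + 1)) (fun j => f (j + 1))
      (fun j hj s hs => hstep (j + 1) (by omega) s hs) hend h3
    refine ⟨s'', _, .loopStep hb h1 h1', ?_, h3'⟩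
    rw [Finset.sum_range_succ']
    omega

end Reaches

/-! ### Commands without loops and calls -/

/-- Commands without loops and calls. -/
def RamCmd.simple : RamCmd → Bool
  | .nop => true
  | .setNat _ _ _ => true
  | .setReal _ _ _ => true
  | .seq c d => c.simple && d.simple
  | .branch _ c d => c.simple && d.simple
  | .loop _ _ => false
  | .call _ => false

/-- An upper bound for the number of steps of a command without loops and calls. -/
def RamCmd.maxCost : RamCmd → ℕ
  | .nop => 1
  | .setNat _ pos e => pos.cost + e.cost + 1
  | .setReal _ pos e => pos.cost + e.cost + 1
  | .seq c d => c.maxCost + d.maxCost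
  | .branch b c d => b.cost + max c.maxCost d.maxCost + 1
  | .loop _ _ => 0
  | .call _ => 0

open Classical in
/-- The final state of a command without loops and calls. -/
noncomputable def RamCmd.post : RamCmd → RamState → RamState
  | .nop, s => s
  | .setNat a pos e, s => s.setNat a (pos.eval s) (e.eval s)
  | .setReal a pos e, s => s.setReal a (pos.eval s) (e.eval s)
  | .seq c d, s => d.post (c.post s)
  | .branch b c d, s => if b.Holds s then c.post s else d.post s
  | .loop _ _, s => s
  | .call _, s => s

/-- Straight-line code can be executed symbolically: its correctness becomes an equation about the
explicit state `c.post s`, to be settled by `simp`. -/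
theorem RamCmd.reaches_post {procs : List RamCmd} {c : RamCmd} (hc : c.simple = true)
    (s : RamState) : Reaches procs c s c.maxCost (fun s' => s' = c.post s) := by
  induction c generalizing s with
  | nop => exact ⟨_, _, .nop s, le_rfl, rfl⟩
  | setNat a pos e => exact ⟨_, _, .setNat s a pos e, le_rfl, rfl⟩
  | setReal a pos e => exact ⟨_, _, .setReal s a pos e, le_rfl, rfl⟩
  | seq c d ihc ihd =>
    simp only [simple, Bool.and_eq_true] at hc
    exact (ihc hc.1 s).seq (fun s' hs' => by subst hs'; exact ihd hc.2 _)
  | branch b c d ihc ihd =>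
    simp only [simple, Bool.and_eq_true] at hc
    refine Reaches.branch le_rfl (fun h => ?_) (fun h => ?_)
    · exact (ihc hc.1 s).mono (le_max_left _ _) (by simp [post, h])
    · exact (ihd hc.2 s).mono (le_max_right _ _) (by simp [post, h])
  | loop b c => simp [simple] at hc
  | call i => simp [simple] at hc

theorem Reaches.of_simple {procs : List RamCmd} {c : RamCmd} {s : RamState} {B : ℕ}
    {Q : RamState → Prop} (hc : c.simple = true) (hB : c.maxCost ≤ B) (h : Q (c.post s)) :
    Reaches procs c s B Q :=
  (RamCmd.reaches_post hc s).mono hB (by rintro _ rfl; exact h)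

theorem RamState.setNat_nat (s : RamState) (a i v b : ℕ) :
    (s.setNat a i v).nat b = if b = a then Function.update (s.nat a) i v else s.nat b := by
  simp only [setNat, Function.update_apply]

theorem RamState.setNat_real (s : RamState) (a i v : ℕ) : (s.setNat a i v).real = s.real := rfl

theorem RamState.setReal_real (s : RamState) (a i : ℕ) (v : ℝ) (b : ℕ) :
    (s.setReal a i v).real b = if b = a then Function.update (s.real a) i v else s.real b := by
  simp only [setReal, Function.update_apply]

theorem RamState.setReal_nat (s : RamState) (a i : ℕ) (v : ℝ) : (s.setReal a i v).nat = s.nat := rfl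

/-- The entry at position `0` of an array of natural numbers. -/
abbrev NatExpr.var (a : ℕ) : NatExpr := .get a (.const 0)

/-- Assignment to the entry at position `0` of an array of natural numbers. -/
abbrev RamCmd.assign (a : ℕ) (e : NatExpr) : RamCmd := .setNat a (.const 0) e

/-- Addition of a constant to the entry at position `0` of an array of natural numbers. -/
abbrev RamCmd.incr (a : ℕ) : RamCmd := .setNat a (.const 0) (.add (.var a) (.const 1))

/-! ### Frames -/

/-- The states `s` and `s'` agree outside the arrays of natural numbers `n₁, …, n₂ - 1` and the
arrays of real numbers `r₁, …, r₂ - 1`. -/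
def Frame (n₁ n₂ r₁ r₂ : ℕ) (s s' : RamState) : Prop :=
  (∀ a, a < n₁ ∨ n₂ ≤ a → s'.nat a = s.nat a) ∧ (∀ a, a < r₁ ∨ r₂ ≤ a → s'.real a = s.real a)

theorem Frame.refl {n₁ n₂ r₁ r₂ : ℕ} (s : RamState) : Frame n₁ n₂ r₁ r₂ s s :=
  ⟨fun _ _ => rfl, fun _ _ => rfl⟩

theorem Frame.trans {n₁ n₂ r₁ r₂ : ℕ} {s s' s'' : RamState} (h : Frame n₁ n₂ r₁ r₂ s s')
    (h' : Frame n₁ n₂ r₁ r₂ s' s'') : Frame n₁ n₂ r₁ r₂ s s'' :=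
  ⟨fun a ha => (h'.1 a ha).trans (h.1 a ha), fun a ha => (h'.2 a ha).trans (h.2 a ha)⟩

theorem Frame.mono {n₁ n₂ r₁ r₂ m₁ m₂ q₁ q₂ : ℕ} {s s' : RamState} (h : Frame n₁ n₂ r₁ r₂ s s')
    (h1 : m₁ ≤ n₁) (h2 : n₂ ≤ m₂) (h3 : q₁ ≤ r₁) (h4 : r₂ ≤ q₂) : Frame m₁ m₂ q₁ q₂ s s' :=
  ⟨fun a ha => h.1 a (by omega), fun a ha => h.2 a (by omega)⟩

/-- All assignments in the command are to the arrays `n₁, …, n₂ - 1` of natural numbers and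
`r₁, …, r₂ - 1` of real numbers. -/
def RamCmd.framed (n₁ n₂ r₁ r₂ : ℕ) : RamCmd → Bool
  | .nop => true
  | .setNat a _ _ => decide (n₁ ≤ a) && decide (a < n₂)
  | .setReal a _ _ => decide (r₁ ≤ a) && decide (a < r₂)
  | .seq c d => c.framed n₁ n₂ r₁ r₂ && d.framed n₁ n₂ r₁ r₂
  | .branch _ c d => c.framed n₁ n₂ r₁ r₂ && d.framed n₁ n₂ r₁ r₂
  | .loop _ c => c.framed n₁ n₂ r₁ r₂
  | .call _ => true

/-- The arrays that may change are read off from the program text. A call can run any procedure, so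
all of them have to respect the frame. -/
theorem RamExec.frame {procs : List RamCmd} {n₁ n₂ r₁ r₂ : ℕ} {c : RamCmd} {s s' : RamState} {T : ℕ}
    (h : RamExec procs c s s' T) (hp : ∀ d ∈ procs, d.framed n₁ n₂ r₁ r₂ = true)
    (hc : c.framed n₁ n₂ r₁ r₂ = true) : Frame n₁ n₂ r₁ r₂ s s' := by
  induction h with
  | nop s => exact Frame.refl s
  | setNat s a pos e =>
    simp only [RamCmd.framed, Bool.and_eq_true, decide_eq_true_eq] at hc
    exact ⟨fun b hb => by rw [RamState.setNat_nat, if_neg (by omega)], fun b hb => rfl⟩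
  | setReal s a pos e =>
    simp only [RamCmd.framed, Bool.and_eq_true, decide_eq_true_eq] at hc
    exact ⟨fun b hb => rfl, fun b hb => by rw [RamState.setReal_real, if_neg (by omega)]⟩
  | seq _ _ ih1 ih2 =>
    simp only [RamCmd.framed, Bool.and_eq_true] at hc
    exact (ih1 hc.1).trans (ih2 hc.2)
  | branchTrue _ _ ih =>
    simp only [RamCmd.framed, Bool.and_eq_true] at hc
    exact ih hc.1
  | branchFalse _ _ ih =>
    simp only [RamCmd.framed, Bool.and_eq_true] at hc
    exact ih hc.2
  | loopStop _ => exact Frame.refl _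
  | loopStep _ _ _ ih1 ih2 => exact (ih1 hc).trans (ih2 hc)
  | call hi _ ih => exact ih (hp _ (List.mem_of_getElem? hi))

/-- With an empty procedure list no call succeeds, so the derivation contains none and remains valid
for every list. Code without calls can thus be framed tightly, the condition on the procedures being
vacuous. -/
theorem RamExec.weaken {procs : List RamCmd} {c : RamCmd} {s s' : RamState} {T : ℕ}
    (h : RamExec [] c s s' T) : RamExec procs c s s' T := by
  induction h with
  | nop s => exact .nop s
  | setNat s a pos e => exact .setNat s a pos e
  | setReal s a pos e => exact .setReal s a pos e
  | seq _ _ ih1 ih2 => exact .seq ih1 ih2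
  | branchTrue h _ ih => exact .branchTrue h ih
  | branchFalse h _ ih => exact .branchFalse h ih
  | loopStop h => exact .loopStop h
  | loopStep h _ _ ih1 ih2 => exact .loopStep h ih1 ih2
  | call hi _ _ => simp at hi

namespace Reaches

variable {procs : List RamCmd} {c d : RamCmd} {s : RamState} {B B' : ℕ}
  {Q R : RamState → Prop}

theorem frame (h : Reaches procs c s B Q) (n₁ n₂ r₁ r₂ : ℕ)
    (hp : ∀ d ∈ procs, d.framed n₁ n₂ r₁ r₂ = true) (hc : c.framed n₁ n₂ r₁ r₂ = true) :
    Reaches procs c s B fun s' => Frame n₁ n₂ r₁ r₂ s s' ∧ Q s' := by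
  obtain ⟨s', T, h1, h2, h3⟩ := h
  exact ⟨s', T, h1, h2, h1.frame hp hc, h3⟩

/-- Carrying the frame along in the invariant allows `I` to speak only of what the loop changes; all
other arrays are compared with the initial state `s`. -/
theorem loop_frame {b : RamTest} (n₁ n₂ r₁ r₂ : ℕ)
    (hp : ∀ d ∈ procs, d.framed n₁ n₂ r₁ r₂ = true) (hc : c.framed n₁ n₂ r₁ r₂ = true)
    (I : ℕ → RamState → Prop) (f : ℕ → ℕ) (n : ℕ)
    (hB : ∑ j ∈ Finset.range n, (f j + b.cost + 1) + b.cost + 1 ≤ B) (h0 : I 0 s)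
    (hstep : ∀ j < n, ∀ s', Frame n₁ n₂ r₁ r₂ s s' → I j s' →
      b.Holds s' ∧ Reaches procs c s' (f j) (I (j + 1)))
    (hend : ∀ s', Frame n₁ n₂ r₁ r₂ s s' → I n s' → ¬ b.Holds s' ∧ Q s') :
    Reaches procs (.loop b c) s B Q :=
  (loop (fun j s' => Frame n₁ n₂ r₁ r₂ s s' ∧ I j s') f n
    (fun j hj s' hs' => ⟨(hstep j hj s' hs'.1 hs'.2).1,
      ((hstep j hj s' hs'.1 hs'.2).2.frame n₁ n₂ r₁ r₂ hp hc).mono le_rfl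
        fun _ h => ⟨hs'.1.trans h.1, h.2⟩⟩)
    (fun s' hs' => (hend s' hs'.1 hs'.2).1) ⟨Frame.refl s, h0⟩).mono hB
    fun s' hs' => (hend s' hs'.1 hs'.2).2

theorem loop_frame_const {b : RamTest} (n₁ n₂ r₁ r₂ : ℕ)
    (hp : ∀ d ∈ procs, d.framed n₁ n₂ r₁ r₂ = true) (hc : c.framed n₁ n₂ r₁ r₂ = true)
    (I : ℕ → RamState → Prop) (D n : ℕ) (hB : n * (D + b.cost + 1) + b.cost + 1 ≤ B) (h0 : I 0 s)
    (hstep : ∀ j < n, ∀ s', Frame n₁ n₂ r₁ r₂ s s' → I j s' →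
      b.Holds s' ∧ Reaches procs c s' D (I (j + 1)))
    (hend : ∀ s', Frame n₁ n₂ r₁ r₂ s s' → I n s' → ¬ b.Holds s' ∧ Q s') :
    Reaches procs (.loop b c) s B Q :=
  loop_frame n₁ n₂ r₁ r₂ hp hc I (fun _ => D) n (by simpa using hB) h0 hstep hend

theorem weaken (h : Reaches [] c s B Q) : Reaches procs c s B Q := by
  obtain ⟨s', T, h1, h2, h3⟩ := h
  exact ⟨s', T, h1.weaken, h2, h3⟩

/-- A loop whose body contains neither loops nor calls. -/
theorem loop_simple {b : RamTest} (n₁ n₂ r₁ r₂ : ℕ) (hs : c.simple = true)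
    (hc : c.framed n₁ n₂ r₁ r₂ = true) (I : ℕ → RamState → Prop) (n : ℕ)
    (hB : n * (c.maxCost + b.cost + 1) + b.cost + 1 ≤ B) (h0 : I 0 s)
    (hstep : ∀ j < n, ∀ s', Frame n₁ n₂ r₁ r₂ s s' → I j s' → b.Holds s' ∧ I (j + 1) (c.post s'))
    (hend : ∀ s', Frame n₁ n₂ r₁ r₂ s s' → I n s' → ¬ b.Holds s' ∧ Q s') :
    Reaches procs (.loop b c) s B Q := by
  exact weaken (loop_frame_const n₁ n₂ r₁ r₂ (by simp) hc I c.maxCost n hB h0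
    (fun j hj s' hF hI => ⟨(hstep j hj s' hF hI).1, .of_simple hs le_rfl (hstep j hj s' hF hI).2⟩)
    hend)

theorem _root_.RamCmd.frame_post {n₁ n₂ r₁ r₂ : ℕ} (hs : c.simple = true)
    (hc : c.framed n₁ n₂ r₁ r₂ = true) (s : RamState) : Frame n₁ n₂ r₁ r₂ s (c.post s) := by
  obtain ⟨s', T, h1, -, rfl⟩ := RamCmd.reaches_post (procs := []) hs s
  exact h1.frame (by simp) hc

/-- The sequence of a command without loops and calls and another command. -/
theorem simple_seq (n₁ n₂ r₁ r₂ : ℕ) (hs : c.simple = true) (hc : c.framed n₁ n₂ r₁ r₂ = true)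
    (hB : c.maxCost + B' ≤ B)
    (h : Frame n₁ n₂ r₁ r₂ s (c.post s) → Reaches procs d (c.post s) B' Q) :
    Reaches procs (.seq c d) s B Q := by
  exact (seq (RamCmd.reaches_post hs s) (fun s' hs' => by
    subst hs'; exact h (RamCmd.frame_post hs hc s))).mono hB fun _ => id

end Reaches

/-! ## Ranks -/

open Classical in
/-- The number of `j < n` with `p j`. -/
noncomputable def countBelow (p : ℕ → Prop) (n : ℕ) : ℕ := Nat.count p n

theorem countBelow_zero (p : ℕ → Prop) : countBelow p 0 = 0 := by
  classical exact Nat.count_zero p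

open Classical in
theorem countBelow_succ (p : ℕ → Prop) (n : ℕ) :
    countBelow p (n + 1) = countBelow p n + if p n then 1 else 0 := Nat.count_succ p n

theorem countBelow_add (p : ℕ → Prop) (a b : ℕ) :
    countBelow p (a + b) = countBelow p a + countBelow (fun k => p (a + k)) b := by
  induction b with
  | zero => simp [countBelow_zero]
  | succ b ih => rw [← add_assoc, countBelow_succ, ih, countBelow_succ, add_assoc]

theorem countBelow_le (p : ℕ → Prop) (n : ℕ) : countBelow p n ≤ n := by
  induction n with
  | zero => simp [countBelow_zero]
  | succ n ih => rw [countBelow_succ]; split_ifs <;> omega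

theorem countBelow_mono {p q : ℕ → Prop} {n : ℕ} (h : ∀ j < n, p j → q j) :
    countBelow p n ≤ countBelow q n := by
  induction n with
  | zero => simp [countBelow_zero]
  | succ n ih =>
    rw [countBelow_succ, countBelow_succ]
    have h1 := ih (fun j hj => h j (by omega))
    have h2 := h n (by omega)
    split_ifs <;> first | omega | tauto

theorem countBelow_congr {p q : ℕ → Prop} {n : ℕ} (h : ∀ j < n, (p j ↔ q j)) :
    countBelow p n = countBelow q n :=
  le_antisymm (countBelow_mono fun j hj => (h j hj).1) (countBelow_mono fun j hj => (h j hj).2)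

theorem countBelow_le_of_le (p : ℕ → Prop) {m n : ℕ} (h : m ≤ n) :
    countBelow p m ≤ countBelow p n := by
  obtain ⟨k, rfl⟩ := Nat.exists_eq_add_of_le h
  rw [countBelow_add]; omega

theorem countBelow_not (p : ℕ → Prop) (n : ℕ) :
    countBelow p n + countBelow (fun j => ¬ p j) n = n := by
  induction n with
  | zero => simp [countBelow_zero]
  | succ n ih => rw [countBelow_succ, countBelow_succ]; split_ifs <;> omega

theorem countBelow_or {p q : ℕ → Prop} {n : ℕ} (h : ∀ j < n, ¬ (p j ∧ q j)) :
    countBelow (fun j => p j ∨ q j) n = countBelow p n + countBelow q n := by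
  induction n with
  | zero => simp [countBelow_zero]
  | succ n ih =>
    rw [countBelow_succ, countBelow_succ, countBelow_succ, ih (fun j hj => h j (by omega))]
    have := h n (by omega)
    split_ifs <;> first | omega | tauto

theorem countBelow_pos {p : ℕ → Prop} {n : ℕ} : 0 < countBelow p n ↔ ∃ j < n, p j := by
  induction n with
  | zero => simp [countBelow_zero]
  | succ n ih =>
    rw [countBelow_succ]
    constructor
    · intro h
      by_cases hp : p n
      · exact ⟨n, by omega, hp⟩
      · obtain ⟨j, hj, hpj⟩ := ih.1 (by simpa [hp] using h)
        exact ⟨j, by omega, hpj⟩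
    · rintro ⟨j, hj, hpj⟩
      by_cases hjn : j = n
      · subst hjn; simp [hpj]
      · have := ih.2 ⟨j, by omega, hpj⟩
        omega

/-- `v` is an element of rank `r` for the values `f 0, …, f (n - 1)`. -/
def IsRank (f : ℕ → ℝ) (n r : ℕ) (v : ℝ) : Prop :=
  countBelow (fun j => f j < v) n ≤ r ∧ r < countBelow (fun j => f j ≤ v) n

theorem IsRank.congr {f g : ℕ → ℝ} {n r : ℕ} {v : ℝ} (h : IsRank f n r v)
    (hfg : ∀ j < n, f j = g j) : IsRank g n r v := by
  unfold IsRank at *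
  rw [countBelow_congr (q := fun j => f j < v) fun j hj => by rw [hfg j hj],
    countBelow_congr (p := fun j => g j ≤ v) (q := fun j => f j ≤ v) fun j hj => by rw [hfg j hj]]
  exact h

/-- The smallest value with more than `r` entries at or below it works. If more than `r` entries
were strictly below it, the largest of these would be a smaller value with the same property. -/
theorem exists_isRank (f : ℕ → ℝ) {n r : ℕ} (hr : r < n) : ∃ i < n, IsRank f n r (f i) := by
  classical
  set S := (Finset.range n).filter (fun i => r < countBelow (fun j => f j ≤ f i) n) with hS
  have hne : S.Nonempty := by
    obtain ⟨i, hi, hmax⟩ := Finset.exists_max_image (Finset.range n) f ⟨0, by simp; omega⟩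
    refine ⟨i, by
      simp only [hS, Finset.mem_filter]
      refine ⟨hi, ?_⟩
      have := countBelow_not (fun j => f j ≤ f i) n
      have h0 : countBelow (fun j => ¬ f j ≤ f i) n = 0 := by
        by_contra h
        obtain ⟨j, hj, hh⟩ := countBelow_pos.1 (Nat.pos_of_ne_zero h)
        exact hh (hmax j (by simpa using hj))
      omega⟩
  obtain ⟨i, hi, hmin⟩ := Finset.exists_min_image S f hne
  simp only [hS, Finset.mem_filter, Finset.mem_range] at hi hmin
  refine ⟨i, hi.1, ?_, hi.2⟩
  by_contra hlt
  push Not at hlt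
  have hpos : 0 < countBelow (fun j => f j < f i) n := by omega
  obtain ⟨j0, hj0, hj0'⟩ := countBelow_pos.1 hpos
  obtain ⟨l, hl, hlmax⟩ := Finset.exists_max_image
    ((Finset.range n).filter (fun j => f j < f i)) f ⟨j0, by simp [hj0, hj0']⟩
  simp only [Finset.mem_filter, Finset.mem_range] at hl hlmax
  have h1 : countBelow (fun j => f j < f i) n ≤ countBelow (fun j => f j ≤ f l) n :=
    countBelow_mono fun j hj h => hlmax j ⟨hj, h⟩
  have := hmin l ⟨hl.1, by omega⟩
  linarith [hl.2]

/-- `hg` says that `g` rearranges the entries of `f` below `p`, expressed by counts of arbitrary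
predicates so that no permutation is needed. An element of rank `r < w` cannot exceed `p`, since
otherwise all `w` entries would lie below it; below `p` the two counts agree. -/
theorem IsRank.of_less {f g : ℕ → ℝ} {n w r : ℕ} {p v : ℝ}
    (hg : ∀ q : ℝ → Prop, countBelow (fun j => q (g j)) w = countBelow (fun j => q (f j) ∧ f j < p) n)
    (hr : r < w) (h : IsRank g w r v) : IsRank f n r v := by
  unfold IsRank at h
  rw [hg (fun y => y < v), hg (fun y => y ≤ v)] at h
  have hw : countBelow (fun j => f j < p) n = w := by
    have h1 := hg (fun _ => True)
    have h2 := countBelow_not (fun _ => True) w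
    have h3 : countBelow (fun _ => ¬ True) w = 0 := by
      by_contra h
      obtain ⟨j, hj, hh⟩ := countBelow_pos.1 (Nat.pos_of_ne_zero h)
      exact hh trivial
    simp only [true_and] at h1
    omega
  have hvp : v ≤ p := by
    by_contra hlt
    push Not at hlt
    have : countBelow (fun j => f j < v ∧ f j < p) n = countBelow (fun j => f j < p) n :=
      countBelow_congr fun j hj => ⟨fun h => h.2, fun h => ⟨h.trans hlt, h⟩⟩
    omega
  constructor
  · refine le_trans (le_of_eq (countBelow_congr fun j hj => ?_)) h.1
    exact ⟨fun h => ⟨h, h.trans_le hvp⟩, fun h => h.1⟩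
  · exact h.2.trans_le (countBelow_mono fun j hj h => h.1)

/-- Some entry above `p` is at most `v`, so `p < v`. The entries up to `p` then all count towards
the rank of `v`, which explains the shift. -/
theorem IsRank.of_greater {f g : ℕ → ℝ} {n w r : ℕ} {p v : ℝ}
    (hg : ∀ q : ℝ → Prop, countBelow (fun j => q (g j)) w = countBelow (fun j => q (f j) ∧ p < f j) n)
    (hr : countBelow (fun j => f j ≤ p) n ≤ r)
    (h : IsRank g w (r - countBelow (fun j => f j ≤ p) n) v) : IsRank f n r v := by
  unfold IsRank at h
  rw [hg (fun y => y < v), hg (fun y => y ≤ v)] at h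
  have hpv : p < v := by
    obtain ⟨j, hj, hh⟩ := countBelow_pos.1 (lt_of_le_of_lt (Nat.zero_le _) h.2)
    exact hh.2.trans_le hh.1
  have h1 := countBelow_or (p := fun j => f j ≤ p) (q := fun j => f j < v ∧ p < f j) (n := n)
    (fun j hj h => absurd h.1 (not_le.2 h.2.2))
  have h2 := countBelow_or (p := fun j => f j ≤ p) (q := fun j => f j ≤ v ∧ p < f j) (n := n)
    (fun j hj h => absurd h.1 (not_le.2 h.2.2))
  constructor
  · refine le_trans (countBelow_mono (q := fun j => f j ≤ p ∨ f j < v ∧ p < f j) ?_) (by omega)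
    intro j hj h
    by_cases hp : f j ≤ p
    · exact Or.inl hp
    · exact Or.inr ⟨h, not_le.1 hp⟩
  · refine lt_of_lt_of_le (b := countBelow (fun j => f j ≤ p ∨ f j ≤ v ∧ p < f j) n) (by omega) ?_
    refine countBelow_mono ?_
    rintro j hj (h | h)
    · exact h.trans hpv.le
    · exact h.1

/-- Each group of five whose median satisfies `q` contributes at least three entries satisfying `q`.
-/
theorem countBelow_groups {f md : ℕ → ℝ} {ng : ℕ} {q : ℝ → Prop}
    (h : ∀ g < ng, q (md g) → 3 ≤ countBelow (fun j => q (f (5 * g + j))) 5) :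
    3 * countBelow (fun g => q (md g)) ng ≤ countBelow (fun j => q (f j)) (5 * ng) := by
  induction ng with
  | zero => simp [countBelow_zero]
  | succ n ih =>
    have h1 := ih (fun g hg => h g (by omega))
    have h2 := h n (by omega)
    rw [mul_add, mul_one, countBelow_add (fun j => q (f j)), countBelow_succ]
    split_ifs with hq
    · have := h2 hq; omega
    · omega

/-- The median of the medians of groups of five is a good pivot. -/
theorem pivot_bounds {f md : ℕ → ℝ} {n : ℕ} {p : ℝ}
    (hmd : ∀ g < n / 5, IsRank (fun j => f (5 * g + j)) 5 2 (md g))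
    (hp : IsRank md (n / 5) (n / 5 / 2) p) :
    countBelow (fun j => f j < p) n + 3 * (n / 5 - n / 5 / 2) ≤ n ∧
      3 * (n / 5 / 2) + 3 ≤ countBelow (fun j => f j ≤ p) n := by
  have hle : 5 * (n / 5) ≤ n := by omega
  constructor
  -- At most `n / 5 / 2` medians lie below `p`; each of the others comes with three entries of its
  -- group that are not below `p`.
  · have h1 := countBelow_groups (f := f) (md := md) (ng := n / 5) (q := fun y => ¬ y < p) (by
      intro g hg hq
      have h2 : countBelow (fun j => f (5 * g + j) < md g) 5 ≤ 2 := (hmd g hg).1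
      have h3 := countBelow_not (fun j => f (5 * g + j) < md g) 5
      have h4 : countBelow (fun j => ¬ f (5 * g + j) < md g) 5 ≤
          countBelow (fun j => ¬ f (5 * g + j) < p) 5 :=
        countBelow_mono fun j hj h hh => h (hh.trans_le (not_lt.1 hq))
      omega)
    have h2 := countBelow_not (fun j => f j < p) n
    have h3 := countBelow_le_of_le (fun j => ¬ f j < p) hle
    have h4 := countBelow_not (fun j => md j < p) (n / 5)
    have h5 := hp.1
    omega
  -- At least `n / 5 / 2 + 1` medians are at most `p`, each with three such entries in its group.
  · have h1 := countBelow_groups (f := f) (md := md) (ng := n / 5) (q := fun y => y ≤ p) (by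
      intro g hg hq
      have h2 : 2 < countBelow (fun j => f (5 * g + j) ≤ md g) 5 := (hmd g hg).2
      have h4 : countBelow (fun j => f (5 * g + j) ≤ md g) 5 ≤
          countBelow (fun j => f (5 * g + j) ≤ p) 5 :=
        countBelow_mono fun j hj h => h.trans hq
      omega)
    have h3 := countBelow_le_of_le (fun j => f j ≤ p) hle
    have h5 := hp.2
    omega


/-! ## Selection in linear time -/

/-- Counts the entries of the segment of the work array (real array `3`) starting at `nat 10` of
length `nat 11` that are below, respectively at most, the pivot (real array `5`). -/
def countCmd : RamCmd :=
  .seq (.seq (.assign 14 (.const 0)) (.seq (.assign 15 (.const 0)) (.assign 16 (.const 0))))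
    (.loop (.natLt (.var 14) (.var 11))
      (.seq (.branch (.realLt (.get 3 (.add (.var 10) (.var 14))) (.get 5 (.const 0)))
          (.incr 15) .nop)
        (.seq (.branch (.realLt (.get 5 (.const 0)) (.get 3 (.add (.var 10) (.var 14))))
          .nop (.incr 16)) (.incr 14))))

theorem countCmd_spec (procs : List RamCmd) (s : RamState) :
    Reaches procs countCmd s (100 * s.nat 11 0 + 100) fun s' =>
      Frame 14 17 5 5 s s' ∧
      s'.nat 15 0 = countBelow (fun j => s.real 3 (s.nat 10 0 + j) < s.real 5 0) (s.nat 11 0) ∧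
      s'.nat 16 0 = countBelow (fun j => s.real 3 (s.nat 10 0 + j) ≤ s.real 5 0) (s.nat 11 0) := by
  unfold countCmd
  set f : ℕ → ℝ := fun j => s.real 3 (s.nat 10 0 + j) with hf
  refine Reaches.simple_seq (B' := 100 * s.nat 11 0 + 50) 14 17 5 5 rfl rfl ?_ fun hF₁ =>
    Reaches.loop_simple 14 17 5 5 rfl rfl (fun j s' => s'.nat 14 0 = j ∧
        s'.nat 15 0 = countBelow (fun j => f j < s.real 5 0) j ∧
        s'.nat 16 0 = countBelow (fun j => f j ≤ s.real 5 0) j) (s.nat 11 0) ?_ ?_ ?_ ?_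
  · simp [RamCmd.maxCost, NatExpr.cost]; omega
  · simp [RamCmd.maxCost, NatExpr.cost, RamTest.cost, RealExpr.cost]; omega
  · simp [RamCmd.post, NatExpr.eval, RamState.setNat_nat, countBelow_zero]
  · rintro j hj s' hF ⟨h14, h15, h16⟩
    replace hF := hF₁.trans hF
    have e10 := hF.1 10 (by norm_num)
    have e11 := hF.1 11 (by norm_num)
    have r3 := hF.2 3 (by norm_num)
    have r5 := hF.2 5 (by norm_num)
    refine ⟨by simp [RamTest.Holds, NatExpr.eval, h14, e11, hj], ?_⟩
    rw [countBelow_succ, countBelow_succ]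
    by_cases h1 : s.real 3 (s.nat 10 0 + j) < s.real 5 0 <;>
      by_cases h2 : s.real 5 0 < s.real 3 (s.nat 10 0 + j)
    · exact absurd (h1.trans h2) (lt_irrefl _)
    all_goals
      first | have h3 := not_le.2 h2 | have h3 := not_lt.1 h2
      simp [RamCmd.post, RamTest.Holds, NatExpr.eval, RealExpr.eval, RamState.setNat_nat,
        RamState.setNat_real, h14, h15, h16, e10, r3, r5, h1, h2, h3, hf]
  · rintro s' hF ⟨h14, h15, h16⟩
    have e11 := (hF₁.trans hF).1 11 (by norm_num)
    refine ⟨by simp [RamTest.Holds, NatExpr.eval, h14, e11], hF₁.trans hF, h15, h16⟩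

/-- Selection of the element of rank `nat 12` in the segment of the work array starting at `nat 10`
of length `nat 11`, by trying all elements. -/
def smallSelectCmd : RamCmd :=
  .seq (.assign 13 (.const 0))
    (.loop (.natLt (.var 13) (.var 11))
      (.seq (.setReal 5 (.const 0) (.get 3 (.add (.var 10) (.var 13))))
        (.seq countCmd
          (.seq (.branch (.and (.not (.natLt (.var 12) (.var 15))) (.natLt (.var 12) (.var 16)))
              (.setReal 4 (.const 0) (.get 5 (.const 0))) .nop)
            (.incr 13)))))

/-- The cost is quadratic, which is harmless: the command only serves groups of five and segments of
fewer than 25 entries. -/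
theorem smallSelectCmd_spec (procs : List RamCmd)
    (hp : ∀ d ∈ procs, d.framed 10 30 3 6 = true) (s : RamState)
    (hr : s.nat 12 0 < s.nat 11 0) :
    Reaches procs smallSelectCmd s (s.nat 11 0 * (100 * s.nat 11 0 + 200) + 10) fun s' =>
      Frame 13 17 4 6 s s' ∧
      IsRank (fun j => s.real 3 (s.nat 10 0 + j)) (s.nat 11 0) (s.nat 12 0) (s'.real 4 0) := by
  unfold smallSelectCmd
  set f : ℕ → ℝ := fun j => s.real 3 (s.nat 10 0 + j) with hf
  set n := s.nat 11 0 with hn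
  set r := s.nat 12 0 with hr'
  -- Once position `i₀` has been tried, a value of the right rank is stored. Later rounds can only
  -- replace it by another value that passes the same test.
  obtain ⟨i₀, hi₀, hrank⟩ := exists_isRank f hr
  refine Reaches.mono (R := fun s' => Frame 13 17 4 6 s s' ∧ IsRank f n r (s'.real 4 0)) ?_ le_rfl
    fun s' hs' => hs'
  refine Reaches.simple_seq (B' := n * (100 * n + 200) + 7) 13 17 4 6 rfl rfl ?_ fun hF₁ => ?_
  · simp [RamCmd.maxCost, NatExpr.cost]; omega
  refine Reaches.loop_frame_const (procs := procs) 10 30 3 6 hp rfl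
    (fun j s' => Frame 13 17 4 6 s s' ∧ s'.nat 13 0 = j ∧ (i₀ < j → IsRank f n r (s'.real 4 0)))
    (100 * n + 150) n ?_ ?_ ?_ ?_
  · simp [NatExpr.cost, RamTest.cost]; nlinarith
  · exact ⟨hF₁, by simp [RamCmd.post, NatExpr.eval, RamState.setNat_nat], by simp⟩
  · rintro i hi s₁ - ⟨hF, h13, hI⟩
    have e10 := hF.1 10 (by norm_num)
    have e11 := hF.1 11 (by norm_num)
    have r3 := hF.2 3 (by norm_num)
    refine ⟨by simp [RamTest.Holds, NatExpr.eval, h13, e11, ← hn, hi], ?_⟩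
    refine Reaches.simple_seq (B' := 100 * n + 140) 13 17 4 6 rfl rfl ?_ fun hF₂ => ?_
    · simp [RamCmd.maxCost, NatExpr.cost, RealExpr.cost]; omega
    set s₂ := RamCmd.post (.setReal 5 (.const 0) (.get 3 (.add (.var 10) (.var 13)))) s₁ with hs₂
    have hp2 : s₂.real 5 0 = f i := by
      simp [hs₂, RamCmd.post, RealExpr.eval, NatExpr.eval, RamState.setReal_real, h13, e10, r3, hf]
    have hF₂' := hF.trans hF₂
    have hs2 : s₂.nat = s₁.nat := rfl
    have hr3 : s₂.real 3 = s.real 3 := hF₂'.2 3 (by norm_num)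
    have e10' := hF₂'.1 10 (by norm_num)
    have e11' := hF₂'.1 11 (by norm_num)
    have r3' := hF₂'.2 3 (by norm_num)
    refine ((countCmd_spec procs s₂).seq (B' := 40) (Q := fun s' => Frame 13 17 4 6 s s' ∧
      s'.nat 13 0 = i + 1 ∧ (i₀ < i + 1 → IsRank f n r (s'.real 4 0))) ?_).mono ?_ fun _ h => h
    · rintro s₃ ⟨hF₃, h15, h16⟩
      have hF₃' := hF₂'.trans (hF₃.mono (m₁ := 13) (m₂ := 17) (q₁ := 4) (q₂ := 6)
        (by norm_num) (by norm_num) (by norm_num) (by norm_num))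
      have e12 := hF₃'.1 12 (by norm_num)
      have e13 : s₃.nat 13 0 = i := by rw [hF₃.1 13 (by norm_num), hs2, h13]
      have r5 : s₃.real 5 0 = f i := by rw [hF₃.2 5 (by norm_num), hp2]
      rw [hp2, hr3, e10', e11'] at h15 h16
      refine Reaches.of_simple rfl (by decide) ⟨hF₃'.trans (RamCmd.frame_post rfl rfl s₃), ?_, ?_⟩
      · by_cases h : r < s₃.nat 15 0 <;> by_cases h' : r < s₃.nat 16 0 <;>
        simp [RamCmd.post, RamTest.Holds, NatExpr.eval, RamState.setNat_nat, RamState.setReal_nat,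
          e12, e13, ← hr', h, h']
      · intro hi
        by_cases h : ¬ r < s₃.nat 15 0 ∧ r < s₃.nat 16 0
        · simp only [RamCmd.post, RamTest.Holds, NatExpr.eval, RealExpr.eval, RamState.setNat_real,
            RamState.setReal_real, e12, ← hr', h, r5, if_true, not_false_iff, true_and,
            Function.update_self]
          exact ⟨by have := h.1; rw [h15] at this; exact not_lt.1 this,
            by have := h.2; rw [h16] at this; exact this⟩
        · simp only [RamCmd.post, RamTest.Holds, NatExpr.eval, RamState.setNat_real,
            e12, ← hr', h, if_false]
          rw [hF₃.2 4 (by norm_num), show s₂.real 4 = s₁.real 4 from rfl]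
          refine hI (lt_of_le_of_ne (by omega) ?_)
          rintro rfl
          rw [h15, h16] at h
          exact h ⟨not_lt.2 hrank.1, hrank.2⟩
    · rw [e11']
  · rintro s' - ⟨hF, h13, hI⟩
    have e11 := hF.1 11 (by norm_num)
    exact ⟨by simp [RamTest.Holds, NatExpr.eval, h13, e11, hn], hF, hI hi₀⟩

/-- Keeps the entries of the segment of the work array starting at `nat 10` of length `nat 11` that
pass the test, moving them to the front; their number is stored in `nat 18`. -/
def compactCmd (t : RamTest) : RamCmd :=
  .seq (.seq (.assign 17 (.const 0)) (.assign 18 (.const 0)))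
    (.loop (.natLt (.var 17) (.var 11))
      (.seq (.branch t
          (.seq (.setReal 3 (.add (.var 10) (.var 18)) (.get 3 (.add (.var 10) (.var 17))))
            (.incr 18)) .nop)
        (.incr 17)))

/-- Compaction in place is safe because the entries from the reading position onwards are still
untouched. The result is described by counts of all predicates `q`, the form that `IsRank.of_less`
and `IsRank.of_greater` consume. -/
theorem compactCmd_spec (procs : List RamCmd) (s : RamState) {t : RamTest} {P : ℝ → Prop}
    (htc : t.cost ≤ 10) (ht : ∀ s', s'.real 5 = s.real 5 →
      (t.Holds s' ↔ P (s'.real 3 (s'.nat 10 0 + s'.nat 17 0)))) :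
    Reaches procs (compactCmd t) s (100 * s.nat 11 0 + 100) fun s' =>
      Frame 17 19 3 4 s s' ∧ (∀ i < s.nat 10 0, s'.real 3 i = s.real 3 i) ∧
      s'.nat 18 0 = countBelow (fun j => P (s.real 3 (s.nat 10 0 + j))) (s.nat 11 0) ∧
      ∀ q : ℝ → Prop, countBelow (fun j => q (s'.real 3 (s.nat 10 0 + j))) (s'.nat 18 0) =
        countBelow (fun j => q (s.real 3 (s.nat 10 0 + j)) ∧ P (s.real 3 (s.nat 10 0 + j)))
          (s.nat 11 0) := by
  unfold compactCmd
  set b := s.nat 10 0 with hb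
  set f : ℕ → ℝ := fun j => s.real 3 (b + j) with hf
  refine Reaches.simple_seq (B' := 100 * s.nat 11 0 + 50) 17 19 3 4 rfl rfl ?_ fun hF₁ =>
    Reaches.loop_simple 17 19 3 4 rfl rfl (fun j s' => s'.nat 17 0 = j ∧
        s'.nat 18 0 = countBelow (fun j => P (f j)) j ∧
        (∀ i, i < b ∨ b + j ≤ i → s'.real 3 i = s.real 3 i) ∧
        ∀ q : ℝ → Prop, countBelow (fun j => q (s'.real 3 (b + j))) (s'.nat 18 0) =
          countBelow (fun j => q (f j) ∧ P (f j)) j) (s.nat 11 0) ?_ ?_ ?_ ?_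
  · simp [RamCmd.maxCost, NatExpr.cost]; omega
  · simp [RamCmd.maxCost, NatExpr.cost, RamTest.cost, RealExpr.cost]
    have : s.nat 11 0 * t.cost ≤ s.nat 11 0 * 10 := Nat.mul_le_mul_left _ htc
    nlinarith
  · simp [RamCmd.post, NatExpr.eval, RamState.setNat_nat, RamState.setNat_real, countBelow_zero]
  · rintro j hj s' hF ⟨h17, h18, hout, hcnt⟩
    replace hF := hF₁.trans hF
    have e10 : s'.nat 10 0 = b := by rw [hF.1 10 (by norm_num)]
    have e11 := hF.1 11 (by norm_num)
    have r5 := hF.2 5 (by norm_num)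
    have hT : t.Holds s' ↔ P (f j) := by
      rw [ht s' r5, e10, h17, hout _ (Or.inr le_rfl)]
    refine ⟨by simp [RamTest.Holds, NatExpr.eval, h17, e11, hj], ?_⟩
    -- The writing position never overtakes the reading position.
    have hw : s'.nat 18 0 ≤ j := h18 ▸ countBelow_le _ _
    by_cases h : P (f j)
    · have hval : s'.real 3 (b + j) = f j := hout _ (Or.inr le_rfl)
      refine ⟨?_, ?_, ?_, ?_⟩
      · simp [RamCmd.post, hT, h, NatExpr.eval, RamState.setNat_nat, RamState.setReal_nat, h17]
      · simp [RamCmd.post, hT, h, NatExpr.eval, RamState.setNat_nat, RamState.setReal_nat, h18,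
          countBelow_succ]
      · intro i hi
        simp only [RamCmd.post, hT, h, if_true, NatExpr.eval, RealExpr.eval, RamState.setNat_real,
          RamState.setReal_real, e10]
        rw [Function.update_of_ne (by omega)]
        exact hout i (by omega)
      · intro q
        simp only [RamCmd.post, hT, h, if_true, NatExpr.eval, RealExpr.eval, RamState.setNat_real,
          RamState.setReal_real, RamState.setNat_nat, RamState.setReal_nat, e10, h17, hval,
          Function.update_self, Nat.reduceEqDiff, if_false]
        rw [countBelow_succ, countBelow_succ, ← hcnt q]
        refine congrArg₂ (· + ·) (countBelow_congr fun i hi => ?_) ?_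
        · rw [Function.update_of_ne (by omega)]
        · rw [Function.update_self]
          by_cases hq : q (f j)
          · rw [if_pos hq, if_pos ⟨hq, h⟩]
          · rw [if_neg hq, if_neg fun h => hq h.1]
    · have hs : RamCmd.post (.seq (.branch t
          (.seq (.setReal 3 (.add (.var 10) (.var 18)) (.get 3 (.add (.var 10) (.var 17))))
            (.incr 18)) .nop) (.incr 17)) s' = RamCmd.post (.incr 17) s' := by
        simp [RamCmd.post, hT, h]
      rw [hs]
      refine ⟨?_, ?_, ?_, ?_⟩
      · simp [RamCmd.post, NatExpr.eval, RamState.setNat_nat, h17]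
      · simp [RamCmd.post, RamState.setNat_nat, h18, h, countBelow_succ]
      · intro i hi
        exact hout i (by omega)
      · intro q
        have := hcnt q
        simp only [RamCmd.post, RamState.setNat_nat, RamState.setNat_real, Nat.reduceEqDiff,
          if_false, countBelow_succ, h, and_false]
        rw [this, add_zero]
  · rintro s' hF ⟨h17, h18, hout, hcnt⟩
    have e11 := (hF₁.trans hF).1 11 (by norm_num)
    exact ⟨by simp [RamTest.Holds, NatExpr.eval, h17, e11], hF₁.trans hF,
      fun i hi => hout i (Or.inl hi), h18, hcnt⟩

/-- Stores the medians of the groups of five of the current segment behind that segment. -/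
def groupsCmd : RamCmd :=
  .seq (.assign 18 (.const 0))
    (.loop (.natLt (.var 18) (.div (.get 19 (.var 22)) (.const 5)))
      (.seq (.seq (.assign 10 (.add (.get 21 (.var 22)) (.mul (.const 5) (.var 18))))
          (.seq (.assign 11 (.const 5)) (.assign 12 (.const 2))))
        (.seq smallSelectCmd
          (.seq (.setReal 3 (.add (.add (.get 21 (.var 22)) (.get 19 (.var 22))) (.var 18))
              (.get 4 (.const 0)))
            (.incr 18)))))

theorem groupsCmd_spec (procs : List RamCmd)
    (hp : ∀ d ∈ procs, d.framed 10 30 3 6 = true) (s : RamState) {d n b : ℕ}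
    (hd : s.nat 22 0 = d) (hn : s.nat 19 d = n) (hb : s.nat 21 d = b) :
    Reaches procs groupsCmd s (1000 * n + 100) fun s' =>
      Frame 10 19 3 6 s s' ∧ (∀ i < b + n, s'.real 3 i = s.real 3 i) ∧
      ∀ g < n / 5, IsRank (fun j => s.real 3 (b + (5 * g + j))) 5 2 (s'.real 3 (b + n + g)) := by
  unfold groupsCmd
  refine Reaches.simple_seq (B' := 1000 * n + 50) 10 19 3 6 rfl rfl ?_ fun hF₁ => ?_
  · simp [RamCmd.maxCost, NatExpr.cost]; omega
  refine Reaches.loop_frame_const (procs := procs) 10 30 3 6 hp rfl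
    (fun j s' => Frame 10 19 3 6 s s' ∧ s'.nat 18 0 = j ∧
      (∀ i < b + n, s'.real 3 i = s.real 3 i) ∧
      ∀ g < j, IsRank (fun j => s.real 3 (b + (5 * g + j))) 5 2 (s'.real 3 (b + n + g)))
    -- Selection among five entries takes at most `5 * (100 * 5 + 200) + 10 = 3510` steps; the rest
    -- of the budget covers the copying and the counter.
    4000 (n / 5) ?_ ?_ ?_ ?_
  · simp [NatExpr.cost, RamTest.cost]; omega
  · exact ⟨hF₁, by simp [RamCmd.post, NatExpr.eval, RamState.setNat_nat], fun i hi => rfl, by simp⟩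
  · rintro g hg s₁ - ⟨hF, h18, hlow, hI⟩
    have e22 : s₁.nat 22 0 = d := by rw [hF.1 22 (by norm_num), hd]
    have e19 : s₁.nat 19 d = n := by rw [hF.1 19 (by norm_num), hn]
    have e21 : s₁.nat 21 d = b := by rw [hF.1 21 (by norm_num), hb]
    refine ⟨by simp [RamTest.Holds, NatExpr.eval, h18, e22, e19, hg], ?_⟩
    refine Reaches.simple_seq (B' := 3960) 10 19 3 6 rfl rfl (by decide) fun hF₂ => ?_
    set s₂ := RamCmd.post _ s₁ with hs₂
    have e10 : s₂.nat 10 0 = b + 5 * g := by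
      simp [hs₂, RamCmd.post, NatExpr.eval, RamState.setNat_nat, h18, e22, e21]
    have e11 : s₂.nat 11 0 = 5 := by
      simp [hs₂, RamCmd.post, NatExpr.eval, RamState.setNat_nat]
    have e12 : s₂.nat 12 0 = 2 := by
      simp [hs₂, RamCmd.post, NatExpr.eval, RamState.setNat_nat]
    have e18 : s₂.nat 18 0 = g := by
      simp [hs₂, RamCmd.post, NatExpr.eval, RamState.setNat_nat, h18]
    have hr : s₂.real = s₁.real := rfl
    refine ((smallSelectCmd_spec procs hp s₂ (by omega)).seq (B' := 40) ?_).mono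
      (by rw [e11]; norm_num) fun _ h => h
    rintro s₃ ⟨hF₃, hrank⟩
    rw [e10, e11, e12, hr] at hrank
    have hF₃' := (hF.trans hF₂).trans (hF₃.mono (m₁ := 10) (m₂ := 19) (q₁ := 3) (q₂ := 6)
        (by norm_num) (by norm_num) (by norm_num) (by norm_num))
    have f18 : s₃.nat 18 0 = g := by rw [hF₃.1 18 (by norm_num), e18]
    have f22 : s₃.nat 22 0 = d := by rw [hF₃'.1 22 (by norm_num), hd]
    have f19 : s₃.nat 19 d = n := by rw [hF₃'.1 19 (by norm_num), hn]
    have f21 : s₃.nat 21 d = b := by rw [hF₃'.1 21 (by norm_num), hb]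
    have f3 : s₃.real 3 = s₁.real 3 := by rw [hF₃.2 3 (by norm_num), hr]
    refine Reaches.of_simple rfl (by decide) ⟨hF₃'.trans (RamCmd.frame_post rfl rfl s₃), ?_, ?_, ?_⟩
    · simp [RamCmd.post, NatExpr.eval, RamState.setNat_nat, RamState.setReal_nat, f18]
    · intro i hi
      simp only [RamCmd.post, NatExpr.eval, RealExpr.eval, RamState.setNat_real,
        RamState.setReal_real, f18, f22, f19, f21, if_true]
      rw [Function.update_of_ne (by omega), f3]
      exact hlow i hi
    · intro g' hg'
      simp only [RamCmd.post, NatExpr.eval, RealExpr.eval, RamState.setNat_real,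
        RamState.setReal_real, f18, f22, f19, f21, if_true]
      by_cases h : g' = g
      · subst h
        rw [Function.update_self]
        refine hrank.congr fun j hj => ?_
        rw [add_assoc b]
        exact hlow _ (by omega)
      · rw [Function.update_of_ne (by omega), f3]
        exact hI g' (by omega)
  · rintro s' - ⟨hF, h18, hlow, hI⟩
    have e22 : s'.nat 22 0 = d := by rw [hF.1 22 (by norm_num), hd]
    have e19 : s'.nat 19 d = n := by rw [hF.1 19 (by norm_num), hn]
    exact ⟨by simp [RamTest.Holds, NatExpr.eval, h18, e22, e19], hF, hlow, hI⟩

/-- The test that the current entry of the work array is below the pivot. -/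
def lessTest : RamTest := .realLt (.get 3 (.add (.var 10) (.var 17))) (.get 5 (.const 0))

/-- The test that the current entry of the work array is above the pivot. -/
def greaterTest : RamTest := .realLt (.get 5 (.const 0)) (.get 3 (.add (.var 10) (.var 17)))

/-- Restricts the current segment to the entries below, equal to, or above the pivot. -/
def shrinkCmd : RamCmd :=
  .branch (.natLt (.get 20 (.var 22)) (.var 15))
    (.seq (compactCmd lessTest) (.setNat 19 (.var 22) (.var 18)))
    (.branch (.natLt (.get 20 (.var 22)) (.var 16))
      (.seq (.setReal 3 (.var 10) (.get 5 (.const 0)))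
        (.seq (.setNat 19 (.var 22) (.const 1)) (.setNat 20 (.var 22) (.const 0))))
      (.seq (compactCmd greaterTest)
        (.seq (.setNat 19 (.var 22) (.var 18))
          (.setNat 20 (.var 22) (.sub (.get 20 (.var 22)) (.var 16))))))

/-- Replaces the selection problem on the current segment by the one on the entries below, equal
to, or above the pivot `real 4`. -/
def partitionCmd : RamCmd :=
  .seq (.seq (.setReal 5 (.const 0) (.get 4 (.const 0)))
      (.seq (.assign 10 (.get 21 (.var 22))) (.assign 11 (.get 19 (.var 22)))))
    (.seq countCmd shrinkCmd)

/-- The current selection problem of `s'` (of length at most `n'`) reduces the one of `s`. -/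
def Reduces (s s' : RamState) (d n' : ℕ) : Prop :=
  (∀ i, i ≠ d → s'.nat 19 i = s.nat 19 i ∧ s'.nat 20 i = s.nat 20 i) ∧
  (∀ i < s.nat 21 d, s'.real 3 i = s.real 3 i) ∧ s'.nat 20 d < s'.nat 19 d ∧ s'.nat 19 d ≤ n' ∧
  ∀ v, IsRank (fun j => s'.real 3 (s.nat 21 d + j)) (s'.nat 19 d) (s'.nat 20 d) v →
    IsRank (fun j => s.real 3 (s.nat 21 d + j)) (s.nat 19 d) (s.nat 20 d) v

theorem isRank_one {f : ℕ → ℝ} {v : ℝ} (h : IsRank f 1 0 v) : v = f 0 := by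
  obtain ⟨h1, h2⟩ := h
  rw [countBelow_succ, countBelow_zero] at h1 h2
  have h3 : ¬ f 0 < v := by
    intro h; simp [h] at h1
  have h4 : f 0 ≤ v := by
    by_contra h; simp [h] at h2
  exact le_antisymm (not_lt.1 h3) h4

/-- The rank `r` is compared with the numbers of entries below and up to the pivot. If the pivot
itself has rank `r`, the segment is replaced by the single entry `p` with rank `0` rather than
returned, so that all three cases end in a smaller selection problem of the same kind. -/
theorem shrinkCmd_spec (procs : List RamCmd) (s : RamState) {d n r b n' : ℕ} {p : ℝ}
    (hd : s.nat 22 0 = d) (hn : s.nat 19 d = n) (hr : s.nat 20 d = r) (hb : s.nat 21 d = b)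
    (h10 : s.nat 10 0 = b) (h11 : s.nat 11 0 = n) (hp : s.real 5 0 = p) (hrn : r < n)
    (h15 : s.nat 15 0 = countBelow (fun j => s.real 3 (b + j) < p) n)
    (h16 : s.nat 16 0 = countBelow (fun j => s.real 3 (b + j) ≤ p) n)
    (hn' : 1 ≤ n') (h15' : s.nat 15 0 ≤ n') (h16' : n ≤ s.nat 16 0 + n') :
    Reaches procs shrinkCmd s (100 * n + 200) fun s' => Reduces s s' d n' := by
  unfold shrinkCmd
  set f : ℕ → ℝ := fun j => s.real 3 (b + j) with hf
  refine Reaches.branch (B := 100 * n + 180) (by simp [RamTest.cost, NatExpr.cost]; omega)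
    (fun hlt => ?_) fun hlt => Reaches.branch (B := 100 * n + 150)
      (by simp [RamTest.cost, NatExpr.cost]; omega) (fun hle => ?_) fun hle => ?_
  · replace hlt : r < s.nat 15 0 := by
      simpa [RamTest.Holds, NatExpr.eval, hd, hr] using hlt
    refine ((compactCmd_spec procs s (P := fun y => y < p) (by decide) fun s' h => by
      simp [lessTest, RamTest.Holds, RealExpr.eval, NatExpr.eval, h, hp]).seq (B' := 10) ?_).mono
      (by rw [h11]; omega) fun _ h => h
    rintro s₁ ⟨hF, hlow, h17, hcnt⟩
    simp only [h10, h11] at hlow h17 hcnt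
    have e22 : s₁.nat 22 0 = d := by rw [hF.1 22 (by norm_num), hd]
    have e20 : s₁.nat 20 = s.nat 20 := hF.1 20 (by norm_num)
    have e19 : s₁.nat 19 = s.nat 19 := hF.1 19 (by norm_num)
    refine Reaches.of_simple rfl (by decide) ⟨?_, ?_, ?_, ?_, ?_⟩
    · intro i hi
      simp [RamCmd.post, NatExpr.eval, RamState.setNat_nat, e22, hi, e19, e20]
    · rw [hb]; exact hlow
    · simp [RamCmd.post, NatExpr.eval, RamState.setNat_nat, e22, e20, hr]
      omega
    · simp [RamCmd.post, NatExpr.eval, RamState.setNat_nat, e22]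
      omega
    · intro v hv
      simp only [RamCmd.post, NatExpr.eval, RamState.setNat_nat, RamState.setNat_real, e22, e20, hb,
        hr, if_true, Function.update_self, Nat.reduceEqDiff, if_false] at hv
      rw [hb, hn, hr]
      exact IsRank.of_less hcnt (by omega) hv
  · replace hle : r < s.nat 16 0 := by
      simpa [RamTest.Holds, NatExpr.eval, hd, hr] using hle
    replace hlt : ¬ r < s.nat 15 0 := by
      simpa [RamTest.Holds, NatExpr.eval, hd, hr] using hlt
    refine Reaches.of_simple rfl (le_trans (by decide : _ ≤ 150) (by omega)) ⟨?_, ?_, ?_, ?_, ?_⟩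
    · intro i hi
      simp [RamCmd.post, NatExpr.eval, RamState.setNat_nat, RamState.setReal_nat, hd, hi]
    · intro i hi
      simp only [RamCmd.post, NatExpr.eval, RealExpr.eval, RamState.setNat_real,
        RamState.setReal_real, if_true]
      rw [Function.update_of_ne (by omega)]
    · simp [RamCmd.post, NatExpr.eval, RamState.setNat_nat, RamState.setReal_nat, hd]
    · simpa [RamCmd.post, NatExpr.eval, RamState.setNat_nat, RamState.setReal_nat, hd] using hn'
    · intro v hv
      simp only [RamCmd.post, NatExpr.eval, RealExpr.eval, RamState.setNat_nat,
        RamState.setReal_nat, RamState.setNat_real, RamState.setReal_real, hd, hb, h10, hp,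
        if_true, Function.update_self, Nat.reduceEqDiff, if_false] at hv
      have := isRank_one hv
      simp only [add_zero, Function.update_self] at this
      rw [hb, hn, hr, this]
      exact ⟨by rw [h15] at hlt; exact not_lt.1 hlt, by rw [h16] at hle; exact hle⟩
  · replace hle : ¬ r < s.nat 16 0 := by
      simpa [RamTest.Holds, NatExpr.eval, hd, hr] using hle
    refine ((compactCmd_spec procs s (P := fun y => p < y) (by decide) fun s' h => by
      simp [greaterTest, RamTest.Holds, RealExpr.eval, NatExpr.eval, h, hp]).seq (B' := 40) ?_).mono
      (by rw [h11]; omega) fun _ h => h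
    rintro s₁ ⟨hF, hlow, h17, hcnt⟩
    simp only [h10, h11] at hlow h17 hcnt
    have e22 : s₁.nat 22 0 = d := by rw [hF.1 22 (by norm_num), hd]
    have e20 : s₁.nat 20 = s.nat 20 := hF.1 20 (by norm_num)
    have e19 : s₁.nat 19 = s.nat 19 := hF.1 19 (by norm_num)
    have e16 : s₁.nat 16 0 = s.nat 16 0 := by rw [hF.1 16 (by norm_num)]
    have hw : countBelow (fun j => s.real 3 (b + j) ≤ p) n +
        countBelow (fun j => p < s.real 3 (b + j)) n = n := by
      simpa only [not_le] using countBelow_not (fun j => s.real 3 (b + j) ≤ p) n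
    refine Reaches.of_simple rfl (by decide) ⟨?_, ?_, ?_, ?_, ?_⟩
    · intro i hi
      simp [RamCmd.post, NatExpr.eval, RamState.setNat_nat, e22, hi, e19, e20]
    · rw [hb]; exact hlow
    · simp [RamCmd.post, NatExpr.eval, RamState.setNat_nat, e22, e20, hr, e16]
      omega
    · simp [RamCmd.post, NatExpr.eval, RamState.setNat_nat, e22]
      omega
    · intro v hv
      simp only [RamCmd.post, NatExpr.eval, RamState.setNat_nat, RamState.setNat_real, e22, e20, hb,
        hr, e16, h16, if_true, Function.update_self, Nat.reduceEqDiff, if_false] at hv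
      rw [hb, hn, hr]
      exact IsRank.of_greater hcnt (by omega) hv

theorem partitionCmd_spec (procs : List RamCmd)
    (s : RamState) {d n b n' : ℕ} {p : ℝ}
    (hd : s.nat 22 0 = d) (hn : s.nat 19 d = n) (hb : s.nat 21 d = b)
    (hp4 : s.real 4 0 = p) (hrn : s.nat 20 d < n) (hn' : 1 ≤ n')
    (h15 : countBelow (fun j => s.real 3 (b + j) < p) n ≤ n')
    (h16 : n ≤ countBelow (fun j => s.real 3 (b + j) ≤ p) n + n') :
    Reaches procs partitionCmd s (200 * n + 400) fun s' =>
      s'.nat 21 = s.nat 21 ∧ s'.nat 22 = s.nat 22 ∧ Reduces s s' d n' := by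
  unfold partitionCmd
  refine Reaches.simple_seq (B' := 200 * n + 350) 10 12 5 6 rfl rfl
    (by simp [RamCmd.maxCost, NatExpr.cost, RealExpr.cost]; omega) fun hF₂ => ?_
  set s₂ := RamCmd.post _ s with hs₂
  have e10 : s₂.nat 10 0 = b := by
    simp [hs₂, RamCmd.post, NatExpr.eval, RamState.setNat_nat, RamState.setReal_nat, hd, hb]
  have e11 : s₂.nat 11 0 = n := by
    simp [hs₂, RamCmd.post, NatExpr.eval, RamState.setNat_nat, RamState.setReal_nat, hd, hn]
  have e5 : s₂.real 5 0 = p := by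
    simp [hs₂, RamCmd.post, NatExpr.eval, RealExpr.eval, RamState.setNat_real,
      RamState.setReal_real, hp4]
  have e3 : s₂.real 3 = s.real 3 := hF₂.2 3 (by norm_num)
  refine Reaches.mono (Reaches.seq (countCmd_spec procs s₂) (B' := 100 * n + 200) ?_)
    (by rw [e11]; omega) fun _ h => h
  rintro s₃ ⟨hF₃, g15, g16⟩
  rw [e10, e11, e5, e3] at g15 g16
  have hn : ∀ a, 17 ≤ a → s₃.nat a = s.nat a := fun a ha => by
    rw [hF₃.1 a (by omega), hF₂.1 a (by omega)]
  have k3 : s₃.real 3 = s.real 3 := by rw [hF₃.2 3 (by norm_num), e3]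
  have k5 : s₃.real 5 0 = p := by rw [hF₃.2 5 (by norm_num), e5]
  have k10 : s₃.nat 10 0 = b := by rw [hF₃.1 10 (by norm_num), e10]
  have k11 : s₃.nat 11 0 = n := by rw [hF₃.1 11 (by norm_num), e11]
  -- The command contains no calls; with an empty procedure list its frame is immediate, and the
  -- result is weakened afterwards.
  have := shrinkCmd_spec [] s₃ (d := d) (n := n) (r := s.nat 20 d) (b := b) (n' := n') (p := p)
    (by rw [hn 22 (by norm_num), hd]) (by rw [hn 19 (by norm_num)]; assumption)
    (by rw [hn 20 (by norm_num)]) (by rw [hn 21 (by norm_num), hb]) k10 k11 k5 hrn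
    (by rw [k3]; exact g15) (by rw [k3]; exact g16) hn' (by rw [g15]; exact h15)
    (by rw [g16]; exact h16)
  refine ((this.frame 10 21 3 6 (by simp) rfl)).weaken.mono le_rfl fun s' ⟨hF, hR⟩ => ⟨?_, ?_, ?_⟩
  · rw [hF.1 21 (by norm_num), hn 21 (by norm_num)]
  · rw [hF.1 22 (by norm_num), hn 22 (by norm_num)]
  · unfold Reduces at hR ⊢
    rwa [hn 19 (by norm_num), hn 20 (by norm_num), hn 21 (by norm_num), k3] at hR

/-- One round of the selection: find a pivot by a recursive call, and partition. -/
def selectStep : RamCmd :=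
  .seq groupsCmd
    (.seq (.seq (.setNat 21 (.add (.var 22) (.const 1)) (.add (.get 21 (.var 22)) (.get 19 (.var 22))))
        (.seq (.setNat 19 (.add (.var 22) (.const 1)) (.div (.get 19 (.var 22)) (.const 5)))
          (.seq (.setNat 20 (.add (.var 22) (.const 1))
              (.div (.div (.get 19 (.var 22)) (.const 5)) (.const 2)))
            (.incr 22))))
      (.seq (.call 0) (.seq (.assign 22 (.sub (.var 22) (.const 1))) partitionCmd)))

/-- The recursive selection procedure. The problem is described by the frame number `nat 22` on a
stack: length `nat 19`, rank `nat 20` and start `nat 21` of a segment of the work array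
(real array `3`). The result is `real 4`. -/
def selectBody : RamCmd :=
  .seq (.loop (.not (.natLt (.get 19 (.var 22)) (.const 25))) selectStep)
    (.seq (.seq (.assign 10 (.get 21 (.var 22))) (.seq (.assign 11 (.get 19 (.var 22)))
      (.assign 12 (.get 20 (.var 22))))) smallSelectCmd)

/-- The state `s'` results from `s` by solving the selection problem in stack frame `d`. -/
def Selected (s s' : RamState) (d : ℕ) : Prop :=
  IsRank (fun j => s.real 3 (s.nat 21 d + j)) (s.nat 19 d) (s.nat 20 d) (s'.real 4 0) ∧
  s'.nat 22 0 = d ∧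
  (∀ i < d, s'.nat 19 i = s.nat 19 i ∧ s'.nat 20 i = s.nat 20 i ∧ s'.nat 21 i = s.nat 21 i) ∧
  ∀ i < s.nat 21 d, s'.real 3 i = s.real 3 i

theorem selectBody_framed : ∀ d ∈ [selectBody], d.framed 10 30 3 6 = true := by
  simp only [List.mem_singleton, forall_eq]; decide

/-- The medians form a subproblem in stack frame `d + 1`, on a segment starting behind the current
one. The recursive call leaves lower frames and the work array below its own segment intact, which
is why `Selected` records both; hence the original segment is still available for partitioning. -/
theorem selectStep_spec {n d b r : ℕ} (hn25 : 25 ≤ n)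
    (ih : ∀ s : RamState, s.nat 19 (s.nat 22 0) = n / 5 → s.nat 20 (s.nat 22 0) < n / 5 →
      Reaches [selectBody] selectBody s (20000 * (n / 5)) fun s' => Selected s s' (s.nat 22 0))
    (s : RamState) (hd : s.nat 22 0 = d) (hn : s.nat 19 d = n) (hr : s.nat 20 d = r)
    (hb : s.nat 21 d = b) (hrn : r < n) :
    Reaches [selectBody] selectStep s (1230 * n + 20000 * (n / 5)) fun s' =>
      s'.nat 22 0 = d ∧ s'.nat 21 d = b ∧ (∀ i < d, s'.nat 19 i = s.nat 19 i ∧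
        s'.nat 20 i = s.nat 20 i ∧ s'.nat 21 i = s.nat 21 i) ∧
      (∀ i < b, s'.real 3 i = s.real 3 i) ∧ s'.nat 20 d < s'.nat 19 d ∧
      s'.nat 19 d ≤ n - 3 * (n / 5 - n / 5 / 2) ∧
      ∀ v, IsRank (fun j => s'.real 3 (b + j)) (s'.nat 19 d) (s'.nat 20 d) v →
        IsRank (fun j => s.real 3 (b + j)) n r v := by
  have hp := selectBody_framed
  unfold selectStep
  refine Reaches.mono (Reaches.seq (groupsCmd_spec _ hp s hd hn hb) (B' := 200 * n + 600 +
    20000 * (n / 5)) ?_) (by omega) fun _ h => h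
  rintro s₁ ⟨hF₁, hlow₁, hmd⟩
  have a19 : s₁.nat 19 = s.nat 19 := hF₁.1 19 (by norm_num)
  have a20 : s₁.nat 20 = s.nat 20 := hF₁.1 20 (by norm_num)
  have a21 : s₁.nat 21 = s.nat 21 := hF₁.1 21 (by norm_num)
  have a22 : s₁.nat 22 0 = d := by rw [hF₁.1 22 (by norm_num), hd]
  refine Reaches.simple_seq (B' := 200 * n + 450 + 20000 * (n / 5)) 10 30 3 6 rfl rfl
    (by simp [RamCmd.maxCost, NatExpr.cost]; omega) fun _ => ?_
  set s₂ := RamCmd.post _ s₁ with hs₂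
  have b22 : s₂.nat 22 0 = d + 1 := by
    simp [hs₂, RamCmd.post, NatExpr.eval, RamState.setNat_nat, a22]
  have b21 : s₂.nat 21 = Function.update (s.nat 21) (d + 1) (b + n) := by
    simp [hs₂, RamCmd.post, NatExpr.eval, RamState.setNat_nat, a22, a21, a19, hb, hn]
  have b19 : s₂.nat 19 = Function.update (s.nat 19) (d + 1) (n / 5) := by
    simp [hs₂, RamCmd.post, NatExpr.eval, RamState.setNat_nat, a22, a19, hn]
  have b20 : s₂.nat 20 = Function.update (s.nat 20) (d + 1) (n / 5 / 2) := by
    simp [hs₂, RamCmd.post, NatExpr.eval, RamState.setNat_nat, a22, a19, a20, hn]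
  have b3 : s₂.real = s₁.real := rfl
  have hcall := ih s₂ (by rw [b22, b19, Function.update_self])
    (by rw [b22, b20, Function.update_self]; omega)
  rw [b22] at hcall
  refine Reaches.mono (Reaches.seq (Reaches.call rfl hcall) (B' := 200 * n + 420) ?_)
    (by omega) fun _ h => h
  rintro s₃ ⟨hrank, c22, hstack, hlow₃⟩
  rw [b21, b20, b19, b3] at hrank
  simp only [b19, b20, b21, Function.update_self] at hrank hstack hlow₃
  have hstack' : ∀ i < d + 1, s₃.nat 19 i = s.nat 19 i ∧ s₃.nat 20 i = s.nat 20 i ∧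
      s₃.nat 21 i = s.nat 21 i := fun i hi => by
    have := hstack i hi
    rwa [Function.update_of_ne (by omega), Function.update_of_ne (by omega),
      Function.update_of_ne (by omega)] at this
  have hlow : ∀ i < b + n, s₃.real 3 i = s.real 3 i := fun i hi => by
    rw [hlow₃ i hi, b3, hlow₁ i hi]
  refine Reaches.simple_seq (B' := 200 * n + 400) 10 30 3 6 rfl rfl
    (by simp [RamCmd.maxCost, NatExpr.cost]; omega) fun _ => ?_
  set s₄ := RamCmd.post _ s₃ with hs₄
  have d22 : s₄.nat 22 0 = d := by
    simp [hs₄, RamCmd.post, NatExpr.eval, RamState.setNat_nat, c22]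
  have d19 : s₄.nat 19 = s₃.nat 19 := by
    simp [hs₄, RamCmd.post, RamState.setNat_nat]
  have d20 : s₄.nat 20 = s₃.nat 20 := by
    simp [hs₄, RamCmd.post, RamState.setNat_nat]
  have d21 : s₄.nat 21 = s₃.nat 21 := by
    simp [hs₄, RamCmd.post, RamState.setNat_nat]
  have d3 : s₄.real = s₃.real := rfl
  obtain ⟨hlt, hle⟩ := pivot_bounds (f := fun j => s.real 3 (b + j)) hmd hrank
  have e1 : countBelow (fun j => s₄.real 3 (b + j) < s₃.real 4 0) n =
      countBelow (fun j => s.real 3 (b + j) < s₃.real 4 0) n :=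
    countBelow_congr fun j hj => by rw [d3, hlow _ (by omega)]
  have e2 : countBelow (fun j => s₄.real 3 (b + j) ≤ s₃.real 4 0) n =
      countBelow (fun j => s.real 3 (b + j) ≤ s₃.real 4 0) n :=
    countBelow_congr fun j hj => by rw [d3, hlow _ (by omega)]
  have hstd := hstack' d (by omega)
  -- The bound `n'` serves both sides of the pivot: `n / 5 - n / 5 / 2` is at most `n / 5 / 2 + 1`,
  -- so `3 * (n / 5 - n / 5 / 2)` entries are excluded in either case.
  refine (partitionCmd_spec _ s₄ (d := d) (n := n) (b := b)
    (n' := n - 3 * (n / 5 - n / 5 / 2)) (p := s₃.real 4 0) d22 (by rw [d19, hstd.1, hn])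
    (by rw [d21, hstd.2.2, hb]) rfl (by rw [d20, hstd.2.1, hr]; exact hrn) (by omega)
    (by rw [e1]; omega) (by rw [e2]; omega)).mono le_rfl ?_
  rintro s₅ ⟨f21, f22, hR1, hR2, hR3, hR4, hR5⟩
  rw [d21, hstd.2.2, hb] at hR2 hR5
  rw [d19, hstd.1, hn, d20, hstd.2.1, hr] at hR5
  refine ⟨by rw [f22, d22], by rw [f21, d21, hstd.2.2, hb], fun i hi => ?_, fun i hi => ?_, hR3, hR4,
    fun v hv => ?_⟩
  · have h1 := hR1 i (by omega)
    have h2 := hstack' i (by omega)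
    rw [f21, h1.1, h1.2, d19, d20, d21]
    exact h2
  · rw [hR2 i hi, d3, hlow i (by omega)]
  · exact (hR5 v hv).congr fun j hj => by rw [d3, hlow _ (by omega)]

/-- The medians make up a fifth of the segment, and about seven tenths of it survive the partition.
Since `1/5 + 7/10 < 1`, about a tenth of `20000 n` is left to pay for the `1230 n` steps of the
round; the threshold 25 absorbs the rounding. -/
theorem selectBody_spec (n : ℕ) (s : RamState) (hn : s.nat 19 (s.nat 22 0) = n)
    (hr : s.nat 20 (s.nat 22 0) < n) :
    Reaches [selectBody] selectBody s (20000 * n) fun s' => Selected s s' (s.nat 22 0) := by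
  induction n using Nat.strong_induction_on generalizing s with
  | _ n ih =>
    have hp := selectBody_framed
    obtain ⟨d, hd⟩ : ∃ d, s.nat 22 0 = d := ⟨_, rfl⟩
    rw [hd] at hn hr ⊢
    by_cases hn25 : n < 25
    · refine Reaches.mono (Reaches.loop_seq_of_not (B := 20000 * n - 100)
        (by simp [RamTest.Holds, NatExpr.eval, hd, hn, hn25]) ?_)
        (by simp [RamTest.cost, NatExpr.cost]; omega) fun _ h => h
      refine Reaches.simple_seq (B' := 20000 * n - 200) 10 13 3 3 rfl rfl
        (by simp [RamCmd.maxCost, NatExpr.cost]; omega) fun hF₁ => ?_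
      set s₁ := RamCmd.post _ s with hs₁
      have e10 : s₁.nat 10 0 = s.nat 21 d := by
        simp [hs₁, RamCmd.post, NatExpr.eval, RamState.setNat_nat, hd]
      have e11 : s₁.nat 11 0 = n := by
        simp [hs₁, RamCmd.post, NatExpr.eval, RamState.setNat_nat, hd, hn]
      have e12 : s₁.nat 12 0 = s.nat 20 d := by
        simp [hs₁, RamCmd.post, NatExpr.eval, RamState.setNat_nat, hd]
      refine (smallSelectCmd_spec _ hp s₁ (by omega)).mono ?_ fun s' ⟨hF, h⟩ => ?_
      · rw [e11]
        have : n * (100 * n + 200) ≤ n * 2700 := Nat.mul_le_mul_left _ (by omega)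
        omega
      · rw [e10, e11, e12] at h
        have e3 : s₁.real = s.real := rfl
        refine ⟨?_, ?_, fun i hi => ?_, fun i hi => ?_⟩
        · rw [hn]; exact h
        · rw [hF.1 22 (by norm_num), hF₁.1 22 (by norm_num), hd]
        · rw [hF.1 19 (by norm_num), hF₁.1 19 (by norm_num), hF.1 20 (by norm_num),
            hF₁.1 20 (by norm_num), hF.1 21 (by norm_num), hF₁.1 21 (by norm_num)]
          exact ⟨rfl, rfl, rfl⟩
        · rw [hF.2 3 (by norm_num), e3]
    -- After one round the remaining loop with the final small selection is the whole body again, on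
    -- a shorter segment, so the induction hypothesis finishes the run.
    · refine Reaches.mono (Reaches.loop_seq_of_holds
        (by simp [RamTest.Holds, NatExpr.eval, hd, hn, not_lt.1 hn25])
        ((selectStep_spec (not_lt.1 hn25) (fun s h1 h2 => ih _ (by omega) s h1 h2) s hd hn rfl rfl
          hr).mono le_rfl ?_) (B' := 20000 * (n - 3 * (n / 5 - n / 5 / 2)))) ?_ fun _ h => h
      · rintro s₁ ⟨h22, h21, hst, hlow, hlt, hle, hred⟩
        refine (ih (s₁.nat 19 d) (by omega) s₁ (by rw [h22]) (by rw [h22]; exact hlt)).mono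
          (by omega) ?_
        rw [h22]
        rintro s₂ ⟨g1, g2, g3, g4⟩
        rw [h21] at g1 g4
        refine ⟨by rw [hn]; exact hred _ g1, g2, fun i hi => ?_, fun i hi => ?_⟩
        · have a := g3 i hi
          have b := hst i hi
          exact ⟨a.1.trans b.1, a.2.1.trans b.2.1, a.2.2.trans b.2.2⟩
        · rw [g4 i hi, hlow i hi]
      · simp [RamTest.cost, NatExpr.cost]
        omega

/-! ## Estimation and output -/

theorem isMedian_of_isRank {f : ℕ → ℝ} {l : ℕ} {v : ℝ} (h : IsRank f l (l / 2) v) :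
    IsMedian ((Multiset.range l).map f) v := by
  classical
  have key : ∀ (q : ℝ → Prop) (inst : DecidablePred q),
      ((Multiset.range l).map f).countP q = countBelow (fun j => q (f j)) l := by
    intro q inst
    clear h
    induction l with
    | zero => simp [countBelow_zero]
    | succ l ih =>
      rw [Multiset.range_succ, Multiset.map_cons, countBelow_succ, ← ih]
      by_cases hq : q (f l)
      · rw [Multiset.countP_cons_of_pos _ hq, if_pos hq]
      · rw [Multiset.countP_cons_of_neg _ hq, if_neg hq, add_zero]
  have h1 := h.1
  have h2 := h.2
  have h3 := countBelow_not (fun j => f j < v) l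
  simp only [not_lt] at h3
  constructor
  · rw [key, Multiset.card_map, Multiset.card_range]; omega
  · rw [key, Multiset.card_map, Multiset.card_range]; omega

/-- The nonzero values `med n`, `D n`, are listed: their number is `nat 30`, the indices are in
array `31`, the values in the array `6` of real numbers. -/
def Listed (s : RamState) (D : ℕ → Prop) (med : ℕ → ℝ) : Prop :=
  (∀ i < s.nat 30 0, ∀ j < s.nat 30 0, s.nat 31 i = s.nat 31 j → i = j) ∧
  (∀ n, D n ∧ med n ≠ 0 ↔ ∃ i < s.nat 30 0, s.nat 31 i = n) ∧
  ∀ i < s.nat 30 0, s.real 6 i = med (s.nat 31 i)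

/-- An index with estimate zero counts as treated but is not listed, because the algorithm keeps
nonzero estimates only. -/
theorem Listed.skip {s s' : RamState} {D : ℕ → Prop} {med : ℕ → ℝ} (h : Listed s D med) {n : ℕ}
    (hn : ¬ D n) (h30 : s'.nat 30 = s.nat 30) (h31 : s'.nat 31 = s.nat 31)
    (h6 : s'.real 6 = s.real 6) :
    Listed s' (fun m => D m ∨ m = n) (Function.update med n 0) := by
  unfold Listed
  rw [h30, h31, h6]
  obtain ⟨h1, h2, h3⟩ := h
  have hne : ∀ i < s.nat 30 0, s.nat 31 i ≠ n := by
    intro i hi e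
    exact hn ((h2 n).2 ⟨i, hi, e⟩).1
  refine ⟨h1, fun m => ?_, fun i hi => ?_⟩
  · rw [← h2 m]
    by_cases hm : m = n
    · subst hm; simp [hn]
    · simp [hm]
  · rw [Function.update_of_ne (hne i hi), h3 i hi]

theorem Listed.push {s s' : RamState} {D : ℕ → Prop} {med : ℕ → ℝ} (h : Listed s D med) {n : ℕ}
    (hn : ¬ D n) {v : ℝ} (hv : v ≠ 0) (h30 : s'.nat 30 0 = s.nat 30 0 + 1)
    (h31 : s'.nat 31 = Function.update (s.nat 31) (s.nat 30 0) n)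
    (h6 : s'.real 6 = Function.update (s.real 6) (s.nat 30 0) v) :
    Listed s' (fun m => D m ∨ m = n) (Function.update med n v) := by
  unfold Listed
  rw [h30, h31, h6]
  obtain ⟨h1, h2, h3⟩ := h
  set c := s.nat 30 0
  have hne : ∀ i < c, s.nat 31 i ≠ n := by
    intro i hi e
    exact hn ((h2 n).2 ⟨i, hi, e⟩).1
  refine ⟨fun i hi j hj hij => ?_, fun m => ?_, fun i hi => ?_⟩
  · by_cases hic : i = c <;> by_cases hjc : j = c
    · omega
    · rw [hic, Function.update_self, Function.update_of_ne hjc] at hij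
      exact absurd hij.symm (hne j (by omega))
    · rw [hjc, Function.update_self, Function.update_of_ne hic] at hij
      exact absurd hij (hne i (by omega))
    · rw [Function.update_of_ne hic, Function.update_of_ne hjc] at hij
      exact h1 i (by omega) j (by omega) hij
  · by_cases hm : m = n
    · subst hm
      simp only [or_true, Function.update_self, true_and]
      exact ⟨fun _ => ⟨c, by omega, by simp⟩, fun _ => hv⟩
    · simp only [hm, or_false, Function.update_of_ne, ne_eq, not_false_iff]
      rw [← ne_eq, h2 m]
      constructor
      · rintro ⟨i, hi, e⟩
        exact ⟨i, by omega, by rw [Function.update_of_ne (by omega), e]⟩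
      · rintro ⟨i, hi, e⟩
        by_cases hic : i = c
        · rw [hic, Function.update_self] at e
          exact absurd e.symm hm
        · rw [Function.update_of_ne hic] at e
          exact ⟨i, by omega, e⟩
  · by_cases hic : i = c
    · simp [hic]
    · rw [Function.update_of_ne hic, Function.update_of_ne hic,
        Function.update_of_ne (hne i (by omega)), h3 i (by omega)]

/-- Lists the median of the first `nat 33` entries of the work array, if it is not zero, as the
estimate for the index `nat 32`. -/
def medStoreCmd : RamCmd :=
  .branch (.natLt (.const 0) (.var 33))
    (.seq (.seq (.assign 22 (.const 0)) (.seq (.assign 19 (.var 33))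
        (.seq (.assign 20 (.div (.var 33) (.const 2))) (.assign 21 (.const 0)))))
      (.seq (.call 0)
        (.branch (.and (.not (.realLt (.get 4 (.const 0)) (.ofNat (.const 0))))
            (.not (.realLt (.ofNat (.const 0)) (.get 4 (.const 0))))) .nop
          (.seq (.setNat 31 (.var 30) (.var 32))
            (.seq (.setReal 6 (.var 30) (.get 4 (.const 0))) (.incr 30))))))
    .nop

theorem medStoreCmd_spec (s : RamState) {D : ℕ → Prop} {med : ℕ → ℝ} (hL : Listed s D med)
    (hD : ¬ D (s.nat 32 0)) :
    Reaches [selectBody] medStoreCmd s (20000 * s.nat 33 0 + 200) fun s' =>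
      Frame 10 32 3 7 s s' ∧ ∃ v, (0 < s.nat 33 0 → IsRank (s.real 3) (s.nat 33 0) (s.nat 33 0 / 2) v) ∧
        Listed s' (fun m => D m ∨ m = s.nat 32 0) (Function.update med (s.nat 32 0) v) := by
  have hp : ∀ d ∈ [selectBody], d.framed 10 32 3 7 = true := by
    simp only [List.mem_singleton, forall_eq]; decide
  refine Reaches.frame (Q := fun s' => ∃ v, (0 < s.nat 33 0 → IsRank (s.real 3) (s.nat 33 0)
    (s.nat 33 0 / 2) v) ∧ Listed s' (fun m => D m ∨ m = s.nat 32 0)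
      (Function.update med (s.nat 32 0) v)) ?_ 10 32 3 7 hp rfl
  unfold medStoreCmd
  set l := s.nat 33 0 with hl
  refine Reaches.branch (B := 20000 * l + 180) (by simp [RamTest.cost, NatExpr.cost]; omega)
    (fun h => ?_) fun h => ?_
  · replace h : 0 < l := by simpa [RamTest.Holds, NatExpr.eval, ← hl] using h
    refine Reaches.simple_seq (B' := 20000 * l + 150) 19 23 3 3 rfl rfl
      (by simp [RamCmd.maxCost, NatExpr.cost]; omega) fun hF₁ => ?_
    set s₁ := RamCmd.post _ s with hs₁
    have e22 : s₁.nat 22 0 = 0 := by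
      simp [hs₁, RamCmd.post, NatExpr.eval, RamState.setNat_nat]
    have e19 : s₁.nat 19 0 = l := by
      simp [hs₁, RamCmd.post, NatExpr.eval, RamState.setNat_nat, hl]
    have e20 : s₁.nat 20 0 = l / 2 := by
      simp [hs₁, RamCmd.post, NatExpr.eval, RamState.setNat_nat, hl]
    have e21 : s₁.nat 21 0 = 0 := by
      simp [hs₁, RamCmd.post, NatExpr.eval, RamState.setNat_nat]
    have e3 : s₁.real = s.real := rfl
    have hcall := ((Reaches.call (i := 0) rfl (selectBody_spec l s₁ (by rw [e22, e19])
      (by rw [e22, e20]; omega))).frame 10 30 3 6 selectBody_framed rfl)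
    rw [e22] at hcall
    refine Reaches.mono (hcall.seq (B' := 100) ?_) (by omega) fun _ h => h
    rintro s₂ ⟨hF₂, hrank, -, -⟩
    simp only [e21, e19, e20, e3, zero_add] at hrank
    have e30 : s₂.nat 30 = s.nat 30 := by rw [hF₂.1 30 (by norm_num), hF₁.1 30 (by norm_num)]
    have e31 : s₂.nat 31 = s.nat 31 := by rw [hF₂.1 31 (by norm_num), hF₁.1 31 (by norm_num)]
    have e32 : s₂.nat 32 = s.nat 32 := by rw [hF₂.1 32 (by norm_num), hF₁.1 32 (by norm_num)]
    have e6 : s₂.real 6 = s.real 6 := by rw [hF₂.2 6 (by norm_num), e3]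
    refine Reaches.branch (B := 50) (by decide) (fun hz => ?_) fun hz => ?_
    · have hz' : s₂.real 4 0 = 0 := by
        simp only [RamTest.Holds, RealExpr.eval, NatExpr.eval, not_lt, Nat.cast_zero] at hz
        exact le_antisymm hz.2 hz.1
      refine Reaches.of_simple rfl (by decide) ⟨0, fun _ => hz' ▸ hrank, ?_⟩
      exact hL.skip hD e30 e31 e6
    · have hz' : s₂.real 4 0 ≠ 0 := by
        intro h0
        simp [RamTest.Holds, RealExpr.eval, NatExpr.eval, h0] at hz
      refine Reaches.of_simple rfl (by decide) ⟨_, fun _ => hrank, ?_⟩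
      refine hL.push hD hz' ?_ ?_ ?_
      · simp [RamCmd.post, NatExpr.eval, RamState.setNat_nat, RamState.setReal_nat, e30]
      · simp [RamCmd.post, NatExpr.eval, RamState.setNat_nat, RamState.setReal_nat, e30, e31, e32]
      · simp [RamCmd.post, NatExpr.eval, RealExpr.eval, RamState.setNat_nat, RamState.setNat_real,
          RamState.setReal_real, e30, e6]
  · replace h : ¬ 0 < l := by simpa [RamTest.Holds, NatExpr.eval, ← hl] using h
    -- Without measurements any number is admissible as a median; zero is recorded and nothing is
    -- listed.
    exact Reaches.of_simple rfl (le_trans (by decide : _ ≤ 150) (by omega))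
      ⟨0, fun h' => absurd h' h, hL.skip hD rfl rfl rfl⟩

/-- The listed pairs `(nat 4, real 2)` are those with the positions `J` in `cand` and `west`. -/
def Emitted (s : RamState) (cand : ℕ → ℕ) (west : ℕ → ℝ) (J : Finset ℕ) : Prop :=
  s.nat 3 0 = J.card ∧ ∀ g : ℕ → ℝ → ℝ,
    ∑ i ∈ Finset.range (s.nat 3 0), g (s.nat 4 i) (s.real 2 i) = ∑ j ∈ J, g (cand j) (west j)

theorem Emitted.insert {s s' : RamState} {cand : ℕ → ℕ} {west : ℕ → ℝ} {J : Finset ℕ}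
    (h : Emitted s cand west J) {j : ℕ} (hj : j ∉ J) (h3 : s'.nat 3 0 = s.nat 3 0 + 1)
    (h4 : s'.nat 4 = Function.update (s.nat 4) (s.nat 3 0) (cand j))
    (h2 : s'.real 2 = Function.update (s.real 2) (s.nat 3 0) (west j)) :
    Emitted s' cand west (insert j J) := by
  obtain ⟨ha, hb⟩ := h
  refine ⟨by rw [h3, ha, Finset.card_insert_of_notMem hj], fun g => ?_⟩
  rw [h3, Finset.sum_range_succ, h4, h2, Finset.sum_insert hj, add_comm, ← hb g]
  congr 1
  · simp
  · refine Finset.sum_congr rfl fun i hi => ?_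
    rw [Finset.mem_range] at hi
    rw [Function.update_of_ne (by omega), Function.update_of_ne (by omega)]

/-- Outputs the listed estimates that pass a test. -/
def emitLoop (t : RamTest) : RamCmd :=
  .seq (.assign 5 (.const 0))
    (.loop (.natLt (.var 5) (.var 30))
      (.seq (.branch t
          (.seq (.setNat 4 (.var 3) (.get 31 (.var 5)))
            (.seq (.setReal 2 (.var 3) (.get 6 (.var 5))) (.incr 3))) .nop)
        (.incr 5)))

/-- The predicate `I j J` describes the set `J` of positions output among the first `j`. It is left
abstract because the loop runs twice with different tests: for estimates above the threshold, and
for ties. -/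
theorem emitLoop_spec (procs : List RamCmd) (s : RamState) (t : RamTest) (htc : t.cost ≤ 50)
    (I : ℕ → Finset ℕ → Prop) {J₀ : Finset ℕ} (hE : Emitted s (s.nat 31) (s.real 6) J₀)
    (h0 : I 0 J₀)
    (hstep : ∀ j < s.nat 30 0, ∀ J s', Frame 3 6 2 3 s s' → s'.nat 5 0 = j → I j J →
      s'.nat 3 0 = J.card → (t.Holds s' → j ∉ J ∧ I (j + 1) (insert j J)) ∧
        (¬ t.Holds s' → I (j + 1) J)) :
    Reaches procs (emitLoop t) s (100 * s.nat 30 0 + 100) fun s' => Frame 3 6 2 3 s s' ∧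
      ∃ J, I (s.nat 30 0) J ∧ Emitted s' (s.nat 31) (s.real 6) J := by
  unfold emitLoop
  refine Reaches.simple_seq (B' := 100 * s.nat 30 0 + 50) 3 6 2 3 rfl rfl
    (by simp [RamCmd.maxCost, NatExpr.cost]; omega) fun hF₁ =>
    Reaches.loop_simple 3 6 2 3 rfl rfl (fun j s' => s'.nat 5 0 = j ∧
      ∃ J, I j J ∧ Emitted s' (s.nat 31) (s.real 6) J) (s.nat 30 0) ?_ ?_ ?_ ?_
  · simp [RamCmd.maxCost, NatExpr.cost, RealExpr.cost, RamTest.cost]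
    have : s.nat 30 0 * t.cost ≤ s.nat 30 0 * 50 := Nat.mul_le_mul_left _ htc
    nlinarith
  · refine ⟨by simp [RamCmd.post, NatExpr.eval, RamState.setNat_nat], J₀, h0, ?_⟩
    simpa [Emitted, RamCmd.post, NatExpr.eval, RamState.setNat_nat, RamState.setNat_real] using hE
  · rintro j hj s' hF ⟨h5, J, hI, hEm⟩
    replace hF := hF₁.trans hF
    have e30 := hF.1 30 (by norm_num)
    have e31 := hF.1 31 (by norm_num)
    have e6 := hF.2 6 (by norm_num)
    refine ⟨by simp [RamTest.Holds, NatExpr.eval, h5, e30, hj], ?_⟩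
    have hst := hstep j hj J s' hF h5 hI hEm.1
    by_cases h : t.Holds s'
    · refine ⟨?_, insert j J, (hst.1 h).2, hEm.insert (hst.1 h).1 ?_ ?_ ?_⟩
      · simp [RamCmd.post, h, NatExpr.eval, RamState.setNat_nat, RamState.setReal_nat, h5]
      · simp [RamCmd.post, h, NatExpr.eval, RamState.setNat_nat, RamState.setReal_nat]
      · simp [RamCmd.post, h, NatExpr.eval, RamState.setNat_nat, RamState.setReal_nat, h5, e31]
      · simp [RamCmd.post, h, NatExpr.eval, RealExpr.eval, RamState.setNat_nat,
          RamState.setNat_real, RamState.setReal_real, h5, e6]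
    · have hs : ∀ c, RamCmd.post (.seq (.branch t c .nop) (.incr 5)) s' =
          RamCmd.post (.incr 5) s' := by simp [RamCmd.post, h]
      rw [hs]
      refine ⟨by simp [RamCmd.post, NatExpr.eval, RamState.setNat_nat, h5], J, hst.2 h, ?_⟩
      simpa [Emitted, RamCmd.post, NatExpr.eval, RamState.setNat_nat, RamState.setNat_real] using hEm
  · rintro s' hF ⟨h5, hJ⟩
    have e30 := (hF₁.trans hF).1 30 (by norm_num)
    exact ⟨by simp [RamTest.Holds, NatExpr.eval, h5, e30], hF₁.trans hF, hJ⟩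

/-- Stores the squares of the listed estimates in the work array and in real array `7`. -/
def keysCmd : RamCmd :=
  .seq (.assign 5 (.const 0))
    (.loop (.natLt (.var 5) (.var 30))
      (.seq (.setReal 3 (.var 5) (.mul (.get 6 (.var 5)) (.get 6 (.var 5))))
        (.seq (.setReal 7 (.var 5) (.get 3 (.var 5))) (.incr 5))))

/-- Squares order the estimates like their magnitudes and need no absolute value. The copy in real
array `7` survives the selection, which rearranges the work array. -/
theorem keysCmd_spec (procs : List RamCmd) (s : RamState) :
    Reaches procs keysCmd s (100 * s.nat 30 0 + 100) fun s' =>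
      (Frame 5 6 3 8 s s' ∧ s'.real 6 = s.real 6) ∧
      ∀ j < s.nat 30 0, s'.real 3 j = s.real 6 j ^ 2 ∧ s'.real 7 j = s.real 6 j ^ 2 := by
  unfold keysCmd
  refine Reaches.simple_seq (B' := 100 * s.nat 30 0 + 50) 5 6 3 8 rfl rfl
    (by simp [RamCmd.maxCost, NatExpr.cost]; omega) fun hF₁ =>
    Reaches.loop_simple 5 6 3 8 rfl rfl (fun j s' => s'.nat 5 0 = j ∧ s'.real 6 = s.real 6 ∧
      ∀ i < j, s'.real 3 i = s.real 6 i ^ 2 ∧ s'.real 7 i = s.real 6 i ^ 2) (s.nat 30 0) ?_ ?_ ?_ ?_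
  · simp [RamCmd.maxCost, NatExpr.cost, RealExpr.cost, RamTest.cost]; omega
  · exact ⟨by simp [RamCmd.post, NatExpr.eval, RamState.setNat_nat], rfl, by simp⟩
  · rintro j hj s' hF ⟨h5, h6, hI⟩
    have e30 := (hF₁.trans hF).1 30 (by norm_num)
    refine ⟨by simp [RamTest.Holds, NatExpr.eval, h5, e30, hj], ?_, ?_, ?_⟩
    · simp [RamCmd.post, NatExpr.eval, RamState.setNat_nat, RamState.setReal_nat, h5]
    · simp [RamCmd.post, RamState.setNat_real, RamState.setReal_real, h6]
    · intro i hi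
      simp only [RamCmd.post, NatExpr.eval, RealExpr.eval, RamState.setNat_real,
        RamState.setReal_real, RamState.setReal_nat, h5, h6, if_true, Nat.reduceEqDiff, if_false,
        Function.update_self]
      by_cases hij : i = j
      · subst hij; simp [sq]
      · rw [Function.update_of_ne hij, Function.update_of_ne hij]
        exact hI i (by omega)
  · rintro s' hF ⟨h5, h6, hI⟩
    have e30 := (hF₁.trans hF).1 30 (by norm_num)
    exact ⟨by simp [RamTest.Holds, NatExpr.eval, h5, e30], ⟨hF₁.trans hF, h6⟩, hI⟩

/-- The threshold `real 8` for the squares of the estimates to be output; `nat 0 1` is half of the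
number of estimates to be kept. -/
def thresholdCmd : RamCmd :=
  .branch (.natLt (.mul (.const 2) (.get 0 (.const 1))) (.var 30))
    (.seq (.seq (.assign 22 (.const 0)) (.seq (.assign 19 (.var 30))
        (.seq (.assign 20 (.sub (.var 30) (.mul (.const 2) (.get 0 (.const 1)))))
          (.assign 21 (.const 0)))))
      (.seq (.call 0) (.setReal 8 (.const 0) (.get 4 (.const 0)))))
    (.setReal 8 (.const 0) (.sub (.ofNat (.const 0)) (.ofNat (.const 1))))

/-- An element of rank `c - 2 k` among `c` keys has at most `2 k` keys above it and at least `2 k`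
keys at or above it; `k ≥ 1` makes this rank smaller than `c`. If there are at most `2 k` keys, the
threshold `-1` lies below every square. -/
theorem thresholdCmd_spec (s : RamState) {f : ℕ → ℝ} {c k : ℕ} (hc : s.nat 30 0 = c)
    (hk : s.nat 0 1 = k) (hk1 : 1 ≤ k) (hf : ∀ j < c, s.real 3 j = f j) (hf0 : ∀ j, 0 ≤ f j) :
    Reaches [selectBody] thresholdCmd s (20000 * c + 200) fun s' =>
      Frame 10 30 3 9 s s' ∧ s'.real 6 = s.real 6 ∧ s'.real 7 = s.real 7 ∧
      countBelow (fun j => s'.real 8 0 < f j) c ≤ 2 * k ∧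
      min (2 * k) c ≤ countBelow (fun j => s'.real 8 0 ≤ f j) c ∧
      (c ≤ 2 * k → ∀ j, s'.real 8 0 < f j) := by
  have hp : ∀ d ∈ [selectBody], d.framed 10 30 3 9 = true := by
    simp only [List.mem_singleton, forall_eq]; decide
  refine Reaches.frame (Q := fun s' => s'.real 6 = s.real 6 ∧ s'.real 7 = s.real 7 ∧
      countBelow (fun j => s'.real 8 0 < f j) c ≤ 2 * k ∧
      min (2 * k) c ≤ countBelow (fun j => s'.real 8 0 ≤ f j) c ∧
      (c ≤ 2 * k → ∀ j, s'.real 8 0 < f j)) ?_ 10 30 3 9 hp rfl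
  unfold thresholdCmd
  refine Reaches.branch (B := 20000 * c + 180) (by simp [RamTest.cost, NatExpr.cost]; omega)
    (fun h => ?_) fun h => ?_
  · replace h : 2 * k < c := by simpa [RamTest.Holds, NatExpr.eval, hc, hk] using h
    refine Reaches.simple_seq (B' := 20000 * c + 150) 19 23 3 3 rfl rfl
      (by simp [RamCmd.maxCost, NatExpr.cost]; omega) fun hF₁ => ?_
    set s₁ := RamCmd.post _ s with hs₁
    have e22 : s₁.nat 22 0 = 0 := by
      simp [hs₁, RamCmd.post, NatExpr.eval, RamState.setNat_nat]
    have e19 : s₁.nat 19 0 = c := by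
      simp [hs₁, RamCmd.post, NatExpr.eval, RamState.setNat_nat, hc]
    have e20 : s₁.nat 20 0 = c - 2 * k := by
      simp [hs₁, RamCmd.post, NatExpr.eval, RamState.setNat_nat, hc, hk]
    have e21 : s₁.nat 21 0 = 0 := by
      simp [hs₁, RamCmd.post, NatExpr.eval, RamState.setNat_nat]
    have e3 : s₁.real = s.real := rfl
    have hcall := ((Reaches.call (i := 0) rfl (selectBody_spec c s₁ (by rw [e22, e19])
      (by rw [e22, e20]; omega))).frame 10 30 3 6 selectBody_framed rfl)
    rw [e22] at hcall
    refine Reaches.mono (hcall.seq (B' := 100) ?_) (by omega) fun _ h => h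
    rintro s₂ ⟨hF₂, hrank, -, -⟩
    simp only [e21, e19, e20, e3, zero_add] at hrank
    replace hrank := hrank.congr (g := f) hf
    have e6 : s₂.real 6 = s.real 6 := by rw [hF₂.2 6 (by norm_num), e3]
    have e7 : s₂.real 7 = s.real 7 := by rw [hF₂.2 7 (by norm_num), e3]
    have e8 : (RamCmd.post (.setReal 8 (.const 0) (.get 4 (.const 0))) s₂).real 8 0 =
        s₂.real 4 0 := by
      simp [RamCmd.post, NatExpr.eval, RealExpr.eval, RamState.setReal_real]
    refine Reaches.of_simple rfl (by decide) ⟨?_, ?_, ?_, ?_, fun h' => by omega⟩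
    · simp [RamCmd.post, RamState.setReal_real, e6]
    · simp [RamCmd.post, RamState.setReal_real, e7]
    · rw [e8]
      have h1 := hrank.2
      have h2 := countBelow_not (fun j => f j ≤ s₂.real 4 0) c
      simp only [not_le] at h2
      omega
    · rw [e8]
      have h1 := hrank.1
      have h2 := countBelow_not (fun j => f j < s₂.real 4 0) c
      simp only [not_lt] at h2
      omega
  · replace h : ¬ 2 * k < c := by simpa [RamTest.Holds, NatExpr.eval, hc, hk] using h
    have e8 : (RamCmd.post (.setReal 8 (.const 0) (.sub (.ofNat (.const 0)) (.ofNat (.const 1))))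
        s).real 8 0 = -1 := by
      simp [RamCmd.post, NatExpr.eval, RealExpr.eval, RamState.setReal_real]
    have hlt : ∀ j, (-1 : ℝ) < f j := fun j => by linarith [hf0 j]
    refine Reaches.of_simple rfl (le_trans (by decide : _ ≤ 150) (by omega)) ⟨?_, ?_, ?_, ?_, ?_⟩
    · simp [RamCmd.post, RamState.setReal_real]
    · simp [RamCmd.post, RamState.setReal_real]
    · have := countBelow_le (fun j => (-1 : ℝ) < f j) c
      rw [e8]; omega
    · rw [e8]
      have h2 := countBelow_not (fun j => -1 ≤ f j) c
      have h3 : countBelow (fun j => ¬ -1 ≤ f j) c = 0 := by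
        by_contra h
        obtain ⟨j, hj, hh⟩ := countBelow_pos.1 (Nat.pos_of_ne_zero h)
        exact hh (hlt j).le
      omega
    · rw [e8]; exact fun _ => hlt

/-- Outputs the listed estimates of largest magnitude. -/
def topCmd : RamCmd :=
  .seq keysCmd (.seq thresholdCmd (.seq (.assign 3 (.const 0))
    (.seq (emitLoop (.realLt (.get 8 (.const 0)) (.get 7 (.var 5))))
      (emitLoop (.and (.and (.not (.realLt (.get 8 (.const 0)) (.get 7 (.var 5))))
        (.not (.realLt (.get 7 (.var 5)) (.get 8 (.const 0)))))
        (.natLt (.var 3) (.mul (.const 2) (.get 0 (.const 1)))))))))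

theorem countBelow_eq_card (p : ℕ → Prop) [DecidablePred p] (n : ℕ) :
    countBelow p n = ((Finset.range n).filter p).card := by
  unfold countBelow
  rw [← Nat.count_eq_card_filter_range]
  congr

/-- Everything strictly above the threshold fits into the `2 k` places, and together with the ties
at the threshold there are enough estimates to fill them. So a first pass outputs the former, and a
second pass fills up with ties. -/
theorem topCmd_spec (s : RamState) {c k : ℕ} (hc : s.nat 30 0 = c) (hk : s.nat 0 1 = k)
    (hk1 : 1 ≤ k) :
    Reaches [selectBody] topCmd s (21000 * c + 1000) fun s' =>
      ∃ J ⊆ Finset.range c, J.card = min (2 * k) c ∧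
        (∀ i ∈ J, ∀ j < c, j ∉ J → |s.real 6 j| ≤ |s.real 6 i|) ∧
        Emitted s' (s.nat 31) (s.real 6) J := by
  classical
  unfold topCmd
  set f : ℕ → ℝ := fun j => s.real 6 j ^ 2 with hf
  have hf0 : ∀ j, 0 ≤ f j := fun j => sq_nonneg _
  refine Reaches.mono (Reaches.seq (keysCmd_spec _ s) (B' := 20500 * c + 800) ?_)
    (by rw [hc]; omega) fun _ h => h
  rintro s₁ ⟨⟨hF₁, e6⟩, hkeys⟩
  rw [hc] at hkeys
  have a30 : s₁.nat 30 0 = c := by rw [hF₁.1 30 (by norm_num), hc]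
  have a0 : s₁.nat 0 1 = k := by rw [hF₁.1 0 (by norm_num), hk]
  refine Reaches.mono (Reaches.seq (thresholdCmd_spec s₁ a30 a0 hk1 (fun j hj => (hkeys j hj).1)
    hf0) (B' := 250 * c + 500) ?_) (by omega) fun _ h => h
  rintro s₂ ⟨hF₂, b6, b7, hgt, hge, hsmall⟩
  set θ := s₂.real 8 0 with hθ
  have hkey₂ : ∀ j < c, s₂.real 7 j = f j := fun j hj => by rw [b7, (hkeys j hj).2]
  refine Reaches.simple_seq (B' := 250 * c + 400) 3 6 2 3 rfl rfl
    (by simp [RamCmd.maxCost, NatExpr.cost]; omega) fun hF₃ => ?_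
  set s₃ := RamCmd.post _ s₂ with hs₃
  have c3 : s₃.nat 3 0 = 0 := by simp [hs₃, RamCmd.post, NatExpr.eval, RamState.setNat_nat]
  have c30 : s₃.nat 30 0 = c := by
    rw [hF₃.1 30 (by norm_num), hF₂.1 30 (by norm_num), a30]
  have c31 : s₃.nat 31 = s.nat 31 := by
    rw [hF₃.1 31 (by norm_num), hF₂.1 31 (by norm_num), hF₁.1 31 (by norm_num)]
  have c0 : s₃.nat 0 1 = k := by
    rw [hF₃.1 0 (by norm_num), hF₂.1 0 (by norm_num), a0]
  have c6 : s₃.real 6 = s.real 6 := by rw [hF₃.2 6 (by norm_num), b6, e6]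
  have c7 : ∀ j < c, s₃.real 7 j = f j := fun j hj => by rw [hF₃.2 7 (by norm_num), hkey₂ j hj]
  have c8 : s₃.real 8 0 = θ := by rw [hF₃.2 8 (by norm_num)]
  refine Reaches.mono (Reaches.seq (emitLoop_spec _ s₃ _ (by decide)
    (fun j J => J = (Finset.range j).filter (fun i => θ < f i)) (J₀ := ∅) ⟨by simp [c3], by simp [c3]⟩
    (by simp) ?_) (B' := 100 * c + 100) ?_) (by rw [c30]; omega)
    fun _ h => h
  · rintro j hj J s' hF h5 rfl -
    rw [c30] at hj
    have hT : RamTest.Holds s' (.realLt (.get 8 (.const 0)) (.get 7 (.var 5))) ↔ θ < f j := by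
      simp only [RamTest.Holds, RealExpr.eval, NatExpr.eval, h5]
      rw [hF.2 8 (by norm_num), hF.2 7 (by norm_num), c8, c7 j hj]
    rw [hT, Finset.range_add_one, Finset.filter_insert]
    exact ⟨fun h => ⟨by simp, by rw [if_pos h]⟩, fun h => by rw [if_neg h]⟩
  rintro s₄ ⟨hF₄, J₁, hJ₁, hE₁⟩
  rw [c30] at hJ₁
  rw [c31, c6] at hE₁
  have d31 : s₄.nat 31 = s.nat 31 := by rw [hF₄.1 31 (by norm_num), c31]
  have d30 : s₄.nat 30 0 = c := by rw [hF₄.1 30 (by norm_num), c30]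
  have d0 : s₄.nat 0 1 = k := by rw [hF₄.1 0 (by norm_num), c0]
  have d6 : s₄.real 6 = s.real 6 := by rw [hF₄.2 6 (by norm_num), c6]
  have d7 : ∀ j < c, s₄.real 7 j = f j := fun j hj => by rw [hF₄.2 7 (by norm_num), c7 j hj]
  have d8 : s₄.real 8 0 = θ := by rw [hF₄.2 8 (by norm_num), c8]
  rw [countBelow_eq_card] at hgt hge
  have hmem₁ : ∀ j, j ∈ J₁ ↔ j < c ∧ θ < f j := fun j => by simp [hJ₁]
  -- Invariant of the second pass: only ties at positions below `j` have been added, and either all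
  -- `2 k` places are taken or no tie seen so far was refused.
  refine (emitLoop_spec _ s₄ _ (by decide) (fun j J => J₁ ⊆ J ∧
      (∀ i ∈ J, i ∈ J₁ ∨ i < j ∧ i < c ∧ f i = θ) ∧ J.card ≤ 2 * k ∧
      (J.card = 2 * k ∨ ∀ i < j, i < c → f i = θ → i ∈ J)) (J₀ := J₁) (by rw [d31, d6]; exact hE₁)
      ⟨subset_rfl, fun i hi => Or.inl hi, by rw [hJ₁]; exact hgt, Or.inr (by simp)⟩ ?_).mono (by rw [d30]) ?_
  · rintro j hj J s' hF h5 ⟨hsub, hJ, hcard, hfull⟩ h3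
    rw [d30] at hj
    have hT : RamTest.Holds s' (.and (.and (.not (.realLt (.get 8 (.const 0)) (.get 7 (.var 5))))
        (.not (.realLt (.get 7 (.var 5)) (.get 8 (.const 0)))))
        (.natLt (.var 3) (.mul (.const 2) (.get 0 (.const 1))))) ↔ f j = θ ∧ J.card < 2 * k := by
      simp only [RamTest.Holds, RealExpr.eval, NatExpr.eval, h5, h3]
      rw [hF.2 8 (by norm_num), hF.2 7 (by norm_num), hF.1 0 (by norm_num), d8, d7 j hj, d0,
        not_lt, not_lt, and_congr_left_iff]
      exact fun _ => ⟨fun h => le_antisymm h.1 h.2, fun h => ⟨h.le, h.ge⟩⟩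
    rw [hT]
    refine ⟨fun ⟨hfj, hlt⟩ => ?_, fun hneg => ⟨hsub, fun i hi => ?_, hcard, ?_⟩⟩
    · have hjJ : j ∉ J := fun h => by
        rcases hJ j h with h | h
        · exact absurd ((hmem₁ j).1 h).2 (by rw [hfj]; exact lt_irrefl _)
        · omega
      refine ⟨hjJ, hsub.trans (Finset.subset_insert _ _), fun i hi => ?_, ?_, Or.inr ?_⟩
      · rcases Finset.mem_insert.1 hi with rfl | hi
        · exact Or.inr ⟨by omega, hj, hfj⟩
        · rcases hJ i hi with h | h
          · exact Or.inl h
          · exact Or.inr ⟨by omega, h.2⟩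
      · rw [Finset.card_insert_of_notMem hjJ]; omega
      · intro i hi hic hfi
        rcases Nat.lt_succ_iff_lt_or_eq.1 hi with h | rfl
        · rcases hfull with h' | h'
          · omega
          · exact Finset.mem_insert_of_mem (h' i h hic hfi)
        · exact Finset.mem_insert_self _ _
    · rcases hJ i hi with h | h
      · exact Or.inl h
      · exact Or.inr ⟨by omega, h.2⟩
    · rcases hfull with h | h
      · exact Or.inl h
      · by_cases hfj : f j = θ
        · exact Or.inl (by
            have : ¬ J.card < 2 * k := fun h => hneg ⟨hfj, h⟩
            omega)
        · refine Or.inr fun i hi hic hfi => ?_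
          rcases Nat.lt_succ_iff_lt_or_eq.1 hi with h' | rfl
          · exact h i h' hic hfi
          · exact absurd hfi hfj
  · rintro s₅ ⟨-, J, ⟨hsub, hJ, hcard, hfull⟩, hE⟩
    rw [d30] at hfull
    rw [d31, d6] at hE
    have hJc : J ⊆ Finset.range c := fun i hi => by
      rcases hJ i hi with h | h
      · exact Finset.mem_range.2 ((hmem₁ i).1 h).1
      · exact Finset.mem_range.2 h.2.1
    have hJθ : ∀ i ∈ J, θ ≤ f i := fun i hi => by
      rcases hJ i hi with h | h
      · exact ((hmem₁ i).1 h).2.le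
      · exact h.2.2.ge
    have hJc' : J.card ≤ c := by simpa using Finset.card_le_card hJc
    refine ⟨J, hJc, ?_, fun i hi j hj hjJ => ?_, hE⟩
    · rcases hfull with h | h
      · omega
      · have : (Finset.range c).filter (fun j => θ ≤ f j) ⊆ J := fun i hi => by
          rw [Finset.mem_filter, Finset.mem_range] at hi
          rcases hi.2.lt_or_eq with h' | h'
          · exact hsub ((hmem₁ i).2 ⟨hi.1, h'⟩)
          · exact h i hi.1 hi.1 h'.symm
        have := Finset.card_le_card this
        have hge' : min (2 * k) c ≤ ((Finset.range c).filter (fun j => θ ≤ f j)).card := hge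
        omega
    · have h1 : f j ≤ θ := by
        by_contra h
        exact hjJ (hsub ((hmem₁ j).2 ⟨hj, not_le.1 h⟩))
      exact sq_le_sq.1 (h1.trans (hJθ i hi))

/-- The output of the listed estimates of largest magnitude is an estimate. -/
theorem isEstimate_of_emitted {b N k : ℕ} {A : Matrix (Fin b) (Fin N) Bool} {y : Fin b → ℝ}
    {S : Finset (Fin N)} {s s' : RamState} {D : ℕ → Prop} {med : ℕ → ℝ} (hL : Listed s D med)
    (hDN : ∀ n, D n → n < N) (hDS : ∀ n : Fin N, n ∈ S ↔ D n)
    (hmed : ∀ n ∈ S, IsMedian (columnValues A y n) (med n)) {J : Finset ℕ}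
    (hJ : J ⊆ Finset.range (s.nat 30 0)) (hcard : J.card = min (2 * k) (s.nat 30 0))
    (hmax : ∀ i ∈ J, ∀ j < s.nat 30 0, j ∉ J → |s.real 6 j| ≤ |s.real 6 i|)
    (hE : Emitted s' (s.nat 31) (s.real 6) J) : IsEstimate A y S k (s'.output N) := by
  classical
  obtain ⟨hinj, hmem, hval⟩ := hL
  set c := s.nat 30 0 with hc
  set cand := s.nat 31 with hcand
  have hJc : ∀ j ∈ J, j < c := fun j hj => Finset.mem_range.1 (hJ hj)
  have hcN : ∀ j < c, cand j < N := fun j hj => hDN _ ((hmem _).2 ⟨j, hj, rfl⟩).1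
  have hfil : ∀ n : Fin N, n ∈ S.filter (fun n : Fin N => med n ≠ 0) ↔ ∃ j < c, cand j = n := by
    intro n
    rw [Finset.mem_filter, hDS, hmem]
  set T : Finset (Fin N) := Finset.univ.filter (fun n => ∃ j ∈ J, cand j = n.val) with hT
  have hTmem : ∀ n, n ∈ T ↔ ∃ j ∈ J, cand j = n.val := fun n => by simp [hT]
  have hTcard : T.card = J.card := by
    symm
    refine Finset.card_bij (fun j hj => ⟨cand j, hcN j (hJc j hj)⟩) ?_ ?_ ?_
    · intro j hj; exact (hTmem _).2 ⟨j, hj, rfl⟩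
    · intro i hi j hj hij
      exact hinj i (hJc i hi) j (hJc j hj) (by simpa using hij)
    · intro n hn
      obtain ⟨j, hj, h⟩ := (hTmem n).1 hn
      exact ⟨j, hj, Fin.ext h⟩
  have hFcard : (S.filter (fun n : Fin N => med n ≠ 0)).card = c := by
    rw [← Finset.card_range c]
    symm
    refine Finset.card_bij (fun j hj => ⟨cand j, hcN j (Finset.mem_range.1 hj)⟩) ?_ ?_ ?_
    · intro j hj; exact (hfil _).2 ⟨j, Finset.mem_range.1 hj, rfl⟩
    · intro i hi j hj hij
      exact hinj i (Finset.mem_range.1 hi) j (Finset.mem_range.1 hj) (by simpa using hij)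
    · intro n hn
      obtain ⟨j, hj, h⟩ := (hfil n).1 hn
      exact ⟨j, Finset.mem_range.2 hj, Fin.ext h⟩
  refine ⟨fun n => med n, hmed, T, ?_, ?_, ?_, ?_⟩
  · intro n hn
    obtain ⟨j, hj, h⟩ := (hTmem n).1 hn
    convert (hfil n).2 ⟨j, hJc j hj, h⟩
  · rw [hTcard, hcard, ← hFcard]
  · intro n hn m hm hmT
    obtain ⟨i, hi, hin⟩ := (hTmem n).1 hn
    obtain ⟨j, hj, hjm⟩ := (hfil m).1 (by convert hm)
    have := hmax i hi j hj fun h => hmT ((hTmem m).2 ⟨j, h, hjm⟩)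
    rwa [hval i (hJc i hi), hval j hj, hin, hjm] at this
  · funext n
    unfold RamState.output
    rw [hE.2 (fun a v => if a = n.val then v else 0)]
    split_ifs with hn
    · obtain ⟨j, hj, hjn⟩ := (hTmem n).1 hn
      rw [Finset.sum_eq_single_of_mem j hj, if_pos hjn, hval j (hJc j hj), hjn]
      intro i hi hij
      rw [if_neg]
      intro h
      exact hij (hinj i (hJc i hi) j (hJc j hj) (by rw [h, hjn]))
    · refine Finset.sum_eq_zero fun j hj => if_neg fun h => hn ((hTmem n).2 ⟨j, hj, h⟩)

theorem Listed.congr {s s' : RamState} {D D' : ℕ → Prop} {med : ℕ → ℝ} (h : Listed s D med)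
    (h30 : s'.nat 30 = s.nat 30) (h31 : s'.nat 31 = s.nat 31) (h6 : s'.real 6 = s.real 6)
    (hD : ∀ n, D' n ↔ D n) : Listed s' D' med := by
  unfold Listed at *
  rw [h30, h31, h6]
  simpa only [hD] using h

theorem Listed.card_le {s : RamState} {med : ℕ → ℝ} {M : ℕ} {idx : ℕ → ℕ}
    (h : Listed s (fun n => ∃ m < M, idx m = n) med) : s.nat 30 0 ≤ M := by
  classical
  have : (Finset.range (s.nat 30 0)).card ≤ ((Finset.range M).image idx).card := by
    refine Finset.card_le_card_of_injOn (s.nat 31) (fun j hj => ?_) (fun i hi j hj hij => ?_)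
    · obtain ⟨⟨m, hm, e⟩, -⟩ := (h.2.1 (s.nat 31 j)).2 ⟨j, by simpa using hj, rfl⟩
      exact Finset.mem_coe.2 (Finset.mem_image.2 ⟨m, Finset.mem_range.2 hm, e⟩)
    · exact h.1 i (by simpa using hi) j (by simpa using hj) hij
  simpa using this.trans Finset.card_image_le

/-- Calls `load`, which provides an index and the list of the values for it, `M` times, and lists
the nonzero medians. -/
def estimateLoop (M : NatExpr) (load : RamCmd) : RamCmd :=
  .seq (.assign 40 (.const 0))
    (.loop (.natLt (.var 40) M) (.seq load (.seq medStoreCmd (.incr 40))))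

/-- `load` provides the index `idx m` and the `len m` values `val m` in at most `cost m` steps. -/
def Loads (s : RamState) (load : RamCmd) (M : ℕ) (idx len cost : ℕ → ℕ) (val : ℕ → ℕ → ℝ) : Prop :=
  ∀ m < M, ∀ s', Frame 10 41 3 7 s s' → s'.nat 40 0 = m →
    Reaches [selectBody] load s' (cost m) fun s'' => Frame 32 40 3 4 s' s'' ∧
      s''.nat 32 0 = idx m ∧ s''.nat 33 0 = len m ∧ ∀ i < len m, s''.real 3 i = val m i

/-- Only the loading of the values depends on the matrix format, so `Loads` lets both programs share
this loop. Distinctness of the indices `idx m` guarantees that no earlier estimate is overwritten.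
-/
theorem estimateLoop_spec (s : RamState) {Me : NatExpr} {load : RamCmd} {M : ℕ}
    {idx len cost : ℕ → ℕ} {val : ℕ → ℕ → ℝ} (hMc : Me.cost ≤ 10)
    (hM : ∀ s', Frame 10 41 3 7 s s' → Me.eval s' = M) (hlf : load.framed 10 41 3 7 = true)
    (hload : Loads s load M idx len cost val) (h30 : s.nat 30 0 = 0)
    (hinj : ∀ i < M, ∀ j < M, idx i = idx j → i = j) :
    Reaches [selectBody] (estimateLoop Me load) s
      (∑ m ∈ Finset.range M, (cost m + 20000 * len m + 300) + 100) fun s' =>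
      Frame 10 41 3 7 s s' ∧ ∃ med, Listed s' (fun n => ∃ m < M, idx m = n) med ∧
        ∀ m < M, 0 < len m → IsRank (val m) (len m) (len m / 2) (med (idx m)) := by
  have hp : ∀ d ∈ [selectBody], d.framed 10 41 3 7 = true := by
    simp only [List.mem_singleton, forall_eq]; decide
  unfold estimateLoop
  refine Reaches.simple_seq (B' := ∑ m ∈ Finset.range M, (cost m + 20000 * len m + 300) + 50)
    10 41 3 7 rfl rfl (by simp [RamCmd.maxCost, NatExpr.cost]; omega) fun hF₁ =>
    Reaches.loop_frame (procs := [selectBody]) 10 41 3 7 hp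
      (by simp only [RamCmd.framed, hlf, Bool.true_and]; decide)
      (fun j s' => s'.nat 40 0 = j ∧ ∃ med, Listed s' (fun n => ∃ m < j, idx m = n) med ∧
        ∀ m < j, 0 < len m → IsRank (val m) (len m) (len m / 2) (med (idx m)))
      (fun m => cost m + 20000 * len m + 250) M ?_ ?_ ?_ ?_
  · have : ∑ m ∈ Finset.range M, (cost m + 20000 * len m + 250 +
        RamTest.cost (.natLt (.var 40) Me) + 1) ≤
        ∑ m ∈ Finset.range M, (cost m + 20000 * len m + 300) := by
      refine Finset.sum_le_sum fun m _ => ?_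
      simp [RamTest.cost, NatExpr.cost]; omega
    have h2 : RamTest.cost (.natLt (.var 40) Me) + 1 ≤ 50 := by
      simp [RamTest.cost, NatExpr.cost]; omega
    omega
  · refine ⟨by simp [RamCmd.post, NatExpr.eval, RamState.setNat_nat], fun _ => 0, ?_, by simp⟩
    simp [Listed, RamCmd.post, RamState.setNat_nat, h30]
  · rintro j hj s₁ hF ⟨h40, med, hL, hrank⟩
    replace hF := hF₁.trans hF
    refine ⟨by simp [RamTest.Holds, NatExpr.eval, h40, hM s₁ hF, hj], ?_⟩
    refine Reaches.mono (Reaches.seq (hload j hj s₁ hF h40) (B' := 20000 * len j + 250) ?_)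
      (by omega) fun _ h => h
    rintro s₂ ⟨hF₂, e32, e33, hval⟩
    have e40 : s₂.nat 40 0 = j := by rw [hF₂.1 40 (by norm_num), h40]
    have hL₂ : Listed s₂ (fun n => ∃ m < j, idx m = n) med :=
      hL.congr (hF₂.1 30 (by norm_num)) (hF₂.1 31 (by norm_num)) (hF₂.2 6 (by norm_num))
        fun _ => Iff.rfl
    refine Reaches.mono (Reaches.seq (medStoreCmd_spec s₂ hL₂ ?_) (B' := 50) ?_)
      (by rw [e33]) fun _ h => h
    · rintro ⟨m, hm, e⟩
      rw [e32] at e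
      exact absurd (hinj m (by omega) j hj e) (by omega)
    rintro s₃ ⟨hF₃, v, hv, hL₃⟩
    rw [e32] at hL₃
    rw [e33] at hv
    refine Reaches.of_simple rfl (by decide) ⟨?_, Function.update med (idx j) v, ?_, ?_⟩
    · have : s₃.nat 40 0 = j := by rw [hF₃.1 40 (by norm_num), e40]
      simp [RamCmd.post, NatExpr.eval, RamState.setNat_nat, this]
    · refine hL₃.congr rfl rfl rfl fun n => ⟨?_, ?_⟩
      · rintro ⟨m, hm, e⟩
        rcases Nat.lt_succ_iff_lt_or_eq.1 hm with h | rfl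
        · exact Or.inl ⟨m, h, e⟩
        · exact Or.inr e.symm
      · rintro (⟨m, hm, e⟩ | rfl)
        · exact ⟨m, by omega, e⟩
        · exact ⟨j, by omega, rfl⟩
    · intro m hm hl
      rcases Nat.lt_succ_iff_lt_or_eq.1 hm with h | rfl
      · rw [Function.update_of_ne fun e => absurd (hinj m (by omega) j hj e) (by omega)]
        exact hrank m h hl
      · rw [Function.update_self]
        exact (hv hl).congr hval
  · rintro s' hF ⟨h40, hmed⟩
    replace hF := hF₁.trans hF
    exact ⟨by simp [RamTest.Holds, NatExpr.eval, h40, hM s' hF], hF, hmed⟩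

theorem estimateLoop_topCmd_spec {b N k : ℕ} (A : Matrix (Fin b) (Fin N) Bool) (y : Fin b → ℝ)
    {S : Finset (Fin N)} (s : RamState) {Me : NatExpr} {load : RamCmd} {M : ℕ}
    {idx len cost : ℕ → ℕ} {val : ℕ → ℕ → ℝ} (hMc : Me.cost ≤ 10)
    (hM : ∀ s', Frame 10 41 3 7 s s' → Me.eval s' = M) (hlf : load.framed 10 41 3 7 = true)
    (hload : Loads s load M idx len cost val) (h30 : s.nat 30 0 = 0) (hk : s.nat 0 1 = k)
    (hk1 : 1 ≤ k) (hinj : ∀ i < M, ∀ j < M, idx i = idx j → i = j)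
    (hN : ∀ m < M, idx m < N) (hS : ∀ n : Fin N, n ∈ S ↔ ∃ m < M, idx m = n)
    (hval : ∀ m < M, ∀ n : Fin N, idx m = n →
      columnValues A y n = (Multiset.range (len m)).map (val m)) :
    Reaches [selectBody] (.seq (estimateLoop Me load) topCmd) s
      (∑ m ∈ Finset.range M, (cost m + 20000 * len m + 300) + 21000 * M + 1100) fun s' =>
      IsEstimate A y S k (s'.output N) := by
  refine Reaches.mono (Reaches.seq (estimateLoop_spec s hMc hM hlf hload h30 hinj)
    (B' := 21000 * M + 1000) ?_) (by omega) fun _ h => h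
  rintro s₁ ⟨hF, med, hL, hrank⟩
  have hcM := hL.card_le
  refine (topCmd_spec s₁ rfl (by rw [hF.1 0 (by norm_num), hk]) hk1).mono (by omega) ?_
  rintro s₂ ⟨J, hJ, hcard, hmax, hE⟩
  refine isEstimate_of_emitted hL ?_ hS ?_ hJ hcard hmax hE
  · rintro n ⟨m, hm, rfl⟩
    exact hN m hm
  · intro n hn
    obtain ⟨m, hm, e⟩ := (hS n).1 hn
    rw [hval m hm n e]
    -- A column without ones puts no constraint on its estimate.
    rcases Nat.eq_zero_or_pos (len m) with h0 | hpos
    · simp [IsMedian, h0]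
    · exact isMedian_of_isRank (e ▸ hrank m hm hpos)

/-! ### The program for estimation -/

/-- Loads the measurements of the rows with a one in column `nat 40`. -/
def loadColumnCmd : RamCmd :=
  .seq (.seq (.assign 32 (.var 40)) (.seq (.assign 33 (.const 0)) (.assign 34 (.get 1 (.var 40)))))
    (.loop (.natLt (.var 34) (.get 1 (.add (.var 40) (.const 1))))
      (.seq (.setReal 3 (.var 33) (.get 0 (.get 2 (.var 34)))) (.seq (.incr 33) (.incr 34))))

theorem loadColumnCmd_spec (procs : List RamCmd) (s : RamState) {m p l : ℕ} (hm : s.nat 40 0 = m)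
    (hp : s.nat 1 m = p) (hl : s.nat 1 (m + 1) = p + l) :
    Reaches procs loadColumnCmd s (100 * l + 100) fun s' => Frame 32 40 3 4 s s' ∧
      s'.nat 32 0 = m ∧ s'.nat 33 0 = l ∧ ∀ i < l, s'.real 3 i = s.real 0 (s.nat 2 (p + i)) := by
  unfold loadColumnCmd
  refine Reaches.simple_seq (B' := 100 * l + 50) 32 40 3 4 rfl rfl
    (by simp [RamCmd.maxCost, NatExpr.cost]; omega) fun hF₁ =>
    Reaches.loop_simple 32 40 3 4 rfl rfl (fun j s' => s'.nat 32 0 = m ∧ s'.nat 33 0 = j ∧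
      s'.nat 34 0 = p + j ∧ ∀ i < j, s'.real 3 i = s.real 0 (s.nat 2 (p + i))) l ?_ ?_ ?_ ?_
  · simp [RamCmd.maxCost, NatExpr.cost, RealExpr.cost, RamTest.cost]; omega
  · simp [RamCmd.post, NatExpr.eval, RamState.setNat_nat, hm, hp]
  · rintro j hj s' hF ⟨h32, h33, h34, hI⟩
    replace hF := hF₁.trans hF
    have e40 : s'.nat 40 0 = m := by rw [hF.1 40 (by norm_num), hm]
    have e1 := hF.1 1 (by norm_num)
    have e2 := hF.1 2 (by norm_num)
    have e0 := hF.2 0 (by norm_num)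
    refine ⟨by simp [RamTest.Holds, NatExpr.eval, h34, e40, e1, hl, hj], ?_, ?_, ?_, ?_⟩
    · simp [RamCmd.post, RamState.setNat_nat, RamState.setReal_nat, h32]
    · simp [RamCmd.post, NatExpr.eval, RamState.setNat_nat, RamState.setReal_nat, h33]
    · simp [RamCmd.post, NatExpr.eval, RamState.setNat_nat, RamState.setReal_nat, h34, add_assoc]
    · intro i hi
      simp only [RamCmd.post, NatExpr.eval, RealExpr.eval, RamState.setNat_real,
        RamState.setReal_real, if_true, h33, h34, e0, e2]
      by_cases hij : i = j
      · rw [hij, Function.update_self]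
      · rw [Function.update_of_ne hij]
        exact hI i (by omega)
  · rintro s' hF ⟨h32, h33, h34, hI⟩
    replace hF := hF₁.trans hF
    have e40 : s'.nat 40 0 = m := by rw [hF.1 40 (by norm_num), hm]
    have e1 := hF.1 1 (by norm_num)
    exact ⟨by simp [RamTest.Holds, NatExpr.eval, h34, e40, e1, hl], hF, h32, h33, hI⟩

/-- The program for estimation with a matrix in compressed column format. -/
def estimationProgram : RamProgram where
  procs := [selectBody]
  main := .seq (estimateLoop (.var 0) loadColumnCmd) topCmd

/-- This is the addressing rule of the compressed column format: the total length of the preceding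
lists is the offset of list `n`. -/
theorem List.getD_flatten {α : Type*} (L : List (List α)) {n i : ℕ} (d : α) (hn : n < L.length)
    (hi : i < (L[n]).length) :
    L.flatten.getD ((L.take n).flatten.length + i) d = (L[n]).getD i d := by
  have h : L.flatten = (L.take n).flatten ++ (L[n] ++ (L.drop (n + 1)).flatten) := by
    conv_lhs => rw [← List.take_append_drop n L, List.flatten_append, List.drop_eq_getElem_cons hn,
      List.flatten_cons]
  rw [h, List.getD_append_right _ _ _ _ (by omega), Nat.add_sub_cancel_left,
    List.getD_append _ _ _ _ hi]

theorem columnLists_length {b N : ℕ} (A : Matrix (Fin b) (Fin N) Bool) :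
    (columnLists A).length = N := by simp [columnLists]

theorem columnLists_getElem {b N : ℕ} (A : Matrix (Fin b) (Fin N) Bool) (n : Fin N)
    (h : n.val < (columnLists A).length) :
    (columnLists A)[n.val] = ((List.finRange b).filter (fun i => A i n)).map Fin.val := by
  simp [columnLists]

theorem columnLists_getElem_length {b N : ℕ} (A : Matrix (Fin b) (Fin N) Bool) (n : Fin N)
    (h : n.val < (columnLists A).length) : ((columnLists A)[n.val]).length = columnOnes A n := by
  rw [columnLists_getElem, List.length_map, columnOnes, Finset.card_def, Finset.filter_val,
    Fin.univ_def]
  simp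

theorem columnValues_eq {b N : ℕ} (A : Matrix (Fin b) (Fin N) Bool) (y : Fin b → ℝ) (n : Fin N)
    (h : n.val < (columnLists A).length) :
    columnValues A y n = (Multiset.range (columnOnes A n)).map
      (fun i => arrayOf y (((columnLists A)[n.val]).getD i 0)) := by
  have h1 : columnValues A y n =
      (((List.finRange b).filter (fun i => A i n)).map y : List ℝ) := by
    rw [columnValues, Finset.filter_val, Fin.univ_def]
    simp
  rw [h1, ← columnLists_getElem_length A n h, ← Multiset.coe_range, Multiset.map_coe]
  congr 1
  rw [columnLists_getElem]
  refine List.ext_getElem (by simp) fun i h1 h2 => ?_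
  simp only [List.length_map] at h1
  simp [arrayOf, h1]

/-- Loading and selection are linear in the length of a column list, and producing the output is
linear in `N`; so the time is governed by the number of ones of the sampled matrix. -/
theorem estimationProgram_spec {N b k : ℕ} (hk : 1 ≤ k) (A : Matrix (Fin b) (Fin N) Bool)
    (y : Fin b → ℝ) : ∃ (z : Fin N → ℝ) (T : ℕ),
      estimationProgram.Runs (estimationInput k A y) T z ∧ IsEstimate A y Finset.univ k z ∧
      T ≤ ∑ n : Fin N, (21000 * columnOnes A n + 22000) + 1100 := by
  set s := estimationInput k A y with hs
  have h := estimateLoop_topCmd_spec A y (S := Finset.univ) (k := k) s (Me := .var 0)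
    (load := loadColumnCmd) (M := N) (idx := fun m => m)
    (len := fun m => ((columnLists A).getD m []).length)
    (cost := fun m => 100 * ((columnLists A).getD m []).length + 100)
    (val := fun m i => s.real 0 (s.nat 2 (((columnLists A).take m).flatten.length + i)))
    (by decide) ?_ rfl ?_ rfl rfl hk (fun _ _ _ _ h => h) (fun m hm => hm) ?_ ?_
  · obtain ⟨s', T, h1, h2, h3⟩ := h
    refine ⟨_, T, ⟨s', h1, rfl⟩, h3, h2.trans ?_⟩
    have e : ∀ n : Fin N, ((columnLists A).getD n []).length = columnOnes A n := fun n => by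
      rw [List.getD_eq_getElem _ _ (by rw [columnLists_length]; exact n.2),
        columnLists_getElem_length]
    rw [Finset.sum_range]
    simp only [e]
    have : 21000 * N = ∑ _n : Fin N, 21000 := by simp [mul_comm]
    rw [this, ← Finset.sum_add_distrib]
    refine Nat.add_le_add_right (Finset.sum_le_sum fun n _ => ?_) _
    omega
  · intro s' hF
    simp only [NatExpr.eval]
    rw [hF.1 0 (by norm_num)]
    rfl
  · intro m hm s' hF h40
    have hm' : m < (columnLists A).length := by rw [columnLists_length]; exact hm
    refine (loadColumnCmd_spec _ s' h40 rfl ?_).mono le_rfl fun s'' h => ?_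
    · rw [hF.1 1 (by norm_num)]
      simp only [hs, estimationInput]
      rw [← List.take_append_getElem hm', List.flatten_append, List.length_append,
        List.getD_eq_getElem _ _ hm']
      simp
    · rw [hF.1 1 (by norm_num), hF.1 2 (by norm_num), hF.2 0 (by norm_num)] at h
      exact h
  · exact fun n => ⟨fun _ => ⟨n, n.2, rfl⟩, fun _ => Finset.mem_univ _⟩
  · rintro m hm n rfl
    have hm' : n.val < (columnLists A).length := by rw [columnLists_length]; exact hm
    rw [columnValues_eq A y n hm', ← columnLists_getElem_length A n hm',
      List.getD_eq_getElem _ _ hm']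
    refine Multiset.map_congr rfl fun i hi => ?_
    rw [Multiset.mem_range] at hi
    rw [← List.getD_flatten _ _ hm' hi]
    rfl

/-! ### The program for recovery -/

/-- Computes `⌈log₂ N⌉` in `nat 42`. -/
def clogCmd : RamCmd :=
  .seq (.seq (.assign 48 (.const 1)) (.assign 42 (.const 0)))
    (.loop (.natLt (.var 48) (.var 0))
      (.seq (.assign 48 (.mul (.const 2) (.var 48))) (.incr 42)))

/-- The frame alone would allow changes to arrays `43` and `45`; these are excluded separately
because the identification relies on their initial zeros. -/
theorem clogCmd_spec (procs : List RamCmd) (s : RamState) {N : ℕ} (hN : s.nat 0 0 = N) :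
    Reaches procs clogCmd s (100 * Nat.clog 2 N + 50) fun s' =>
      Frame 42 50 0 0 s s' ∧ (∀ a, a = 43 ∨ a = 45 → s'.nat a = s.nat a) ∧
        s'.nat 42 0 = Nat.clog 2 N := by
  unfold clogCmd
  refine Reaches.simple_seq (B' := 100 * Nat.clog 2 N + 20) 42 50 0 0 rfl rfl
    (by simp [RamCmd.maxCost, NatExpr.cost]; omega) fun hF₁ =>
    Reaches.loop_simple 42 50 0 0 rfl rfl (fun j s' => s'.nat 48 0 = 2 ^ j ∧ s'.nat 42 0 = j ∧
      ∀ a, a = 43 ∨ a = 45 → s'.nat a = s.nat a) (Nat.clog 2 N) ?_ ?_ ?_ ?_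
  · simp [RamCmd.maxCost, NatExpr.cost, RamTest.cost]; omega
  · refine ⟨by simp [RamCmd.post, NatExpr.eval, RamState.setNat_nat],
      by simp [RamCmd.post, NatExpr.eval, RamState.setNat_nat], ?_⟩
    rintro a (rfl | rfl) <;> simp [RamCmd.post, RamState.setNat_nat]
  · rintro j hj s' hF ⟨h48, h42, h⟩
    have e0 := (hF₁.trans hF).1 0 (by norm_num)
    have hlt : 2 ^ j < N := (Nat.lt_clog_iff_pow_lt (by norm_num)).1 hj
    refine ⟨by simp [RamTest.Holds, NatExpr.eval, h48, e0, hN, hlt], ?_, ?_, ?_⟩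
    · simp [RamCmd.post, NatExpr.eval, RamState.setNat_nat, h48, pow_succ, mul_comm]
    · simp [RamCmd.post, NatExpr.eval, RamState.setNat_nat, h42]
    · rintro a (rfl | rfl) <;> simp [RamCmd.post, RamState.setNat_nat, h]
  · rintro s' hF ⟨h48, h42, h⟩
    have e0 := (hF₁.trans hF).1 0 (by norm_num)
    have hlt : ¬ 2 ^ Nat.clog 2 N < N := not_lt.2 (Nat.le_pow_clog (by norm_num) N)
    exact ⟨by simp [RamTest.Holds, NatExpr.eval, h48, e0, hN, not_lt.1 hlt], hF₁.trans hF, h, h42⟩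

/-- Computes in `nat 47` the index read off from row `nat 46`. -/
def foundCmd : RamCmd :=
  .seq (.seq (.assign 47 (.const 0)) (.seq (.assign 48 (.const 1)) (.assign 49 (.const 0))))
    (.loop (.natLt (.var 49) (.var 42))
      (.seq (.branch (.realLt
          (.mul (.sub (.get 0 (.var 46)) (.get 0 (.add (.var 46) (.mul (.get 0 (.const 2))
              (.add (.const 1) (.var 49))))))
            (.sub (.get 0 (.var 46)) (.get 0 (.add (.var 46) (.mul (.get 0 (.const 2))
              (.add (.const 1) (.var 49)))))))
          (.mul (.get 0 (.add (.var 46) (.mul (.get 0 (.const 2)) (.add (.const 1) (.var 49)))))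
            (.get 0 (.add (.var 46) (.mul (.get 0 (.const 2)) (.add (.const 1) (.var 49)))))))
          (.assign 47 (.add (.var 47) (.var 48))) .nop)
        (.seq (.assign 48 (.mul (.const 2) (.var 48))) (.incr 49))))

open Classical in
theorem foundCmd_spec (procs : List RamCmd) (s : RamState) {L j r : ℕ} (hL : s.nat 42 0 = L)
    (hj : s.nat 46 0 = j) (hr : s.nat 0 2 = r) :
    Reaches procs foundCmd s (200 * L + 50) fun s' => Frame 47 50 0 0 s s' ∧
      s'.nat 47 0 = ∑ i ∈ Finset.range L,
        if |s.real 0 j - s.real 0 (j + r * (1 + i))| < |s.real 0 (j + r * (1 + i))|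
        then 2 ^ i else 0 := by
  unfold foundCmd
  refine Reaches.simple_seq (B' := 200 * L + 20) 47 50 0 0 rfl rfl
    (by simp [RamCmd.maxCost, NatExpr.cost]; omega) fun hF₁ =>
    Reaches.loop_simple 47 50 0 0 rfl rfl (fun a s' => s'.nat 49 0 = a ∧ s'.nat 48 0 = 2 ^ a ∧
      s'.nat 47 0 = ∑ i ∈ Finset.range a,
        if |s.real 0 j - s.real 0 (j + r * (1 + i))| < |s.real 0 (j + r * (1 + i))|
        then 2 ^ i else 0) L ?_ ?_ ?_ ?_
  · simp [RamCmd.maxCost, NatExpr.cost, RamTest.cost, RealExpr.cost]; omega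
  · simp [RamCmd.post, NatExpr.eval, RamState.setNat_nat]
  · rintro a ha s' hF ⟨h49, h48, h47⟩
    replace hF := hF₁.trans hF
    have e42 : s'.nat 42 0 = L := by rw [hF.1 42 (by norm_num), hL]
    have e46 : s'.nat 46 0 = j := by rw [hF.1 46 (by norm_num), hj]
    have e0 : s'.nat 0 2 = r := by rw [hF.1 0 (by norm_num), hr]
    have er : s'.real 0 = s.real 0 := hF.2 0 (by norm_num)
    refine ⟨by simp [RamTest.Holds, NatExpr.eval, h49, e42, ha], ?_⟩
    rw [Finset.sum_range_succ]
    by_cases h : |s.real 0 j - s.real 0 (j + r * (1 + a))| < |s.real 0 (j + r * (1 + a))|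
    all_goals
      have h' := h
      -- The program compares squares instead of absolute values.
      rw [← sq_lt_sq, sq, sq] at h'
      simp [RamCmd.post, RamTest.Holds, NatExpr.eval, RealExpr.eval, RamState.setNat_nat,
        h49, h48, h47, e46, e0, er, h, h', pow_succ, mul_comm 2]
  · rintro s' hF ⟨h49, h48, h47⟩
    replace hF := hF₁.trans hF
    have e42 : s'.nat 42 0 = L := by rw [hF.1 42 (by norm_num), hL]
    exact ⟨by simp [RamTest.Holds, NatExpr.eval, h49, e42], hF, h47⟩

/-- Lists in array `44` the distinct indices below `N` read off from the rows; their number is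
`nat 43`, and array `45` marks the indices already listed. -/
def identifyCmd : RamCmd :=
  .seq (.assign 46 (.const 0))
    (.loop (.natLt (.var 46) (.get 0 (.const 2)))
      (.seq foundCmd
        (.seq (.branch (.and (.natLt (.var 47) (.var 0)) (.natEq (.get 45 (.var 47)) (.const 0)))
            (.seq (.setNat 45 (.var 47) (.const 1))
              (.seq (.setNat 44 (.var 43) (.var 47)) (.incr 43))) .nop)
          (.incr 46))))

/-- The marks in array `45` detect repetitions in constant time, and as that array is zero
initially, no initialisation of length `N` is needed. The index read off from row `j` enters only
through `F`, so the bit tests can be treated separately. -/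
theorem identifyCmd_spec (procs : List RamCmd) (hp : ∀ d ∈ procs, d.framed 10 50 3 9 = true)
    (s : RamState) {N L r : ℕ} (hN : s.nat 0 0 = N)
    (hL : s.nat 42 0 = L) (hr : s.nat 0 2 = r) (h43 : s.nat 43 0 = 0) (h45 : ∀ i, s.nat 45 i = 0)
    {F : ℕ → ℕ} (hF : ∀ (s' : RamState) (j : ℕ), j < r → s'.real 0 = s.real 0 → s'.nat 0 2 = r →
      s'.nat 42 0 = L → s'.nat 46 0 = j →
      Reaches procs foundCmd s' (200 * L + 50) fun s'' => Frame 47 50 0 0 s' s'' ∧ s''.nat 47 0 = F j) :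
    Reaches procs identifyCmd s (r * (200 * L + 150) + 50) fun s' => Frame 43 50 0 0 s s' ∧
      (∀ i < s'.nat 43 0, ∀ j < s'.nat 43 0, s'.nat 44 i = s'.nat 44 j → i = j) ∧
      ∀ v, (v < N ∧ ∃ j < r, F j = v) ↔ ∃ i < s'.nat 43 0, s'.nat 44 i = v := by
  unfold identifyCmd
  refine Reaches.mono (R := fun s' => Frame 43 50 0 0 s s' ∧
      (∀ i < s'.nat 43 0, ∀ j < s'.nat 43 0, s'.nat 44 i = s'.nat 44 j → i = j) ∧
      ∀ v, (v < N ∧ ∃ j < r, F j = v) ↔ ∃ i < s'.nat 43 0, s'.nat 44 i = v) ?_ le_rfl fun _ h => h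
  refine Reaches.simple_seq (B' := r * (200 * L + 150) + 30) 43 50 0 0 rfl rfl
    (by simp [RamCmd.maxCost, NatExpr.cost]; omega) fun hF₁ =>
    Reaches.loop_frame_const (procs := procs) 10 50 3 9 hp rfl (fun a s' => Frame 43 50 0 0 s s' ∧
      s'.nat 46 0 = a ∧
      (∀ i < s'.nat 43 0, ∀ j < s'.nat 43 0, s'.nat 44 i = s'.nat 44 j → i = j) ∧
      (∀ v, (v < N ∧ ∃ j < a, F j = v) ↔ ∃ i < s'.nat 43 0, s'.nat 44 i = v) ∧
      ∀ v, s'.nat 45 v = 0 ↔ ¬ (v < N ∧ ∃ j < a, F j = v)) (200 * L + 130) r ?_ ?_ ?_ ?_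
  · simp [NatExpr.cost, RamTest.cost]; nlinarith
  · refine ⟨hF₁, ?_, ?_, ?_, ?_⟩ <;>
      simp [RamCmd.post, NatExpr.eval, RamState.setNat_nat, h43, h45]
  · rintro a ha s₁ - ⟨hG, h46, hinj, hmem, hmark⟩
    have e0 : s₁.nat 0 = s.nat 0 := hG.1 0 (by norm_num)
    refine ⟨by simp [RamTest.Holds, NatExpr.eval, h46, e0, hr, ha], ?_⟩
    refine Reaches.mono (Reaches.seq (hF s₁ a ha (hG.2 0 (by norm_num)) (by rw [e0, hr])
      (by rw [hG.1 42 (by norm_num), hL]) h46) (B' := 80) ?_) (by omega) fun _ h => h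
    rintro s₂ ⟨hF₂, h47⟩
    have g46 : s₂.nat 46 0 = a := by rw [hF₂.1 46 (by norm_num), h46]
    have g43 : s₂.nat 43 = s₁.nat 43 := hF₂.1 43 (by norm_num)
    have g44 : s₂.nat 44 = s₁.nat 44 := hF₂.1 44 (by norm_num)
    have g45 : s₂.nat 45 = s₁.nat 45 := hF₂.1 45 (by norm_num)
    have g0 : s₂.nat 0 0 = N := by rw [hF₂.1 0 (by norm_num), e0, hN]
    have hG₂ := hG.trans (hF₂.mono (m₁ := 43) (m₂ := 50) (q₁ := 0) (q₂ := 0) (by norm_num)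
      (by norm_num) le_rfl le_rfl)
    set c := s₁.nat 43 0 with hc
    have hD : ∀ v, (v < N ∧ ∃ j < a + 1, F j = v) ↔ (v < N ∧ ∃ j < a, F j = v) ∨ v < N ∧ v = F a := by
      intro v
      constructor
      · rintro ⟨h1, j, hj, e⟩
        rcases Nat.lt_succ_iff_lt_or_eq.1 hj with h | rfl
        · exact Or.inl ⟨h1, j, h, e⟩
        · exact Or.inr ⟨h1, e.symm⟩
      · rintro (⟨h1, j, hj, e⟩ | ⟨h1, e⟩)
        · exact ⟨h1, j, by omega, e⟩
        · exact ⟨h1, a, by omega, e.symm⟩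
    refine Reaches.of_simple rfl (by decide) ⟨hG₂.trans (RamCmd.frame_post rfl rfl s₂), ?_⟩
    by_cases h : F a < N ∧ s₁.nat 45 (F a) = 0
    · have hnew := (hmark _).1 h.2
      have hne : ∀ i < c, s₁.nat 44 i ≠ F a := fun i hi e => hnew ((hmem _).2 ⟨i, hi, e⟩)
      simp only [RamCmd.post, RamTest.Holds, NatExpr.eval, RamState.setNat_nat, h47, g43, g44, g45,
        g46, g0, h.1, h.2, and_self, if_true, Nat.reduceEqDiff, if_false, Function.update_self, ← hc,
        hD]
      refine ⟨trivial, fun i hi j hj hij => ?_, fun v => ?_, fun v => ?_⟩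
      · by_cases hic : i = c <;> by_cases hjc : j = c
        · omega
        · rw [hic, Function.update_self, Function.update_of_ne hjc] at hij
          exact absurd hij.symm (hne j (by omega))
        · rw [hjc, Function.update_self, Function.update_of_ne hic] at hij
          exact absurd hij (hne i (by omega))
        · rw [Function.update_of_ne hic, Function.update_of_ne hjc] at hij
          exact hinj i (by omega) j (by omega) hij
      · rw [hmem]
        constructor
        · rintro (⟨i, hi, e⟩ | ⟨-, e⟩)
          · exact ⟨i, by omega, by rw [Function.update_of_ne (by omega), e]⟩
          · exact ⟨c, by omega, by rw [Function.update_self, e]⟩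
        · rintro ⟨i, hi, e⟩
          by_cases hic : i = c
          · rw [hic, Function.update_self] at e
            exact Or.inr ⟨e ▸ h.1, e.symm⟩
          · rw [Function.update_of_ne hic] at e
            exact Or.inl ⟨i, by omega, e⟩
      · by_cases hv : v = F a
        · rw [hv, Function.update_self]
          simp [h.1]
        · rw [Function.update_of_ne hv, hmark]
          simp [hv]
    · have hs : ∀ c, RamCmd.post (.seq (.branch (.and (.natLt (.var 47) (.var 0))
          (.natEq (.get 45 (.var 47)) (.const 0))) c .nop) (.incr 46)) s₂ =
          RamCmd.post (.incr 46) s₂ := by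
        intro c
        have : ¬ RamTest.Holds s₂ (.and (.natLt (.var 47) (.var 0))
          (.natEq (.get 45 (.var 47)) (.const 0))) := by
          simpa [RamTest.Holds, NatExpr.eval, h47, g0, g45] using h
        simp [RamCmd.post, this]
      rw [hs]
      have hD' : ∀ v, (v < N ∧ ∃ j < a + 1, F j = v) ↔ (v < N ∧ ∃ j < a, F j = v) := by
        intro v
        rw [hD]
        refine or_iff_left_of_imp ?_
        rintro ⟨hv, rfl⟩
        by_contra hcon
        exact h ⟨hv, (hmark _).2 hcon⟩
      simp only [hD']
      simp only [RamCmd.post, NatExpr.eval, RamState.setNat_nat, g43, g44, g45, g46, if_true,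
        Nat.reduceEqDiff, if_false, Function.update_self, ← hc, true_and]
      exact ⟨hinj, hmem, hmark⟩
  · rintro s' - ⟨hG, h46, hinj, hmem, -⟩
    have e0 : s'.nat 0 = s.nat 0 := hG.1 0 (by norm_num)
    exact ⟨by simp [RamTest.Holds, NatExpr.eval, h46, e0, hr], hG, hinj, hmem⟩

/-- Loads the measurements of the rows of the sampled blocks with a one in column
`array 44 [nat 40]`. -/
def loadDevoreCmd : RamCmd :=
  .seq (.seq (.assign 32 (.get 44 (.var 40))) (.assign 33 (.const 0)))
    (.loop (.natLt (.var 33) (.get 0 (.const 4)))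
      (.seq (.seq (.assign 34 (.var 32)) (.seq (.assign 35 (.const 0)) (.assign 36 (.const 1))))
        (.seq (.loop (.natLt (.const 0) (.var 34))
            (.seq (.assign 35 (.add (.var 35) (.mul (.mod (.var 34) (.get 0 (.const 3))) (.var 36))))
              (.seq (.assign 36 (.mul (.var 36) (.get 1 (.var 33))))
                (.assign 34 (.div (.var 34) (.get 0 (.const 3)))))))
          (.seq (.setReal 3 (.var 33) (.get 1 (.add (.mul (.var 33) (.get 0 (.const 3)))
              (.mod (.var 35) (.get 0 (.const 3)))))) (.incr 33)))))

/-- For each sampled block the polynomial of `n` is evaluated digit by digit, and reduced modulo `P`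
only at the end. The cost per block is proportional to the number of base `P` digits of `n`. -/
theorem loadDevoreCmd_spec (procs : List RamCmd) (s : RamState) {m n P b : ℕ} (hP : 1 < P)
    (hm : s.nat 40 0 = m) (hn : s.nat 44 m = n) (hPs : s.nat 0 3 = P) (hb : s.nat 0 4 = b)
    (hpf : ∀ d ∈ procs, d.framed 10 50 3 9 = true) :
    Reaches procs loadDevoreCmd s (b * (100 * (Nat.digits P n).length + 150) + 100) fun s' =>
      Frame 32 40 3 4 s s' ∧ s'.nat 32 0 = n ∧ s'.nat 33 0 = b ∧ ∀ i < b, s'.real 3 i =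
        s.real 1 (i * P + Nat.ofDigits (s.nat 1 i) (Nat.digits P n) % P) := by
  unfold loadDevoreCmd
  set ℓ := (Nat.digits P n).length with hℓ
  refine Reaches.simple_seq (B' := b * (100 * ℓ + 150) + 50) 32 40 3 4 rfl rfl
    (by simp [RamCmd.maxCost, NatExpr.cost]; omega) fun hF₁ =>
    Reaches.loop_frame_const (procs := procs) 10 50 3 9 hpf rfl (fun j s' => Frame 32 40 3 4 s s' ∧
      s'.nat 32 0 = n ∧ s'.nat 33 0 = j ∧ ∀ i < j, s'.real 3 i =
        s.real 1 (i * P + Nat.ofDigits (s.nat 1 i) (Nat.digits P n) % P)) (100 * ℓ + 130) b ?_ ?_ ?_ ?_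
  · simp [NatExpr.cost, RamTest.cost]; nlinarith
  · exact ⟨hF₁, by simp [RamCmd.post, NatExpr.eval, RamState.setNat_nat, hm, hn],
      by simp [RamCmd.post, NatExpr.eval, RamState.setNat_nat], by simp⟩
  · rintro j hj s₁ - ⟨hF, h32, h33, hI⟩
    have e0 := hF.1 0 (by norm_num)
    refine ⟨by simp [RamTest.Holds, NatExpr.eval, h33, e0, hb, hj], ?_⟩
    refine Reaches.simple_seq (B' := 100 * ℓ + 100) 32 40 3 4 rfl rfl
      (by simp [RamCmd.maxCost, NatExpr.cost]; omega) fun hF₂ => ?_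
    set s₂ := RamCmd.post _ s₁ with hs₂
    set q := s.nat 1 j with hq
    have hin : Reaches procs (.loop (.natLt (.const 0) (.var 34))
            (.seq (.assign 35 (.add (.var 35) (.mul (.mod (.var 34) (.get 0 (.const 3))) (.var 36))))
              (.seq (.assign 36 (.mul (.var 36) (.get 1 (.var 33))))
                (.assign 34 (.div (.var 34) (.get 0 (.const 3))))))) s₂ (100 * ℓ + 50) fun s' =>
          Frame 34 40 3 3 s₂ s' ∧ s'.nat 35 0 = Nat.ofDigits q (Nat.digits P n) := by
      -- After `a` rounds the partial sum, plus the current power of `q` times the value of the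
      -- digits not yet read, equals the full value.
      refine Reaches.loop_simple 34 40 3 3 rfl rfl (fun a s' => s'.nat 34 0 = n / P ^ a ∧
        s'.nat 35 0 + s'.nat 36 0 * Nat.ofDigits q (Nat.digits P (n / P ^ a)) =
          Nat.ofDigits q (Nat.digits P n)) ℓ ?_ ?_ ?_ ?_
      · simp [RamCmd.maxCost, NatExpr.cost, RamTest.cost]; omega
      · simp [hs₂, RamCmd.post, NatExpr.eval, RamState.setNat_nat, h32]
      · rintro a ha s' hF' ⟨h34, hsum⟩
        have g0 : s'.nat 0 3 = P := by
          rw [hF'.1 0 (by norm_num), hF₂.1 0 (by norm_num), e0, hPs]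
        have g1 : s'.nat 1 j = q := by
          rw [hF'.1 1 (by norm_num), hF₂.1 1 (by norm_num), hF.1 1 (by norm_num)]
        have g33 : s'.nat 33 0 = j := by
          rw [hF'.1 33 (by norm_num)]
          simp [hs₂, RamCmd.post, NatExpr.eval, RamState.setNat_nat, h33]
        have hpos : 0 < n / P ^ a :=
          Nat.div_pos ((Nat.lt_digits_length_iff hP n).1 ha) (by positivity)
        rw [Nat.digits_def' hP hpos, Nat.ofDigits_cons] at hsum
        refine ⟨by simp [RamTest.Holds, NatExpr.eval, h34, hpos], ?_, ?_⟩
        · simp [RamCmd.post, NatExpr.eval, RamState.setNat_nat, h34, g0, pow_succ,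
            Nat.div_div_eq_div_mul]
        · simp [RamCmd.post, NatExpr.eval, RamState.setNat_nat, h34, g0, g33, g1, pow_succ,
            ← Nat.div_div_eq_div_mul]
          rw [← hsum]
          ring
      · rintro s' hF' ⟨h34, hsum⟩
        have hz : n / P ^ ℓ = 0 := Nat.div_eq_of_lt (Nat.lt_base_pow_length_digits hP)
        rw [hz] at h34 hsum
        exact ⟨by simp [RamTest.Holds, NatExpr.eval, h34], hF', by simpa using hsum⟩
    refine Reaches.mono (Reaches.seq hin (B' := 50) ?_) (by omega) fun _ h => h
    rintro s₃ ⟨hF₃, h35⟩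
    have hF₃' := (hF.trans hF₂).trans (hF₃.mono (m₁ := 32) (m₂ := 40) (q₁ := 3) (q₂ := 4)
      (by norm_num) (by norm_num) (by norm_num) (by norm_num))
    have k0 : s₃.nat 0 3 = P := by rw [hF₃'.1 0 (by norm_num), hPs]
    have k32 : s₃.nat 32 0 = n := by
      rw [hF₃.1 32 (by norm_num)]
      simp [hs₂, RamCmd.post, RamState.setNat_nat, h32]
    have k33 : s₃.nat 33 0 = j := by
      rw [hF₃.1 33 (by norm_num)]
      simp [hs₂, RamCmd.post, RamState.setNat_nat, h33]
    have k1 : s₃.real 1 = s.real 1 := hF₃'.2 1 (by norm_num)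
    have k3 : s₃.real 3 = s₁.real 3 := by rw [hF₃.2 3 (by norm_num)]; rfl
    refine Reaches.of_simple rfl (by decide) ⟨hF₃'.trans (RamCmd.frame_post rfl rfl s₃), ?_, ?_, ?_⟩
    · simp [RamCmd.post, RamState.setNat_nat, RamState.setReal_nat, k32]
    · simp [RamCmd.post, NatExpr.eval, RamState.setNat_nat, RamState.setReal_nat, k33]
    · intro i hi
      simp only [RamCmd.post, NatExpr.eval, RealExpr.eval, RamState.setNat_real,
        RamState.setReal_real, if_true, k33, k0, k1, k3, h35]
      by_cases hij : i = j
      · rw [hij, Function.update_self]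
      · rw [Function.update_of_ne hij]
        exact hI i (by omega)
  · rintro s' - ⟨hF, h32, h33, hI⟩
    have e0 := hF.1 0 (by norm_num)
    exact ⟨by simp [RamTest.Holds, NatExpr.eval, h33, e0, hb], hF, h32, h33, hI⟩

/-- The program for identification and estimation. -/
def recoveryProgram : RamProgram where
  procs := [selectBody]
  main := .seq clogCmd (.seq identifyCmd (.seq (estimateLoop (.var 43) loadDevoreCmd) topCmd))

/-- Every block contains exactly one row with a one in column `n`, so the values are indexed by the
sampled blocks. -/
theorem columnValues_devoreBlocks {P b N : ℕ} (s : Fin b → Fin P) (y : Fin (b * P) → ℝ) (n : Fin N) :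
    columnValues (devoreBlocks N s) y n = (Multiset.range b).map (fun i => arrayOf y
      (i * P + Nat.ofDigits (arrayOf (fun i => (s i).val) i) (Nat.digits P n) % P)) := by
  classical
  have hlt : ∀ i : Fin b, Nat.ofDigits (s i).val (Nat.digits P n) % P < P := fun i =>
    Nat.mod_lt _ (s i).pos
  set e : Fin b ↪ Fin (b * P) := ⟨fun i => finProdFinEquiv (i, ⟨_, hlt i⟩), fun i j h => by
    simpa using congrArg Prod.fst (finProdFinEquiv.injective h)⟩ with he
  have hfil : Finset.univ.filter (fun i => devoreBlocks N s i n = true) = Finset.univ.map e := by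
    ext i
    obtain ⟨⟨a, c⟩, rfl⟩ := finProdFinEquiv.surjective i
    have h1 : (finProdFinEquiv (a, c)).divNat = a := by
      have := finProdFinEquiv.symm_apply_apply (a, c)
      exact congrArg Prod.fst this
    have h2 : (finProdFinEquiv (a, c)).modNat = c := by
      have := finProdFinEquiv.symm_apply_apply (a, c)
      exact congrArg Prod.snd this
    rw [Finset.mem_filter]
    simp only [Finset.mem_univ, true_and, Finset.mem_map, devoreBlocks, sampleRows,
      Matrix.submatrix_apply, id, blockRows, devore, h1, h2, decide_eq_true_eq]
    constructor
    · intro h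
      refine ⟨a, ?_⟩
      exact congrArg finProdFinEquiv (Prod.ext rfl (Fin.ext h))
    · rintro ⟨i, hi⟩
      have := finProdFinEquiv.injective hi
      simp only [Prod.mk.injEq] at this
      rw [← this.1, ← this.2]
  rw [columnValues, hfil, Finset.map_val, Multiset.map_map, Fin.univ_def, ← Multiset.coe_range,
    ← List.map_coe_finRange_eq_range]
  simp only [Multiset.map_coe, List.map_map]
  congr 1
  refine List.map_congr_left fun i _ => ?_
  simp only [Function.comp, arrayOf, i.2, dif_pos, he]
  have hb : i * P + Nat.ofDigits (s i).val (Nat.digits P n) % P < b * P := by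
    have h1 := hlt i
    have h2 : (i + 1) * P ≤ b * P := Nat.mul_le_mul_right _ i.2
    nlinarith
  rw [dif_pos hb]
  congr 1
  apply Fin.ext
  simp [finProdFinEquiv, add_comm, mul_comm]

/-- Since repetitions are removed, the cost of estimation is expressed by the number of distinct
indices found. It is at most the number of rows and also at most `N`, and the latter matters when
`t` exceeds `N`. -/
theorem recoveryProgram_spec {N k r P b : ℕ} (hk : 1 ≤ k) (hP : 1 < P) (hN : 1 ≤ N)
    (s₂ : Fin b → Fin P)
    (u : Fin ((1 + Nat.clog 2 N) * r) → ℝ) (y : Fin (b * P) → ℝ) :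
    ∃ (z : Fin N → ℝ) (T : ℕ), recoveryProgram.Runs (recoveryInput N k s₂ u y) T z ∧
      IsRecovery (devoreBlocks N s₂) y u k z ∧
      T ≤ 400 * ((r + 1) * (Nat.clog 2 N + 1)) +
        30000 * ((identified N u).card * (b * (Nat.log P N + 3) + 1)) + 2000 := by
  classical
  set s := recoveryInput N k s₂ u y with hs
  have n0 : s.nat 0 0 = N ∧ s.nat 0 1 = k ∧ s.nat 0 2 = r ∧ s.nat 0 3 = P ∧ s.nat 0 4 = b := by
    simp [hs, recoveryInput, arrayOf]
  obtain ⟨n00, n01, n02, n03, n04⟩ := n0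
  set F : ℕ → ℕ := fun j => ∑ i ∈ Finset.range (Nat.clog 2 N),
        if |s.real 0 j - s.real 0 (j + r * (1 + i))| < |s.real 0 (j + r * (1 + i))|
        then 2 ^ i else 0 with hF
  have hFfound : ∀ j : Fin r, F j = foundIndex u j := by
    intro j
    have hent : ∀ i : Fin (1 + Nat.clog 2 N), s.real 0 (j + r * i) = idEntry u i j := by
      intro i
      have hlt : j + r * i < (1 + Nat.clog 2 N) * r := by
        have : (i.val + 1) * r ≤ (1 + Nat.clog 2 N) * r := Nat.mul_le_mul_right _ i.2
        have := j.2
        nlinarith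
      simp only [hs, recoveryInput, arrayOf, idEntry]
      rw [dif_pos hlt]
      congr 1
    have h0 : s.real 0 j = idEntry u 0 j := by
      rw [← hent 0]; simp
    simp only [hF, foundIndex]
    rw [Finset.sum_range]
    refine Finset.sum_congr rfl fun i _ => ?_
    have := hent (Fin.natAdd 1 i)
    simp only [Fin.val_natAdd] at this
    rw [h0, this]
  have hmemS : ∀ n : Fin N, n ∈ identified N u ↔ n.val < N ∧ ∃ j < r, F j = n := by
    intro n
    simp only [identified, Finset.mem_filter, Finset.mem_univ, true_and, n.2]
    constructor
    · rintro ⟨j, hj⟩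
      exact ⟨j, j.2, by rw [hFfound, hj]⟩
    · rintro ⟨j, hj, h⟩
      exact ⟨⟨j, hj⟩, by rw [← hFfound]; exact h⟩
  have hp : ∀ d ∈ [selectBody], d.framed 10 50 3 9 = true := by
    simp only [List.mem_singleton, forall_eq]; decide
  have key : Reaches [selectBody] recoveryProgram.main s (400 * ((r + 1) * (Nat.clog 2 N + 1)) +
        30000 * ((identified N u).card * (b * (Nat.log P N + 3) + 1)) + 2000) fun s' =>
        IsRecovery (devoreBlocks N s₂) y u k (s'.output N) := by
    unfold recoveryProgram
    refine Reaches.mono (Reaches.seq (clogCmd_spec _ s n00) (B' := r * (200 * Nat.clog 2 N + 150) + 50 +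
      (30000 * ((identified N u).card * (b * (Nat.log P N + 3) + 1)) + 1100)) ?_) (by nlinarith)
      fun _ h => h
    rintro s₁ ⟨hF₁, h1, h42⟩
    have a0 : s₁.nat 0 = s.nat 0 := hF₁.1 0 (by norm_num)
    refine (Reaches.seq (identifyCmd_spec [selectBody] hp s₁ (F := F) (L := Nat.clog 2 N) (N := N) (r := r)
      (by rw [a0, n00]) h42 (by rw [a0, n02]) (by rw [h1 43 (by norm_num)]; rfl)
      (by rw [h1 45 (by norm_num)]; exact fun _ => rfl) ?_)) ?_
    · intro s' j hj h0 h02 h42 h46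
      refine (foundCmd_spec _ s' h42 h46 h02).mono le_rfl fun s'' h => ?_
      rw [h0, hF₁.2 0 (by norm_num)] at h
      exact h
    rintro s₃ ⟨hF₃, hinj, hmem⟩
    have b0 : s₃.nat 0 = s.nat 0 := by rw [hF₃.1 0 (by norm_num), a0]
    have hM : s₃.nat 43 0 ≤ (identified N u).card := by
      rw [← Finset.card_range (s₃.nat 43 0)]
      refine Finset.card_le_card_of_injOn (fun i => if h : s₃.nat 44 i < N then ⟨_, h⟩ else ⟨0, hN⟩)
        (fun i hi => ?_) fun i hi j hj hij => ?_
      · have h := (hmem (s₃.nat 44 i)).2 ⟨i, by simpa using hi, rfl⟩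
        simp only [h.1, dif_pos]
        exact (hmemS _).2 h
      · have h := (hmem (s₃.nat 44 i)).2 ⟨i, by simpa using hi, rfl⟩
        have h' := (hmem (s₃.nat 44 j)).2 ⟨j, by simpa using hj, rfl⟩
        simp only [h.1, h'.1, dif_pos, Fin.mk.injEq] at hij
        exact hinj i (by simpa using hi) j (by simpa using hj) hij
    have hidx : ∀ m < s₃.nat 43 0, s₃.nat 44 m < N := fun m hm => ((hmem _).2 ⟨m, hm, rfl⟩).1
    have hlen : ∀ m < s₃.nat 43 0, (Nat.digits P (s₃.nat 44 m)).length ≤ Nat.log P N + 1 := by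
      intro m hm
      rw [Nat.digits_length_le_iff hP]
      exact (hidx m hm).trans (Nat.lt_pow_succ_log_self hP N)
    refine (estimateLoop_topCmd_spec (devoreBlocks N s₂) y (S := identified N u) (k := k) s₃
      (Me := .var 43) (load := loadDevoreCmd) (M := s₃.nat 43 0) (idx := s₃.nat 44)
      (len := fun _ => b)
      (cost := fun m => b * (100 * (Nat.digits P (s₃.nat 44 m)).length + 150) + 100)
      (val := fun m i => s₃.real 1 (i * P +
        Nat.ofDigits (s₃.nat 1 i) (Nat.digits P (s₃.nat 44 m)) % P))
      (by decide) ?_ rfl ?_ ?_ (by rw [b0, n01]) hk hinj hidx ?_ ?_).mono ?_ fun s' h => h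
    · intro s' hG
      simp only [NatExpr.eval]
      rw [hG.1 43 (by norm_num)]
    · intro m hm s' hG h40
      refine (loadDevoreCmd_spec _ s' hP h40 rfl (by rw [hG.1 0 (by norm_num), b0, n03])
        (by rw [hG.1 0 (by norm_num), b0, n04]) hp).mono (by rw [hG.1 44 (by norm_num)])
        fun s'' h => ?_
      rw [hG.1 44 (by norm_num), hG.1 1 (by norm_num), hG.2 1 (by norm_num)] at h
      exact h
    · rw [hF₃.1 30 (by norm_num), hF₁.1 30 (by norm_num)]; rfl
    · intro n
      rw [hmemS, hmem]
    · intro m hm n hn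
      have e1 : s₃.nat 1 = arrayOf (fun i => (s₂ i).val) := by
        rw [hF₃.1 1 (by norm_num), hF₁.1 1 (by norm_num)]; rfl
      have er : s₃.real 1 = arrayOf y := by
        rw [hF₃.2 1 (by norm_num), hF₁.2 1 (by norm_num)]; rfl
      simp only [hn, e1, er]
      exact columnValues_devoreBlocks s₂ y n
    · have h1 : ∑ m ∈ Finset.range (s₃.nat 43 0),
          (b * (100 * (Nat.digits P (s₃.nat 44 m)).length + 150) + 100 + 20000 * b + 300) ≤
          s₃.nat 43 0 * (8000 * (b * (Nat.log P N + 3) + 1)) := by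
        refine (Finset.sum_le_card_nsmul _ _ (8000 * (b * (Nat.log P N + 3) + 1)) fun m hm => ?_).trans
          (by rw [Finset.card_range, smul_eq_mul])
        have := hlen m (Finset.mem_range.1 hm)
        have : b * (Nat.digits P (s₃.nat 44 m)).length ≤ b * (Nat.log P N + 1) :=
          Nat.mul_le_mul_left _ this
        nlinarith
      have h2 : s₃.nat 43 0 * (b * (Nat.log P N + 3) + 1) ≤
          (identified N u).card * (b * (Nat.log P N + 3) + 1) := Nat.mul_le_mul_right _ hM
      have h3 : s₃.nat 43 0 ≤ s₃.nat 43 0 * (b * (Nat.log P N + 3) + 1) :=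
        Nat.le_mul_of_pos_right _ (by omega)
      nlinarith
  obtain ⟨s', T, h1, h2, h3⟩ := key
  exact ⟨_, T, ⟨s', h1, rfl⟩, h3, h2⟩

/-! ## Deterministic guarantees -/

section Deterministic

variable {ι : Type*} {N : ℕ}

open Classical in
/-- The total magnitude of the entries of `x` other than `x n` that row `i` of `A` measures. -/
noncomputable def interference (A : Matrix ι (Fin N) Bool) (x : Fin N → ℝ) (n : Fin N) (i : ι) : ℝ :=
  ∑ l ∈ Finset.univ.filter (fun l => l ≠ n ∧ A i l = true), |x l|

/-- Row `i` measures `x n` up to an error of at most `δ`. -/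
def IsGoodRow (A : Matrix ι (Fin N) Bool) (x : Fin N → ℝ) (δ : ℝ) (n : Fin N) (i : ι) : Prop :=
  A i n = true ∧ interference A x n i ≤ δ

/-- Row `i` measures `x n` with an interference larger than `δ`. -/
def IsBadRow (A : Matrix ι (Fin N) Bool) (x : Fin N → ℝ) (δ : ℝ) (n : Fin N) (i : ι) : Prop :=
  A i n = true ∧ δ < interference A x n i

open Classical in
/-- The number of good rows for `x n`. -/
noncomputable def goodCount [Fintype ι] (A : Matrix ι (Fin N) Bool) (x : Fin N → ℝ) (δ : ℝ)
    (n : Fin N) : ℕ :=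
  (Finset.univ.filter (IsGoodRow A x δ n)).card

open Classical in
/-- The number of bad rows for `x n`. -/
noncomputable def badCount [Fintype ι] (A : Matrix ι (Fin N) Bool) (x : Fin N → ℝ) (δ : ℝ)
    (n : Fin N) : ℕ :=
  (Finset.univ.filter (IsBadRow A x δ n)).card

/-! ### Estimation from a majority of good rows -/

theorem goodCount_add_badCount [Fintype ι] (A : Matrix ι (Fin N) Bool) (x : Fin N → ℝ) (δ : ℝ)
    (n : Fin N) : goodCount A x δ n + badCount A x δ n = columnOnes A n := by
  classical
  rw [goodCount, badCount, columnOnes, ← Finset.card_union_of_disjoint]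
  · congr 1
    ext i
    simp only [Finset.mem_union, Finset.mem_filter, Finset.mem_univ, true_and, IsGoodRow, IsBadRow]
    have := le_or_gt (interference A x n i) δ
    tauto
  · rw [Finset.disjoint_filter]
    rintro i - ⟨_, h⟩ ⟨_, h'⟩
    exact absurd h (not_le.2 h')

/-- Two measurements of the same row are treated together: if the weights `c` and `d` share each
entry between them, the interference is split as well, and the sum of both errors stays below the
interference. The bit tests need this joint bound. -/
theorem abs_sum_sub_le_interference (A : Matrix ι (Fin N) Bool) (x : Fin N → ℝ) {n : Fin N} {i : ι}
    (h : A i n = true) (c : Fin N → ℝ) (d : Fin N → ℝ) (hcd : ∀ l, l ≠ n → |c l| + |d l| ≤ 1) :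
    |∑ l, (if A i l = true then 1 else 0) * c l * x l - c n * x n| +
      |∑ l, (if A i l = true then 1 else 0) * d l * x l - d n * x n| ≤ interference A x n i := by
  classical
  have key : ∀ c : Fin N → ℝ, |∑ l, (if A i l = true then 1 else 0) * c l * x l - c n * x n| ≤
      ∑ l ∈ Finset.univ.filter (fun l => l ≠ n ∧ A i l = true), |c l| * |x l| := by
    intro c
    rw [← Finset.add_sum_erase _ _ (Finset.mem_univ n), h]
    simp only [if_true, one_mul, add_sub_cancel_left]
    refine (Finset.abs_sum_le_sum_abs _ _).trans ?_
    rw [← Finset.filter_filter, Finset.filter_ne', Finset.sum_filter]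
    refine Finset.sum_le_sum fun l _ => ?_
    split_ifs <;> simp [abs_mul]
  refine (add_le_add (key c) (key d)).trans ?_
  rw [← Finset.sum_add_distrib, interference]
  refine Finset.sum_le_sum fun l hl => ?_
  have := hcd l (Finset.mem_filter.1 hl).2.1
  nlinarith [abs_nonneg (x l)]

theorem estMeasurements_apply {b : ℕ} (A : Matrix (Fin b) (Fin N) Bool) (x : Fin N → ℝ) (i : Fin b) :
    estMeasurements A x i = ∑ l, (if A i l = true then 1 else 0) * x l := by
  simp [estMeasurements, Matrix.mulVec, dotProduct, realMat]

theorem abs_estMeasurements_sub_le {b : ℕ} (A : Matrix (Fin b) (Fin N) Bool) (x : Fin N → ℝ)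
    {n : Fin N} {i : Fin b} (h : A i n = true) :
    |estMeasurements A x i - x n| ≤ interference A x n i := by
  have := abs_sum_sub_le_interference A x h (fun _ => 1) (fun _ => 0) (by simp)
  simpa [estMeasurements_apply] using this

/-- If a median were off by more than `δ`, at least half of the values would lie on its far side,
and all rows producing them would be bad. -/
theorem abs_sub_le_of_isMedian {b : ℕ} (A : Matrix (Fin b) (Fin N) Bool) (x : Fin N → ℝ) {δ : ℝ}
    {n : Fin N} (h : badCount A x δ n < goodCount A x δ n) {w : ℝ}
    (hw : IsMedian (columnValues A (estMeasurements A x) n) w) : |w - x n| ≤ δ := by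
  classical
  have hcard := goodCount_add_badCount A x δ n
  have hc : (columnValues A (estMeasurements A x) n).card = columnOnes A n := by
    rw [columnValues, columnOnes, Multiset.card_map]; rfl
  have key : ∀ p : ℝ → Prop, (∀ u, p u → |u - x n| ≤ δ → False) →
      (columnValues A (estMeasurements A x) n).countP p ≤ badCount A x δ n := by
    intro p hp
    rw [columnValues, Multiset.countP_map, ← Finset.filter_val, Finset.card_val, badCount]
    refine Finset.card_le_card fun i hi => ?_
    simp only [Finset.mem_filter, Finset.mem_univ, true_and] at hi ⊢
    refine ⟨hi.1, ?_⟩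
    by_contra hlt
    exact hp _ hi.2 ((abs_estMeasurements_sub_le A x hi.1).trans (not_lt.1 hlt))
  obtain ⟨h1, h2⟩ := hw
  rw [hc] at h1 h2
  rw [abs_sub_le_iff]
  constructor
  · by_contra hlt
    have := key (fun u => w ≤ u) fun u hu hu' => by
      have := (abs_sub_le_iff.1 hu').1
      linarith
    omega
  · by_contra hlt
    have := key (fun u => u ≤ w) fun u hu hu' => by
      have := (abs_sub_le_iff.1 hu').2
      linarith
    omega

/-! ### Identification by bit tests -/

theorem sum_testBit_eq_mod (n L : ℕ) :
    ∑ i ∈ Finset.range L, (if n.testBit i = true then 2 ^ i else 0) = n % 2 ^ L := by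
  induction L with
  | zero => simp [Nat.mod_one]
  | succ L ih =>
    rw [Finset.sum_range_succ, ih, pow_succ, Nat.mod_mul, Nat.testBit_eq_decide_div_mod_eq]
    rcases Nat.mod_two_eq_zero_or_one (n / 2 ^ L) with h | h <;> simp [h]

theorem idEntry_idMeasurements {r : ℕ} (A : Matrix (Fin r) (Fin N) Bool) (x : Fin N → ℝ)
    (i : Fin (1 + Nat.clog 2 N)) (j : Fin r) :
    idEntry (idMeasurements A x) i j = ∑ l, (if A j l = true then 1 else 0) *
      (if bitTest N i l = true then 1 else 0) * x l := by
  have h1 : (finProdFinEquiv (i, j)).divNat = i :=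
    congrArg Prod.fst (finProdFinEquiv.symm_apply_apply (i, j))
  have h2 : (finProdFinEquiv (i, j)).modNat = j :=
    congrArg Prod.snd (finProdFinEquiv.symm_apply_apply (i, j))
  simp [idEntry, idMeasurements, Matrix.mulVec, dotProduct, realMat, rowTensor, h1, h2]

/-- Exactly one of the two complementary measurements for a bit contains `x n`. Their errors add up
to at most `δ < |x n|`, so the one containing `x n` is strictly larger in magnitude, and every bit
of `n` is read correctly. -/
theorem foundIndex_eq_of_isGoodRow {r : ℕ} (A : Matrix (Fin r) (Fin N) Bool) (x : Fin N → ℝ) {δ : ℝ}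
    {n : Fin N} {j : Fin r} (h : IsGoodRow A x δ n j) (hx : δ < |x n|) :
    foundIndex (idMeasurements A x) j = n := by
  have hbit : ∀ i : Fin (Nat.clog 2 N),
      (|idEntry (idMeasurements A x) 0 j - idEntry (idMeasurements A x) (Fin.natAdd 1 i) j| <
        |idEntry (idMeasurements A x) (Fin.natAdd 1 i) j|) ↔ n.val.testBit i = true := by
    intro i
    have hb : ∀ l : Fin N, bitTest N (Fin.natAdd 1 i) l = l.val.testBit i := by
      intro l; simp [bitTest]
    have h0 : ∀ l : Fin N, bitTest N 0 l = true := by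
      intro l; simp [bitTest]
    have e1 : idEntry (idMeasurements A x) (Fin.natAdd 1 i) j =
        ∑ l, (if A j l = true then 1 else 0) * (if l.val.testBit i = true then 1 else 0) * x l := by
      rw [idEntry_idMeasurements]; simp only [hb]
    have e0 : idEntry (idMeasurements A x) 0 j - idEntry (idMeasurements A x) (Fin.natAdd 1 i) j =
        ∑ l, (if A j l = true then 1 else 0) * (if l.val.testBit i = true then 0 else 1) * x l := by
      rw [e1, idEntry_idMeasurements, ← Finset.sum_sub_distrib]
      refine Finset.sum_congr rfl fun l _ => ?_
      rw [h0]
      split_ifs <;> simp_all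
    have := (abs_sum_sub_le_interference A x h.1 (fun l => if l.val.testBit i = true then 1 else 0)
      (fun l => if l.val.testBit i = true then 0 else 1)
      (fun l _ => by split_ifs <;> simp)).trans h.2
    rw [← e1, ← e0] at this
    set a := idEntry (idMeasurements A x) (Fin.natAdd 1 i) j
    set d := idEntry (idMeasurements A x) 0 j - a
    by_cases hn : n.val.testBit i = true
    · simp only [hn, if_true, one_mul, zero_mul, sub_zero, iff_true] at this ⊢
      have := abs_sub_abs_le_abs_sub (x n) a
      rw [abs_sub_comm] at this
      linarith
    · simp only [hn, Bool.false_eq_true, if_false, one_mul, zero_mul, sub_zero, iff_false,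
        not_lt] at this ⊢
      have := abs_sub_abs_le_abs_sub (x n) d
      rw [abs_sub_comm (x n) d] at this
      linarith
  unfold foundIndex
  simp only [hbit]
  rw [← Finset.sum_range (fun i => if n.val.testBit i = true then 2 ^ i else 0), sum_testBit_eq_mod,
    Nat.mod_eq_of_lt]
  -- The `⌈log₂ N⌉` tested bits determine an index below `N` completely.
  exact n.2.trans_le (Nat.le_pow_clog (by norm_num) N)

theorem mem_identified_of_isGoodRow {r : ℕ} (A : Matrix (Fin r) (Fin N) Bool) (x : Fin N → ℝ) {δ : ℝ}
    {n : Fin N} {j : Fin r} (h : IsGoodRow A x δ n j) (hx : δ < |x n|) :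
    n ∈ identified N (idMeasurements A x) := by
  classical
  exact Finset.mem_filter.2 ⟨Finset.mem_univ _, j, foundIndex_eq_of_isGoodRow A x h hx⟩

theorem card_identified_le {L r : ℕ} (u : Fin ((1 + L) * r) → ℝ) : (identified N u).card ≤ r := by
  classical
  have : (identified N u).image Fin.val ⊆ Finset.univ.image fun j : Fin r => foundIndex u j := by
    intro a ha
    simp only [Finset.mem_image, identified, Finset.mem_filter, Finset.mem_univ, true_and] at ha ⊢
    obtain ⟨n, ⟨j, hj⟩, rfl⟩ := ha
    exact ⟨j, hj⟩
  calc (identified N u).card = ((identified N u).image Fin.val).card :=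
        (Finset.card_image_of_injective _ Fin.val_injective).symm
    _ ≤ _ := Finset.card_le_card this
    _ ≤ (Finset.univ : Finset (Fin r)).card := Finset.card_image_le
    _ = r := by simp

-- Bad rows come in two kinds. Those with a one in another column of `U` number at most `α` per
-- element of `U`, hence at most `α t`. The others, collected in `W`, take more than `δ` from
-- outside `U`; each outside entry is seen by at most `α` rows of column `n`, so `δ` times the size
-- of `W` is at most `α δ t`.
open Classical in
theorem badCount_le [Fintype ι] {A : Matrix ι (Fin N) Bool} {K α : ℕ} (hA : IsCoherent A K α)
    (x : Fin N → ℝ) {δ t : ℝ} (hδ : 0 ≤ δ) (U : Finset (Fin N)) (hU : (U.card : ℝ) ≤ t)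
    (hx : ∑ l ∈ Uᶜ, |x l| ≤ δ * t) (n : Fin N) : (badCount A x δ n : ℝ) ≤ 2 * α * t := by
  set W := Finset.univ.filter fun i : ι => A i n = true ∧
    δ < ∑ l ∈ Uᶜ.filter (fun l => l ≠ n ∧ A i l = true), |x l| with hW
  have hsub : Finset.univ.filter (IsBadRow A x δ n) ⊆
      ((U.erase n).biUnion fun l => Finset.univ.filter fun i => A i n = true ∧ A i l = true) ∪ W := by
    intro i hi
    simp only [Finset.mem_filter, Finset.mem_univ, true_and, IsBadRow] at hi
    by_cases hex : ∃ l ∈ U.erase n, A i l = true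
    · obtain ⟨l, hl, hil⟩ := hex
      exact Finset.mem_union_left _ (Finset.mem_biUnion.2 ⟨l, hl, by simp [hi.1, hil]⟩)
    · refine Finset.mem_union_right _ (Finset.mem_filter.2 ⟨Finset.mem_univ _, hi.1, ?_⟩)
      refine hi.2.trans_le (le_of_eq ?_)
      rw [interference]
      congr 1
      ext l
      simp only [Finset.mem_filter, Finset.mem_univ, true_and, Finset.mem_compl]
      refine ⟨fun h => ⟨fun hlU => hex ⟨l, Finset.mem_erase.2 ⟨h.1, hlU⟩, h.2⟩, h⟩, fun h => h.2⟩
  have h1 : (((U.erase n).biUnion fun l =>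
      Finset.univ.filter fun i => A i n = true ∧ A i l = true).card : ℝ) ≤ α * t := by
    have : ((U.erase n).biUnion fun l =>
        Finset.univ.filter fun i => A i n = true ∧ A i l = true).card ≤ U.card * α := by
      refine (Finset.card_biUnion_le_card_mul _ _ α fun l hl => ?_).trans
        (Nat.mul_le_mul_right _ (Finset.card_le_card (Finset.erase_subset _ _)))
      exact hA.2 n l (Finset.ne_of_mem_erase hl).symm
    calc _ ≤ ((U.card * α : ℕ) : ℝ) := by exact_mod_cast this
      _ = α * U.card := by push_cast; ring
      _ ≤ _ := by gcongr
  have h2 : (W.card : ℝ) ≤ α * t := by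
    have hs : ∑ i ∈ W, ∑ l ∈ Uᶜ.filter (fun l => l ≠ n ∧ A i l = true), |x l| ≤ α * (δ * t) := by
      calc ∑ i ∈ W, ∑ l ∈ Uᶜ.filter (fun l => l ≠ n ∧ A i l = true), |x l|
          = ∑ i ∈ W, ∑ l ∈ Uᶜ, if l ≠ n ∧ A i l = true then |x l| else 0 := by
            simp only [Finset.sum_filter]
        _ = ∑ l ∈ Uᶜ, ∑ i ∈ W, if l ≠ n ∧ A i l = true then |x l| else 0 := Finset.sum_comm
        _ ≤ ∑ l ∈ Uᶜ, α * |x l| := by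
            refine Finset.sum_le_sum fun l _ => ?_
            rw [← Finset.sum_filter, Finset.sum_const, nsmul_eq_mul]
            refine mul_le_mul_of_nonneg_right ?_ (abs_nonneg _)
            by_cases hln : l = n
            · simp [hln]
            · refine Nat.cast_le.2 (le_trans (Finset.card_le_card ?_) (hA.2 n l (Ne.symm hln)))
              intro i hi
              simp only [hW, Finset.mem_filter, Finset.mem_univ, true_and] at hi ⊢
              exact ⟨hi.1.1, hi.2.2⟩
        _ = α * ∑ l ∈ Uᶜ, |x l| := by rw [Finset.mul_sum]
        _ ≤ α * (δ * t) := by gcongr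
    have hs' : (W.card : ℝ) * δ ≤ ∑ i ∈ W, ∑ l ∈ Uᶜ.filter (fun l => l ≠ n ∧ A i l = true), |x l| := by
      rw [← nsmul_eq_mul]
      exact Finset.card_nsmul_le_sum _ _ _ fun i hi => (Finset.mem_filter.1 hi).2.2.le
    -- For `δ = 0` the division fails, but then `x` vanishes outside `U` and `W` is empty.
    rcases hδ.eq_or_lt with h0 | hpos
    · have hemp : W = ∅ := by
        refine Finset.eq_empty_of_forall_notMem fun i hi => ?_
        have hlt := (Finset.mem_filter.1 hi).2.2
        have hle : ∑ l ∈ Uᶜ.filter (fun l => l ≠ n ∧ A i l = true), |x l| ≤ ∑ l ∈ Uᶜ, |x l| :=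
          Finset.sum_le_sum_of_subset_of_nonneg (Finset.filter_subset _ _) fun _ _ _ => abs_nonneg _
        rw [← h0] at hlt hx
        linarith
      rw [hemp]
      have : 0 ≤ t := (Nat.cast_nonneg _).trans hU
      simp only [Finset.card_empty, Nat.cast_zero]
      positivity
    · refine le_of_mul_le_mul_right (hs'.trans (hs.trans_eq ?_)) hpos
      ring
  have h3 := (Finset.card_le_card hsub).trans (Finset.card_union_le _ _)
  have h4 : (badCount A x δ n : ℝ) ≤ ((((U.erase n).biUnion fun l =>
      Finset.univ.filter fun i => A i n = true ∧ A i l = true).card + W.card : ℕ) : ℝ) := by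
    rw [badCount]
    exact_mod_cast h3
  push_cast at h4
  linarith

-- At most `t` heavy entries lie in `U`, and the mass `δ t` outside `U` leaves room for at most `t`
-- more.
open Classical in
theorem card_heavy_le (x : Fin N → ℝ) {δ t : ℝ} (hδ : 0 ≤ δ) (U : Finset (Fin N))
    (hU : (U.card : ℝ) ≤ t) (hx : ∑ l ∈ Uᶜ, |x l| ≤ δ * t) :
    ((Finset.univ.filter fun n => δ < |x n|).card : ℝ) ≤ 2 * t := by
  set W := Uᶜ.filter fun n => δ < |x n| with hW
  have hsub : (Finset.univ.filter fun n => δ < |x n|) ⊆ U ∪ W := by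
    intro n hn
    by_cases hnU : n ∈ U
    · exact Finset.mem_union_left _ hnU
    · refine Finset.mem_union_right _ (Finset.mem_filter.2 ⟨Finset.mem_compl.2 hnU, ?_⟩)
      exact (Finset.mem_filter.1 hn).2
  have h1 : (W.card : ℝ) ≤ t := by
    have hs : (W.card : ℝ) * δ ≤ ∑ l ∈ W, |x l| := by
      rw [← nsmul_eq_mul]
      exact Finset.card_nsmul_le_sum _ _ _ fun i hi => (Finset.mem_filter.1 hi).2.le
    have hs' : ∑ l ∈ W, |x l| ≤ ∑ l ∈ Uᶜ, |x l| :=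
      Finset.sum_le_sum_of_subset_of_nonneg (Finset.filter_subset _ _) fun _ _ _ => abs_nonneg _
    rcases hδ.eq_or_lt with h0 | hpos
    · have hemp : W = ∅ := by
        refine Finset.eq_empty_of_forall_notMem fun i hi => ?_
        have hlt := (Finset.mem_filter.1 hi).2
        have hle : |x i| ≤ ∑ l ∈ Uᶜ, |x l| :=
          Finset.single_le_sum (f := fun l => |x l|) (fun _ _ => abs_nonneg _) (Finset.mem_filter.1 hi).1
        rw [← h0] at hlt hx
        linarith
      rw [hemp]
      simpa using (Nat.cast_nonneg _).trans hU
    · refine le_of_mul_le_mul_right (hs.trans (hs'.trans (hx.trans_eq ?_))) hpos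
      ring
  have h3 : ((Finset.univ.filter fun n => δ < |x n|).card : ℝ) ≤ ((U.card + W.card : ℕ) : ℝ) := by
    exact_mod_cast (Finset.card_le_card hsub).trans (Finset.card_union_le _ _)
  push_cast at h3
  linarith

/-! ### From estimation errors to the recovery guarantee -/

theorem lpNormOf_two (v : Fin N → ℝ) : lpNormOf 2 v = √(∑ n, v n ^ 2) := by
  simp [lpNormOf, EuclideanSpace.norm_eq]

theorem lpNormOf_one (v : Fin N → ℝ) : lpNormOf 1 v = ∑ n, |v n| := by
  simp [lpNormOf, PiLp.norm_eq_of_nat 1 Nat.cast_one.symm]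

theorem lpNormOf_two_le_add {v a d : Fin N → ℝ} (h : ∀ n, |v n| ≤ a n + d n) :
    lpNormOf 2 v ≤ lpNormOf 2 a + lpNormOf 2 d := by
  have h1 : lpNormOf 2 v ≤ lpNormOf 2 (a + d) := by
    rw [lpNormOf_two, lpNormOf_two]
    refine Real.sqrt_le_sqrt (Finset.sum_le_sum fun n _ => ?_)
    rw [← sq_abs]
    exact pow_le_pow_left₀ (abs_nonneg _) (h n) 2
  refine h1.trans ?_
  simp only [lpNormOf, WithLp.toLp_add]
  exact norm_add_le _ _

open Classical in
/-- Keeping the `2 k` largest estimates is as good as keeping the entries of any set `U` of at most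
`k` indices, up to the estimation error. -/
theorem lpNormOf_sub_le_of_isEstimate {b k : ℕ} {A : Matrix (Fin b) (Fin N) Bool} {y : Fin b → ℝ}
    {S : Finset (Fin N)} {x z : Fin N → ℝ} {δ : ℝ} (hδ : 0 ≤ δ) (hz : IsEstimate A y S k z)
    (hest : ∀ n ∈ S, ∀ w, IsMedian (columnValues A y n) w → |w - x n| ≤ δ)
    (hS : ∀ n, δ < |x n| → n ∈ S) (U : Finset (Fin N)) (hU : U.card ≤ k) :
    lpNormOf 2 (x - z) ≤ √(∑ n ∈ Uᶜ, x n ^ 2) + 4 * δ * √k := by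
  obtain ⟨w, hw, T, hTF, hTcard, hTmax, rfl⟩ := hz
  set F := S.filter (fun n => w n ≠ 0) with hF
  have hSw : ∀ n ∈ S, |w n - x n| ≤ δ := fun n hn => hest n hn _ (hw n hn)
  have hTS : ∀ n ∈ T, n ∈ S := fun n hn => (Finset.mem_filter.1 (hTF hn)).1
  have hnF : ∀ n, n ∉ F → |x n| ≤ δ := by
    intro n hn
    by_contra hlt
    have hnS := hS n (not_le.1 hlt)
    have h0 : w n = 0 := by
      by_contra h0
      exact hn (Finset.mem_filter.2 ⟨hnS, h0⟩)
    have := hSw n hnS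
    rw [h0, zero_sub, abs_neg] at this
    exact hlt this
  have hT2 : T.card ≤ 2 * k := hTcard.trans_le (min_le_left _ _)
  -- The level `c` separates kept from discarded entries up to `2 δ`, and the kept entries outside
  -- `U` are large enough to pay for the discarded ones inside `U`. If all nonzero estimates are
  -- kept, every discarded entry is at most `δ` and `c = 0` works.
  obtain ⟨c, hc0, hc, hcU⟩ : ∃ c : ℝ, 0 ≤ c ∧ (∀ n, n ∉ T → |x n| ≤ c + 2 * δ) ∧
      ((U \ T).card : ℝ) * c ^ 2 ≤ ∑ n ∈ T \ U, x n ^ 2 := by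
    by_cases hcase : T = F
    · refine ⟨0, le_rfl, fun n hn => ?_, ?_⟩
      · have := hnF n (hcase ▸ hn)
        linarith
      · simpa using Finset.sum_nonneg fun n _ => sq_nonneg (x n)
    · have hT : T.card = 2 * k := by
        by_contra hne
        exact hcase (Finset.eq_of_subset_of_card_le hTF (by omega))
      -- An empty `T` with `2 k` elements forces `k = 0` and `U = ∅`; any bound for the entries of
      -- `x` serves as `c`.
      rcases T.eq_empty_or_nonempty with hemp | hne
      · refine ⟨∑ n, |x n|, Finset.sum_nonneg fun _ _ => abs_nonneg _, fun n _ => ?_, ?_⟩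
        · have := Finset.single_le_sum (f := fun l => |x l|) (fun _ _ => abs_nonneg _)
            (Finset.mem_univ n)
          linarith
        · have : U = ∅ := by
            rw [hemp, Finset.card_empty] at hT
            exact Finset.card_eq_zero.1 (by omega)
          simp [this, hemp]
      -- The smallest kept estimate, lowered by `δ`, bounds the kept entries of `x` from below. As
      -- `T` has `2 k` elements and `U` at most `k`, the set `T \ U` is at least as large as `U \
      -- T`.
      · obtain ⟨i₀, hi₀, hmin⟩ := T.exists_min_image (fun n => |w n|) hne
        refine ⟨max 0 (|w i₀| - δ), le_max_left _ _, fun n hn => ?_, ?_⟩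
        · by_cases hnF' : n ∈ F
          · have h1 := hTmax i₀ hi₀ n hnF' hn
            have h2 := hSw n (Finset.mem_filter.1 hnF').1
            have h3 := abs_sub_abs_le_abs_sub (x n) (w n)
            rw [abs_sub_comm] at h3
            have h4 := le_max_right 0 (|w i₀| - δ)
            linarith
          · have := hnF n hnF'
            have h4 := le_max_left 0 (|w i₀| - δ)
            linarith
        · have h1 : (U \ T).card ≤ (T \ U).card := by
            have e1 := Finset.card_sdiff_add_card_inter U T
            have e2 := Finset.card_sdiff_add_card_inter T U
            rw [Finset.inter_comm] at e2
            omega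
          calc ((U \ T).card : ℝ) * max 0 (|w i₀| - δ) ^ 2
              ≤ ((T \ U).card : ℝ) * max 0 (|w i₀| - δ) ^ 2 := by gcongr
            _ ≤ _ := by
              rw [← nsmul_eq_mul]
              refine Finset.card_nsmul_le_sum _ _ _ fun i hi => ?_
              have hiT := (Finset.mem_sdiff.1 hi).1
              rw [← sq_abs (x i)]
              refine pow_le_pow_left₀ (le_max_left _ _) (max_le (abs_nonneg _) ?_) 2
              have h1 := hmin i hiT
              have h2 := hSw i (hTS i hiT)
              have h3 := abs_sub_abs_le_abs_sub (w i) (x i)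
              linarith
  -- The error is dominated by `a + d`: the norm of `a` is compared with the tail of `x` outside
  -- `U`, and `d` collects the multiples of `δ`.
  set a : Fin N → ℝ := fun n => if n ∈ T then 0 else if n ∈ U then c else |x n| with ha
  set d : Fin N → ℝ := fun n => if n ∈ T then δ else if n ∈ U then 2 * δ else 0 with hd
  have had : ∀ n, |(x - fun n => if n ∈ T then w n else 0) n| ≤ a n + d n := by
    intro n
    simp only [Pi.sub_apply, ha, hd]
    by_cases hnT : n ∈ T
    · simp only [hnT, if_true, zero_add]
      rw [abs_sub_comm]
      exact hSw n (hTS n hnT)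
    · by_cases hnU : n ∈ U
      · simpa [hnT, hnU] using hc n hnT
      · simp [hnT, hnU]
  refine (lpNormOf_two_le_add had).trans (add_le_add ?_ ?_)
  · rw [lpNormOf_two]
    refine Real.sqrt_le_sqrt ?_
    have e1 : ∑ n, a n ^ 2 = ((U \ T).card : ℝ) * c ^ 2 + ∑ n ∈ (T ∪ U)ᶜ, x n ^ 2 := by
      have : ∀ n, a n ^ 2 = (if n ∈ U \ T then c ^ 2 else 0) + if n ∈ (T ∪ U)ᶜ then x n ^ 2 else 0 := by
        intro n
        by_cases hnT : n ∈ T <;> by_cases hnU : n ∈ U <;> simp [ha, hnT, hnU]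
      simp only [this, Finset.sum_add_distrib, Finset.sum_ite_mem, Finset.univ_inter,
        Finset.sum_const, nsmul_eq_mul]
    have e2 : Uᶜ = (T \ U) ∪ (T ∪ U)ᶜ := by
      ext n
      simp only [Finset.mem_compl, Finset.mem_union, Finset.mem_sdiff]
      tauto
    have hdis : Disjoint (T \ U) (T ∪ U)ᶜ := by
      rw [Finset.disjoint_left]
      intro n hn hn'
      simp only [Finset.mem_compl, Finset.mem_union, Finset.mem_sdiff] at hn hn'
      tauto
    rw [e1, e2, Finset.sum_union hdis]
    linarith
  · rw [lpNormOf_two]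
    refine Real.sqrt_le_iff.2 ⟨by positivity, ?_⟩
    have e1 : ∑ n, d n ^ 2 = (T.card : ℝ) * δ ^ 2 + (U \ T).card * (2 * δ) ^ 2 := by
      have : ∀ n, d n ^ 2 = (if n ∈ T then δ ^ 2 else 0) + if n ∈ U \ T then (2 * δ) ^ 2 else 0 := by
        intro n
        by_cases hnT : n ∈ T <;> by_cases hnU : n ∈ U <;> simp [hd, hnT, hnU]
      simp only [this, Finset.sum_add_distrib, Finset.sum_ite_mem, Finset.univ_inter,
        Finset.sum_const, nsmul_eq_mul]
    -- The squared norm of `d` is at most `2 k δ² + 4 k δ² = 6 k δ²`, well below `16 k δ²`.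
    rw [e1, mul_pow (4 * δ), Real.sq_sqrt (Nat.cast_nonneg k)]
    have h1 : (T.card : ℝ) ≤ 2 * k := by exact_mod_cast hT2
    have h2 : ((U \ T).card : ℝ) ≤ k := by
      exact_mod_cast (Finset.card_le_card Finset.sdiff_subset).trans hU
    nlinarith [sq_nonneg δ]

/-- The admissible interference `ε ‖x - xt‖₁ / k`. -/
noncomputable def noiseLevel (x xt : Fin N → ℝ) (k : ℕ) (ε : ℝ) : ℝ := ε * lpNormOf 1 (x - xt) / k

theorem noiseLevel_nonneg (x xt : Fin N → ℝ) (k : ℕ) {ε : ℝ} (hε : 0 < ε) :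
    0 ≤ noiseLevel x xt k ε := by
  have : 0 ≤ lpNormOf 1 (x - xt) := norm_nonneg _
  unfold noiseLevel
  positivity

theorem sum_compl_abs_le_noiseLevel (x xt : Fin N → ℝ) {k : ℕ} (hk : 1 ≤ k) {ε : ℝ} (hε : 0 < ε) :
    ∑ l ∈ (Finset.univ.filter fun n => xt n ≠ 0)ᶜ, |x l| ≤ noiseLevel x xt k ε * (k / ε) := by
  have hk' : (0 : ℝ) < k := by exact_mod_cast hk
  have e : noiseLevel x xt k ε * (k / ε) = lpNormOf 1 (x - xt) := by
    unfold noiseLevel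
    field_simp
  rw [e, lpNormOf_one]
  calc _ = ∑ l ∈ (Finset.univ.filter fun n => xt n ≠ 0)ᶜ, |(x - xt) l| := by
        refine Finset.sum_congr rfl fun l hl => ?_
        simp only [Finset.mem_compl, Finset.mem_filter, Finset.mem_univ, true_and, not_not] at hl
        simp [hl]
    _ ≤ _ := Finset.sum_le_sum_of_subset_of_nonneg (Finset.subset_univ _) fun _ _ _ => abs_nonneg _

/-- For the noise level `δ` the term `4 δ √k` equals `4 ε ‖x - xt‖₁ / √k`, which lies within the
permitted constant 22. -/
theorem errorBound_of_isEstimate {b k : ℕ} {A : Matrix (Fin b) (Fin N) Bool}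
    {S : Finset (Fin N)} {x xk xt z : Fin N → ℝ} {ε : ℝ} (hk : 1 ≤ k) (hε : 0 < ε)
    (hxk : nonzeroCount xk ≤ k) (hz : IsEstimate A (estMeasurements A x) S k z)
    (hest : ∀ n ∈ S, badCount A x (noiseLevel x xt k ε) n < goodCount A x (noiseLevel x xt k ε) n)
    (hS : ∀ n, noiseLevel x xt k ε < |x n| → n ∈ S) : ErrorBound x xk xt k ε z := by
  have hδ := noiseLevel_nonneg x xt k hε
  have hk' : (0 : ℝ) < k := by exact_mod_cast hk
  refine (lpNormOf_sub_le_of_isEstimate hδ hz (fun n hn w hw => abs_sub_le_of_isMedian A x (hest n hn) hw)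
    hS (Finset.univ.filter fun n => xk n ≠ 0) hxk).trans (add_le_add ?_ ?_)
  · rw [lpNormOf_two]
    refine Real.sqrt_le_sqrt ?_
    calc _ = ∑ l ∈ (Finset.univ.filter fun n => xk n ≠ 0)ᶜ, (x - xk) l ^ 2 := by
          refine Finset.sum_congr (by congr) fun l hl => ?_
          simp only [Finset.mem_compl, Finset.mem_filter, Finset.mem_univ, true_and, not_not] at hl
          simp [hl]
      _ ≤ _ := Finset.sum_le_sum_of_subset_of_nonneg (Finset.subset_univ _) fun _ _ _ => sq_nonneg _
  · have h0 : 0 ≤ ε * lpNormOf 1 (x - xt) := mul_nonneg hε.le (norm_nonneg _)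
    have hs : √(k : ℝ) * √(k : ℝ) = k := Real.mul_self_sqrt hk'.le
    have hs' : 0 < √(k : ℝ) := Real.sqrt_pos.2 hk'
    have e : 4 * noiseLevel x xt k ε * √(k : ℝ) = 4 * (ε * lpNormOf 1 (x - xt)) / √(k : ℝ) := by
      rw [noiseLevel, eq_div_iff hs'.ne', mul_assoc, hs]
      field_simp
    rw [e]
    refine div_le_div_of_nonneg_right ?_ hs'.le
    linarith

/-- Identification uses only that a heavy index has at least one good row; estimation needs the
majority, but only for indices actually found. -/
theorem recoverySucceeds_of_counts {r b k : ℕ} {B : Matrix (Fin r) (Fin N) Bool}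
    {A : Matrix (Fin b) (Fin N) Bool} {x xk xt : Fin N → ℝ} {ε : ℝ} (hk : 1 ≤ k) (hε : 0 < ε)
    (hxk : nonzeroCount xk ≤ k)
    (hB : ∀ n, noiseLevel x xt k ε < |x n| →
      badCount B x (noiseLevel x xt k ε) n < goodCount B x (noiseLevel x xt k ε) n)
    (hA : ∀ n ∈ identified N (idMeasurements B x),
      badCount A x (noiseLevel x xt k ε) n < goodCount A x (noiseLevel x xt k ε) n) :
    RecoverySucceeds B A x xk xt k ε := by
  classical
  intro z hz
  refine errorBound_of_isEstimate hk hε hxk hz hA fun n hn => ?_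
  obtain ⟨j, hj⟩ := Finset.card_pos.1 ((Nat.zero_le _).trans_lt (hB n hn))
  exact mem_identified_of_isGoodRow B x (Finset.mem_filter.1 hj).2 hn

theorem estimationSucceeds_of_counts {b k : ℕ} {A : Matrix (Fin b) (Fin N) Bool}
    {x xk xt : Fin N → ℝ} {ε : ℝ} (hk : 1 ≤ k) (hε : 0 < ε) (hxk : nonzeroCount xk ≤ k)
    (hA : ∀ n, badCount A x (noiseLevel x xt k ε) n < goodCount A x (noiseLevel x xt k ε) n) :
    EstimationSucceeds A x xk xt k ε := fun _ hz =>
  errorBound_of_isEstimate hk hε hxk hz (fun n _ => hA n) fun n _ => Finset.mem_univ n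

end Deterministic

/-! ## Sampling with replacement -/

section Sampling

variable {ι : Type*} [Fintype ι]

open Classical in
/-- Markov's inequality for a product of nonnegative weights of independent uniform samples. -/
theorem card_filter_mul_le_of_prod_weight {b : ℕ} (f : ι → ℝ) (hf : ∀ i, 0 ≤ f i) {a v : ℝ}
    (hsum : ∑ i, f i ≤ Fintype.card ι * Real.exp a) (E : (Fin b → ι) → Prop)
    (hE : ∀ s, E s → v ≤ ∏ j, f (s j)) :
    ((Finset.univ.filter E).card : ℝ) * v ≤ (Fintype.card ι : ℝ) ^ b * Real.exp (b * a) := by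
  calc ((Finset.univ.filter E).card : ℝ) * v ≤ ∑ s ∈ Finset.univ.filter E, ∏ j, f (s j) := by
        rw [← nsmul_eq_mul]
        exact Finset.card_nsmul_le_sum _ _ _ fun s hs => hE s (Finset.mem_filter.1 hs).2
    _ ≤ ∑ s : Fin b → ι, ∏ j, f (s j) :=
        Finset.sum_le_sum_of_subset_of_nonneg (Finset.filter_subset _ _) fun s _ _ =>
          Finset.prod_nonneg fun j _ => hf _
    _ = (∑ i, f i) ^ b := by rw [Fintype.sum_pow]
    _ ≤ ((Fintype.card ι : ℝ) * Real.exp a) ^ b :=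
        pow_le_pow_left₀ (Finset.sum_nonneg fun i _ => hf i) hsum b
    _ = _ := by rw [mul_pow, ← Real.exp_nat_mul]

-- Weight `1/2` on `G` and `2` on `B` makes the product at least `1` whenever the samples hit `B` at
-- least as often as `G`. The mean weight is at most `1 - θ ≤ exp (-θ)`.
open Classical in
theorem card_good_le_bad_le {b : ℕ} (G B : Finset ι) {θ : ℝ}
    (hθ : θ * Fintype.card ι ≤ G.card / 2 - B.card) :
    ((Finset.univ.filter fun s : Fin b → ι => (Finset.univ.filter fun j => s j ∈ G).card ≤
      (Finset.univ.filter fun j => s j ∈ B).card).card : ℝ) ≤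
      (Fintype.card ι : ℝ) ^ b * Real.exp (b * (-θ)) := by
  have key := card_filter_mul_le_of_prod_weight (b := b)
    (fun i => (if i ∈ G then 2⁻¹ else 1) * if i ∈ B then 2 else 1) (fun i => by positivity)
    (a := -θ) (v := 1) ?_ (fun s => (Finset.univ.filter fun j => s j ∈ G).card ≤
      (Finset.univ.filter fun j => s j ∈ B).card) ?_
  · rw [mul_one] at key
    convert key
  · have h1 : ∀ i, ((if i ∈ G then 2⁻¹ else 1) * if i ∈ B then 2 else 1 : ℝ) ≤
        1 + (if i ∈ B then 1 else 0) - (if i ∈ G then 2⁻¹ else 0) := by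
      intro i
      split_ifs <;> norm_num
    have h2 := Finset.sum_le_sum fun (i : ι) (_ : i ∈ Finset.univ) => h1 i
    rw [Finset.sum_sub_distrib, Finset.sum_add_distrib] at h2
    simp only [Finset.sum_const, Finset.card_univ, nsmul_eq_mul, mul_one, Finset.sum_ite_mem,
      Finset.univ_inter] at h2
    have h3 := mul_le_mul_of_nonneg_left (Real.add_one_le_exp (-θ)) (Nat.cast_nonneg (α := ℝ) (Fintype.card ι))
    linarith
  · intro s hs
    rw [Finset.prod_mul_distrib, Finset.prod_ite, Finset.prod_ite]
    simp only [Finset.prod_const, one_pow, mul_one, inv_pow]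
    rw [inv_mul_eq_div, one_le_div (by positivity)]
    exact pow_le_pow_right₀ (by norm_num) hs

-- With weight `2` on `G` and `1` elsewhere, more than `h` hits make the product exceed `2 ^ h`,
-- while the mean weight is at most `1 + a ≤ exp a`.
open Classical in
theorem card_hits_gt_le {b : ℕ} (G : Finset ι) {a h : ℝ} (hG : (G.card : ℝ) ≤ a * Fintype.card ι) :
    ((Finset.univ.filter fun s : Fin b → ι =>
      h < (Finset.univ.filter fun j => s j ∈ G).card).card : ℝ) ≤
      (Fintype.card ι : ℝ) ^ b * Real.exp (b * a - h * Real.log 2) := by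
  have key := card_filter_mul_le_of_prod_weight (b := b) (fun i => if i ∈ G then 2 else 1)
    (fun i => by positivity) (a := a) (v := Real.exp (h * Real.log 2)) ?_
    (fun s => h < (Finset.univ.filter fun j => s j ∈ G).card) ?_
  · rw [sub_eq_add_neg, Real.exp_add, Real.exp_neg, ← mul_assoc, ← div_eq_mul_inv,
      le_div_iff₀ (Real.exp_pos _)]
    exact key
  · have h1 : ∀ i, (if i ∈ G then 2 else 1 : ℝ) = 1 + (if i ∈ G then 1 else 0) := by
      intro i
      split_ifs <;> norm_num
    simp only [h1, Finset.sum_add_distrib, Finset.sum_const, Finset.card_univ, nsmul_eq_mul, mul_one,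
      Finset.sum_ite_mem, Finset.univ_inter]
    have h3 := mul_le_mul_of_nonneg_left (Real.add_one_le_exp a) (Nat.cast_nonneg (α := ℝ) (Fintype.card ι))
    linarith
  · intro s hs
    rw [Finset.prod_ite]
    simp only [Finset.prod_const, one_pow, mul_one]
    rw [← Real.rpow_natCast, Real.rpow_def_of_pos (by norm_num), Real.exp_le_exp, mul_comm]
    exact mul_le_mul_of_nonneg_left hs.le (Real.log_nonneg (by norm_num))

open Classical in
theorem ofReal_le_uniformOn_univ {Ω : Type*} [Fintype Ω] [Nonempty Ω] [MeasurableSpace Ω]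
    [MeasurableSingletonClass Ω] {σ : ℝ} {E : Set Ω}
    (h : ((Finset.univ.filter fun ω => ω ∉ E).card : ℝ) ≤ (1 - σ) * Fintype.card Ω) :
    ENNReal.ofReal σ ≤ uniformOn Set.univ E := by
  have hE : E.toFinset = Finset.univ.filter fun ω => ω ∈ E := by ext; simp
  rw [uniformOn_univ, Measure.count_apply_finite E E.toFinite]
  have hpos : (0 : ℝ) < Fintype.card Ω := by exact_mod_cast Fintype.card_pos
  rw [ENNReal.le_div_iff_mul_le (Or.inl (by simp)) (Or.inl (by simp)),
    ← ENNReal.ofReal_natCast, ← ENNReal.ofReal_natCast, ← ENNReal.ofReal_mul' (by positivity)]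
  refine ENNReal.ofReal_le_ofReal ?_
  have h2 := Finset.card_filter_add_card_filter_not (s := (Finset.univ : Finset Ω)) (fun ω => ω ∈ E)
  rw [Finset.card_univ] at h2
  have h3 : (E.toFinite.toFinset.card : ℝ) = (Finset.univ.filter fun ω => ω ∈ E).card := by
    congr 2
    ext; simp
  have h4 : ((Finset.univ.filter fun ω => ω ∈ E).card : ℝ) +
    (Finset.univ.filter fun ω => ω ∉ E).card = Fintype.card Ω := by exact_mod_cast h2
  rw [h3]
  linarith

-- The second event may depend on the first sample, as the set of identified indices does. This is
-- harmless because its failure bound holds for every fixed first sample.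
open Classical in
theorem ofReal_le_uniformOn_univ_prod {Ω₁ Ω₂ : Type*} [Fintype Ω₁] [Nonempty Ω₁] [MeasurableSpace Ω₁]
    [MeasurableSingletonClass Ω₁] [Fintype Ω₂] [Nonempty Ω₂] [MeasurableSpace Ω₂]
    [MeasurableSingletonClass Ω₂] {σ : ℝ} {E : Set (Ω₁ × Ω₂)} (E₁ : Ω₁ → Prop) (E₂ : Ω₁ → Ω₂ → Prop)
    (h₁ : ((Finset.univ.filter fun ω => ¬ E₁ ω).card : ℝ) ≤ (1 - σ) / 2 * Fintype.card Ω₁)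
    (h₂ : ∀ ω₁, ((Finset.univ.filter fun ω => ¬ E₂ ω₁ ω).card : ℝ) ≤
      (1 - σ) / 2 * Fintype.card Ω₂)
    (h : ∀ ω₁ ω₂, E₁ ω₁ → E₂ ω₁ ω₂ → (ω₁, ω₂) ∈ E) :
    ENNReal.ofReal σ ≤ uniformOn Set.univ E := by
  apply ofReal_le_uniformOn_univ
  have hle : ∀ ω₁, ((Finset.univ.filter fun ω₂ => (ω₁, ω₂) ∉ E).card : ℝ) ≤
      (if ¬ E₁ ω₁ then (Fintype.card Ω₂ : ℝ) else 0) + (1 - σ) / 2 * Fintype.card Ω₂ := by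
    intro ω₁
    by_cases hω : E₁ ω₁
    · simp only [hω, not_true, if_false, zero_add]
      refine le_trans (Nat.cast_le.2 (Finset.card_le_card fun ω₂ hω₂ => ?_)) (h₂ ω₁)
      simp only [Finset.mem_filter, Finset.mem_univ, true_and] at hω₂ ⊢
      exact fun h' => hω₂ (h _ _ hω h')
    · simp only [hω, not_false_eq_true, if_true]
      have h1 : ((Finset.univ.filter fun ω₂ => (ω₁, ω₂) ∉ E).card : ℝ) ≤ Fintype.card Ω₂ := by
        exact_mod_cast Finset.card_le_univ _
      have h2 := (Nat.cast_nonneg _).trans (h₂ ω₁)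
      linarith
  have hcard : ((Finset.univ.filter fun ω : Ω₁ × Ω₂ => ω ∉ E).card : ℝ) =
      ∑ ω₁, ((Finset.univ.filter fun ω₂ => (ω₁, ω₂) ∉ E).card : ℝ) := by
    simp only [Finset.card_filter, Fintype.sum_prod_type]
    push_cast
    rfl
  rw [hcard]
  refine (Finset.sum_le_sum fun ω₁ _ => hle ω₁).trans ?_
  rw [Finset.sum_add_distrib, ← Finset.sum_filter, Finset.sum_const, Finset.sum_const,
    Fintype.card_prod, Finset.card_univ, nsmul_eq_mul, nsmul_eq_mul]
  have := mul_le_mul_of_nonneg_right h₁ (Nat.cast_nonneg (α := ℝ) (Fintype.card Ω₂))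
  push_cast
  linarith

variable {N : ℕ}

open Classical in
/-- The matrix `M s` is made of `b` independent uniform samples `s j` in such a way that for every
column `n` the good and the bad rows correspond to samples in sets `G` and `B`, where the
density of `G` sufficiently exceeds that of `B`. -/
def IsSampledMatrix {b r : ℕ} (M : (Fin b → ι) → Matrix (Fin r) (Fin N) Bool) (x : Fin N → ℝ)
    (δ θ : ℝ) : Prop :=
  ∀ n, ∃ G B : Finset ι, θ * Fintype.card ι ≤ G.card / 2 - B.card ∧ ∀ s,
    goodCount (M s) x δ n = (Finset.univ.filter fun j => s j ∈ G).card ∧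
    badCount (M s) x δ n = (Finset.univ.filter fun j => s j ∈ B).card

/-- The exponential is `((1 - σ) / (2 q))²`. One factor `1 / (2 q)` pays for a union bound over `M ≤
2 q` indices, and the rest is at most `(1 - σ) / 2`. -/
theorem one_sub_div_sq_mul_le {σ q M : ℝ} (hσ : 2 / 3 ≤ σ) (hσ1 : σ < 1) (hq : 1 ≤ q)
    (hM : M ≤ 2 * q) : M * Real.exp (-(2 * Real.log (2 * q / (1 - σ)))) ≤ (1 - σ) / 2 := by
  have h1 : 0 < 1 - σ := by linarith
  have hu : 0 < 2 * q / (1 - σ) := by positivity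
  have e : Real.exp (-(2 * Real.log (2 * q / (1 - σ)))) = ((1 - σ) / (2 * q)) ^ 2 := by
    rw [Real.exp_neg, mul_comm, Real.exp_mul, Real.exp_log hu, Real.rpow_two, ← inv_pow, inv_div]
  rw [e, div_pow]
  calc M * ((1 - σ) ^ 2 / (2 * q) ^ 2) ≤ 2 * q * ((1 - σ) ^ 2 / (2 * q) ^ 2) := by gcongr
    _ = (1 - σ) ^ 2 / (2 * q) := by field_simp
    _ ≤ (1 - σ) ^ 2 / 2 := by gcongr; linarith
    _ ≤ (1 - σ) / 2 := by nlinarith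

theorem log_two_mul_div_nonneg {σ q : ℝ} (hσ : 2 / 3 ≤ σ) (hσ1 : σ < 1) (hq : 1 ≤ q) :
    0 ≤ Real.log (2 * q / (1 - σ)) := by
  refine Real.log_nonneg ?_
  rw [le_div_iff₀ (by linarith)]
  linarith

-- The sample size is chosen so that `b θ ≥ 2 ln (2 q / (1 - σ))`. Each index then fails with
-- probability at most `((1 - σ) / (2 q))²`, and a union bound over `H` finishes.
open Classical in
theorem IsSampledMatrix.card_fail_le {b r : ℕ} {M : (Fin b → ι) → Matrix (Fin r) (Fin N) Bool}
    {x : Fin N → ℝ} {δ θ κ ρ q σ : ℝ} (h : IsSampledMatrix M x δ θ) (hσ : 2 / 3 ≤ σ)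
    (hσ1 : σ < 1) (hq : 1 ≤ q) (hθ : 0 ≤ θ) (hκ : 2 ≤ θ * (κ * ρ)) (hb : b = sampleSize κ ρ q σ)
    (H : Finset (Fin N)) (hH : (H.card : ℝ) ≤ 2 * q) (E : (Fin b → ι) → Prop)
    (hE : ∀ s, (∀ n ∈ H, badCount (M s) x δ n < goodCount (M s) x δ n) → E s) :
    ((Finset.univ.filter fun s => ¬ E s).card : ℝ) ≤
      (1 - σ) / 2 * Fintype.card (Fin b → ι) := by
  have hL := log_two_mul_div_nonneg hσ hσ1 hq
  have hbθ : 2 * Real.log (2 * q / (1 - σ)) ≤ b * θ := by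
    have h1 : κ * ρ * Real.log (2 * q / (1 - σ)) ≤ b := by
      rw [hb]; exact Nat.le_ceil _
    have h2 := mul_le_mul_of_nonneg_right h1 hθ
    have h3 := mul_le_mul_of_nonneg_right hκ hL
    nlinarith
  have hone : ∀ n, ((Finset.univ.filter fun s => goodCount (M s) x δ n ≤ badCount (M s) x δ n).card : ℝ)
      ≤ (Fintype.card ι : ℝ) ^ b * Real.exp (-(2 * Real.log (2 * q / (1 - σ)))) := by
    intro n
    obtain ⟨G, B, hGB, hs⟩ := h n
    simp only [hs]
    refine (card_good_le_bad_le G B hGB).trans ?_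
    gcongr
    linarith
  have hsub : (Finset.univ.filter fun s => ¬ E s) ⊆
      H.biUnion fun n => Finset.univ.filter fun s => goodCount (M s) x δ n ≤ badCount (M s) x δ n := by
    intro s hs
    have hs' := mt (hE s) (Finset.mem_filter.1 hs).2
    simp only [not_forall, not_lt] at hs'
    obtain ⟨n, hn, h⟩ := hs'
    exact Finset.mem_biUnion.2 ⟨n, hn, by simpa using h⟩
  calc _ ≤ ((∑ n ∈ H, (Finset.univ.filter fun s =>
        goodCount (M s) x δ n ≤ badCount (M s) x δ n).card : ℕ) : ℝ) := by
        exact_mod_cast (Finset.card_le_card hsub).trans Finset.card_biUnion_le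
    _ ≤ ∑ n ∈ H, (Fintype.card ι : ℝ) ^ b * Real.exp (-(2 * Real.log (2 * q / (1 - σ)))) := by
        push_cast
        exact Finset.sum_le_sum fun n _ => hone n
    _ = (H.card * Real.exp (-(2 * Real.log (2 * q / (1 - σ))))) * (Fintype.card ι : ℝ) ^ b := by
        rw [Finset.sum_const, nsmul_eq_mul]; ring
    _ ≤ (1 - σ) / 2 * (Fintype.card ι : ℝ) ^ b := by
        gcongr
        exact one_sub_div_sq_mul_le hσ hσ1 hq hH
    _ = _ := by simp

/-- The first sample has to treat the at most `2 t` heavy entries, so `q = t` suffices there. The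
second has to treat the identified indices, at most one per row of the first matrix, so `q = r₁`. -/
theorem ofReal_le_uniformOn_recoverySucceeds {ι₁ ι₂ : Type*} [Fintype ι₁] [Nonempty ι₁]
    [MeasurableSpace ι₁] [MeasurableSingletonClass ι₁] [Fintype ι₂] [Nonempty ι₂]
    [MeasurableSpace ι₂] [MeasurableSingletonClass ι₂] {b₁ b₂ r₁ r₂ k : ℕ}
    {M₁ : (Fin b₁ → ι₁) → Matrix (Fin r₁) (Fin N) Bool}
    {M₂ : (Fin b₂ → ι₂) → Matrix (Fin r₂) (Fin N) Bool} {x xk xt : Fin N → ℝ}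
    {κ ρ₁ ρ₂ θ₁ θ₂ ε σ q : ℝ} (hk : 1 ≤ k) (hε : 0 < ε) (hε1 : ε ≤ 1)
    (hσ : 2 / 3 ≤ σ) (hσ1 : σ < 1)
    (hxk : nonzeroCount xk ≤ k) (hxt : (nonzeroCount xt : ℝ) ≤ k / ε)
    (h₁ : IsSampledMatrix M₁ x (noiseLevel x xt k ε) θ₁)
    (h₂ : IsSampledMatrix M₂ x (noiseLevel x xt k ε) θ₂)
    (hθ₁ : 0 ≤ θ₁) (hκ₁ : 2 ≤ θ₁ * (κ * ρ₁)) (hb₁ : b₁ = sampleSize κ ρ₁ (k / ε) σ)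
    (hθ₂ : 0 ≤ θ₂) (hκ₂ : 2 ≤ θ₂ * (κ * ρ₂)) (hb₂ : b₂ = sampleSize κ ρ₂ q σ)
    (hq : q = r₁) (hr : 1 ≤ r₁) :
    ENNReal.ofReal σ ≤ uniformOn Set.univ {s : (Fin b₁ → ι₁) × (Fin b₂ → ι₂) |
      RecoverySucceeds (M₁ s.1) (M₂ s.2) x xk xt k ε} := by
  classical
  have ht : 1 ≤ (k / ε : ℝ) := by
    rw [le_div_iff₀ hε, one_mul]
    exact hε1.trans (by exact_mod_cast hk)
  have hr' : (1 : ℝ) ≤ r₁ := by exact_mod_cast hr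
  refine ofReal_le_uniformOn_univ_prod
    (fun s => ∀ n ∈ Finset.univ.filter fun n => noiseLevel x xt k ε < |x n|,
      badCount (M₁ s) x (noiseLevel x xt k ε) n < goodCount (M₁ s) x (noiseLevel x xt k ε) n)
    (fun s₁ s => ∀ n ∈ identified N (idMeasurements (M₁ s₁) x),
      badCount (M₂ s) x (noiseLevel x xt k ε) n < goodCount (M₂ s) x (noiseLevel x xt k ε) n) ?_ ?_ ?_
  · exact h₁.card_fail_le hσ hσ1 ht hθ₁ hκ₁ hb₁ _ (card_heavy_le x (noiseLevel_nonneg x xt k hε) _ hxt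
      (sum_compl_abs_le_noiseLevel x xt hk hε)) _ fun _ h => h
  · intro s₁
    refine h₂.card_fail_le hσ hσ1 (hq ▸ hr') hθ₂ hκ₂ hb₂ _ ?_ _ fun _ h => h
    have : ((identified N (idMeasurements (M₁ s₁) x)).card : ℝ) ≤ r₁ := by
      exact_mod_cast card_identified_le _
    linarith
  · intro s₁ s₂ hs₁ hs₂
    exact recoverySucceeds_of_counts hk hε hxk (fun n hn => hs₁ n (by simpa using hn)) hs₂

/-! ### Sampling rows -/

theorem goodCount_sampleRows {b : ℕ} (A : Matrix ι (Fin N) Bool) (x : Fin N → ℝ) (δ : ℝ) (n : Fin N)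
    [DecidablePred (IsGoodRow A x δ n)] (s : Fin b → ι) [DecidableEq ι] :
    goodCount (sampleRows A s) x δ n =
      (Finset.univ.filter fun j => s j ∈ Finset.univ.filter (IsGoodRow A x δ n)).card := by
  unfold goodCount
  congr 1
  ext j
  simp only [Finset.mem_filter, Finset.mem_univ, true_and]
  rfl

theorem badCount_sampleRows {b : ℕ} (A : Matrix ι (Fin N) Bool) (x : Fin N → ℝ) (δ : ℝ) (n : Fin N)
    [DecidablePred (IsBadRow A x δ n)] (s : Fin b → ι) [DecidableEq ι] :
    badCount (sampleRows A s) x δ n =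
      (Finset.univ.filter fun j => s j ∈ Finset.univ.filter (IsBadRow A x δ n)).card := by
  unfold badCount
  congr 1
  ext j
  simp only [Finset.mem_filter, Finset.mem_univ, true_and]
  rfl

/-- With at least `K` ones in a column and at most `K / 10` bad rows, half the good rows minus the
bad ones is at least `K / 2 - 3 K / 20 ≥ K / 4`. -/
theorem isSampledMatrix_sampleRows {A : Matrix ι (Fin N) Bool} {K : ℕ} (hA : ∀ n, K ≤ columnOnes A n)
    {b : ℕ} (x : Fin N → ℝ) {δ : ℝ} (hbad : ∀ n, (badCount A x δ n : ℝ) ≤ K / 10) (hm : 0 < Fintype.card ι) :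
    IsSampledMatrix (fun s : Fin b → ι => sampleRows A s) x δ (K / (4 * Fintype.card ι)) := by
  classical
  intro n
  refine ⟨Finset.univ.filter (IsGoodRow A x δ n), Finset.univ.filter (IsBadRow A x δ n), ?_, fun s =>
    ⟨goodCount_sampleRows A x δ n s, badCount_sampleRows A x δ n s⟩⟩
  have h1 : (goodCount A x δ n : ℝ) + badCount A x δ n = columnOnes A n := by
    exact_mod_cast goodCount_add_badCount A x δ n
  have h2 : (K : ℝ) ≤ columnOnes A n := by exact_mod_cast hA n
  have hm' : (0 : ℝ) < Fintype.card ι := by exact_mod_cast hm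
  have e : (K / (4 * Fintype.card ι) : ℝ) * Fintype.card ι = K / 4 := by field_simp
  rw [e]
  have h3 := hbad n
  change (K : ℝ) / 4 ≤ (goodCount A x δ n : ℝ) / 2 - badCount A x δ n
  linarith

end Sampling

/-! ## DeVore matrices -/

section DeVore

variable {P N : ℕ}

/-- The row of block `q` in which column `n` of the DeVore matrix has its one. -/
def devoreRow (hP : 0 < P) (n : Fin N) (q : Fin P) : Fin P :=
  ⟨Nat.ofDigits q.val (Nat.digits P n.val) % P, Nat.mod_lt _ hP⟩

theorem devore_apply_eq_true_iff (hP : 0 < P) (n : Fin N) (q c : Fin P) :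
    devore P N (q, c) n = true ↔ c = devoreRow hP n q := by
  simp only [devore, decide_eq_true_eq, devoreRow, Fin.ext_iff]
  exact eq_comm

/-- A property that singles out at most the row `v q` in block `q` turns counting sampled rows into
counting sampled blocks. -/
theorem card_filter_blockRows {b : ℕ} (s : Fin b → Fin P) (v : Fin P → Fin P)
    (R : Fin P × Fin P → Prop) [DecidablePred R] (hR : ∀ q c, R (q, c) → c = v q) :
    (Finset.univ.filter fun i => R (blockRows s i)).card =
      (Finset.univ.filter fun j => R (s j, v (s j))).card := by
  have hb : ∀ a c, blockRows s (finProdFinEquiv (a, c)) = (s a, c) := by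
    intro a c
    have : ((finProdFinEquiv (a, c)).divNat, (finProdFinEquiv (a, c)).modNat) = (a, c) :=
      finProdFinEquiv.symm_apply_apply (a, c)
    exact congrArg (fun z : Fin b × Fin P => (s z.1, z.2)) this
  symm
  refine Finset.card_bij (fun j _ => finProdFinEquiv (j, v (s j))) (fun j hj => ?_)
    (fun i _ j _ h => congrArg Prod.fst (finProdFinEquiv.injective h)) fun i hi => ?_
  · rw [Finset.mem_filter, hb]
    exact ⟨Finset.mem_univ _, (Finset.mem_filter.1 hj).2⟩
  · obtain ⟨⟨a, c⟩, rfl⟩ := finProdFinEquiv.surjective i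
    have h := (Finset.mem_filter.1 hi).2
    rw [hb] at h
    have hc := hR _ _ h
    subst hc
    exact ⟨a, Finset.mem_filter.2 ⟨Finset.mem_univ _, h⟩, rfl⟩

-- The map `g` turns a source of randomness into block indices. Allowing fibres of size up to `c`
-- covers uniform blocks (`c = 1`) and blocks read off from fair bits (`c = 2`) at once; the
-- non-uniformity costs a factor `c` in the density of bad blocks.
open Classical in
theorem isSampledMatrix_devoreBlocks {ι : Type*} [Fintype ι] (hP : 0 < P) (g : ι → Fin P) {b c : ℕ}
    (hg : ∀ q, (Finset.univ.filter fun i => g i = q).card ≤ c) (x : Fin N → ℝ) {δ : ℝ}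
    (hbad : ∀ n, c * (badCount (devore P N) x δ n : ℝ) ≤ Fintype.card ι / 10) :
    IsSampledMatrix (fun s : Fin b → ι => devoreBlocks N fun j => g (s j)) x δ (1 / 4) := by
  intro n
  set B := Finset.univ.filter fun i => IsBadRow (devore P N) x δ n (g i, devoreRow hP n (g i)) with hB
  set G := Finset.univ.filter fun i => IsGoodRow (devore P N) x δ n (g i, devoreRow hP n (g i)) with hG
  refine ⟨G, B, ?_, fun s => ⟨?_, ?_⟩⟩
  · have h1 : B.card ≤ c * badCount (devore P N) x δ n := by
      refine Finset.card_le_mul_card_image_of_maps_to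
        (f := fun i => (g i, devoreRow hP n (g i))) (fun i hi => ?_) c fun q hq => ?_
      · exact Finset.mem_filter.2 ⟨Finset.mem_univ _, (Finset.mem_filter.1 hi).2⟩
      · refine (Finset.card_le_card fun i hi => ?_).trans (hg q.1)
        exact Finset.mem_filter.2 ⟨Finset.mem_univ _, congrArg Prod.fst (Finset.mem_filter.1 hi).2⟩
    have h2 : G.card + B.card = Fintype.card ι := by
      rw [hG, hB, ← Finset.card_univ, ← Finset.card_union_of_disjoint]
      · congr 1
        ext i
        have h3 := (devore_apply_eq_true_iff hP n (g i) _).2 rfl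
        rw [Finset.mem_union, Finset.mem_filter, Finset.mem_filter]
        simp only [Finset.mem_univ, true_and, IsGoodRow, IsBadRow, h3, iff_true]
        exact le_or_gt _ _
      · rw [Finset.disjoint_filter]
        rintro i - ⟨_, h⟩ ⟨_, h'⟩
        exact absurd h (not_le.2 h')
    have h1' : (B.card : ℝ) ≤ c * badCount (devore P N) x δ n := by exact_mod_cast h1
    have h2' : (G.card : ℝ) + B.card = Fintype.card ι := by exact_mod_cast h2
    have h3 := hbad n
    linarith
  · have := card_filter_blockRows (fun j => g (s j)) (devoreRow hP n)
      (IsGoodRow (devore P N) x δ n) fun q c h => (devore_apply_eq_true_iff hP n q c).1 h.1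
    simp only [hG, Finset.mem_filter_univ]
    exact this
  · have := card_filter_blockRows (fun j => g (s j)) (devoreRow hP n)
      (IsBadRow (devore P N) x δ n) fun q c h => (devore_apply_eq_true_iff hP n q c).1 h.1
    simp only [hB, Finset.mem_filter_univ]
    exact this

theorem injective_sum_bits (w : ℕ) :
    Function.Injective fun v : Fin w → Bool => ∑ i : Fin w, if v i then 2 ^ i.val else 0 := by
  intro v v' h
  have e : ∀ v : Fin w → Bool, (∑ i : Fin w, if v i then 2 ^ i.val else 0) =
      (finFunctionFinEquiv fun i => if v i then (1 : Fin 2) else 0).val := by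
    intro v
    rw [finFunctionFinEquiv_apply]
    refine Finset.sum_congr rfl fun i _ => ?_
    cases v i <;> simp
  simp only [e] at h
  have := finFunctionFinEquiv.injective (Fin.ext h)
  funext i
  have hi := congrFun this i
  revert hi
  cases v i <;> cases v' i <;> simp

theorem sum_bits_lt (w : ℕ) (v : Fin w → Bool) :
    (∑ i : Fin w, if v i then 2 ^ i.val else 0) < 2 ^ w := by
  calc (∑ i : Fin w, if v i then 2 ^ i.val else 0) ≤ ∑ i : Fin w, 2 ^ i.val :=
        Finset.sum_le_sum fun i _ => by split_ifs <;> simp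
    _ = ∑ i ∈ Finset.range w, 2 ^ i := (Finset.sum_range (fun i => 2 ^ i)).symm
    _ < 2 ^ w := Nat.geomSum_lt le_rfl (by simp)

/-- The least power of two not below `P` is smaller than `2 P`, so only the numbers `q` and `q + P`
can reduce to `q`. -/
theorem card_blockOfBits_fiber_le (hP : 0 < P) (q : Fin P) :
    (Finset.univ.filter fun v : Fin (Nat.clog 2 P) → Bool => blockOfBits hP v = q).card ≤ 2 := by
  classical
  have hw : 2 ^ Nat.clog 2 P < 2 * P := by
    rcases hP.nat_succ_le.eq_or_lt with h | h
    · rw [← h]; simp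
    · have h1 := Nat.pow_pred_clog_lt_self (b := 2) (by norm_num) h
      have h2 : 0 < Nat.clog 2 P := Nat.clog_pos (by norm_num) h
      calc 2 ^ Nat.clog 2 P = 2 * 2 ^ (Nat.clog 2 P).pred := by
            rw [← pow_succ']; exact congrArg _ (Nat.succ_pred_eq_of_pos h2).symm
        _ < 2 * P := by omega
  rw [← Finset.card_image_of_injective _ (injective_sum_bits (Nat.clog 2 P))]
  refine (Finset.card_le_card (t := {q.val, q.val + P}) fun a ha => ?_).trans Finset.card_le_two
  obtain ⟨v, hv, rfl⟩ := Finset.mem_image.1 ha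
  have h1 := sum_bits_lt _ v
  have h2 : (∑ i, if v i then 2 ^ i.val else 0) % P = q := congrArg Fin.val (Finset.mem_filter.1 hv).2
  simp only [Finset.mem_insert, Finset.mem_singleton]
  set a := ∑ i, if v i then 2 ^ i.val else 0
  have h3 : a / P < 2 := Nat.div_lt_of_lt_mul (by linarith)
  have h4 := Nat.div_add_mod a P
  rw [h2] at h4
  interval_cases h5 : a / P
  · left; omega
  · right; omega

/-! ### Coherence -/

theorem columnOnes_devore (hP : 0 < P) (n : Fin N) : columnOnes (devore P N) n = P := by
  classical
  have := Finset.card_bij (s := (Finset.univ : Finset (Fin P)))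
    (t := Finset.univ.filter fun i => devore P N i n = true) (fun q _ => (q, devoreRow hP n q))
    (fun q _ => Finset.mem_filter.2 ⟨Finset.mem_univ _, (devore_apply_eq_true_iff hP n q _).2 rfl⟩)
    (fun q _ q' _ h => congrArg Prod.fst h) fun i hi =>
      ⟨i.1, Finset.mem_univ _, Prod.ext rfl
        ((devore_apply_eq_true_iff hP n i.1 i.2).1 (Finset.mem_filter.1 hi).2).symm⟩
  rw [columnOnes, ← this, Finset.card_univ, Fintype.card_fin]

theorem eq_of_digits_eq (hP : 1 < P) (j : ℕ) : ∀ l, (∀ i, j / P ^ i % P = l / P ^ i % P) → j = l := by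
  induction j using Nat.strong_induction_on with
  | _ j ih =>
    intro l h
    have h0 := h 0
    simp only [pow_zero, Nat.div_one] at h0
    have hd : ∀ i, j / P / P ^ i % P = l / P / P ^ i % P := by
      intro i
      have := h (i + 1)
      rwa [pow_succ', ← Nat.div_div_eq_div_mul, ← Nat.div_div_eq_div_mul] at this
    rcases Nat.eq_zero_or_pos j with rfl | hj
    · by_contra hl
      have h1 := h (Nat.log P l)
      rw [Nat.zero_div, Nat.zero_mod] at h1
      have h2 : l / P ^ Nat.log P l < P := by
        refine Nat.div_lt_of_lt_mul ?_
        rw [← pow_succ]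
        exact Nat.lt_pow_succ_log_self hP l
      rw [Nat.mod_eq_of_lt h2] at h1
      have h3 := Nat.div_pos (Nat.pow_log_le_self P (Ne.symm hl)) (Nat.pow_pos (by omega))
      omega
    · have := ih (j / P) (Nat.div_lt_self hj hP) (l / P) hd
      rw [← Nat.div_add_mod j P, ← Nat.div_add_mod l P, this, h0]

open Polynomial in
theorem coeff_ofDigits_X {R : Type*} [CommRing R] (L : List ℕ) (i : ℕ) :
    (Nat.ofDigits (X : R[X]) L).coeff i = (L.getD i 0 : ℕ) := by
  induction L generalizing i with
  | nil => simp [Nat.ofDigits]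
  | cons a L ih =>
    rw [Nat.ofDigits, coeff_add]
    cases i with
    | zero => simp
    | succ i => simp [ih, coeff_natCast_ite]

open Polynomial in
theorem eval_ofDigits_X {R : Type*} [CommRing R] (L : List ℕ) (a : R) :
    (Nat.ofDigits (X : R[X]) L).eval a = Nat.ofDigits a L := by
  induction L with
  | nil => simp [Nat.ofDigits]
  | cons b L ih => simp [Nat.ofDigits, ih]

-- An agreement point is a root of the difference polynomial over `ZMod P`. This polynomial is
-- nonzero because distinct numbers differ in some base `P` digit, and its degree is at most `log_P
-- N`.
open Polynomial in
theorem card_ofDigits_eq_le (hP : P.Prime) {j l : ℕ} (hjl : j ≠ l) (hj : j < N) (hl : l < N) :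
    (Finset.univ.filter fun q : Fin P => Nat.ofDigits q.val (Nat.digits P j) % P =
      Nat.ofDigits q.val (Nat.digits P l) % P).card ≤ Nat.log P N := by
  classical
  have := Fact.mk hP
  set p : (ZMod P)[X] := Nat.ofDigits X (Nat.digits P j) - Nat.ofDigits X (Nat.digits P l) with hp
  have hcoeff : ∀ i, p.coeff i = ((j / P ^ i % P : ℕ) : ZMod P) - (l / P ^ i % P : ℕ) := by
    intro i
    rw [hp, coeff_sub, coeff_ofDigits_X, coeff_ofDigits_X, Nat.getD_digits _ _ hP.two_le,
      Nat.getD_digits _ _ hP.two_le]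
  have hp0 : p ≠ 0 := by
    intro h0
    refine hjl (eq_of_digits_eq hP.one_lt j l fun i => ?_)
    have := hcoeff i
    rw [h0, coeff_zero, eq_comm, sub_eq_zero, ZMod.natCast_eq_natCast_iff'] at this
    simpa using this
  have hdeg : p.natDegree ≤ Nat.log P N := by
    rw [natDegree_le_iff_coeff_eq_zero]
    intro i hi
    have hN : N < P ^ i := Nat.lt_pow_of_log_lt hP.one_lt hi
    rw [hcoeff, Nat.div_eq_of_lt (hj.trans hN), Nat.div_eq_of_lt (hl.trans hN), sub_self]
  refine le_trans ?_ ((card_roots' p).trans hdeg)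
  refine le_trans ?_ (Multiset.toFinset_card_le p.roots)
  refine Finset.card_le_card_of_injOn (fun q => ((q.val : ℕ) : ZMod P)) (fun q hq => ?_)
    fun q _ q' _ h => ?_
  · have h := (Finset.mem_filter.1 hq).2
    rw [← ZMod.natCast_eq_natCast_iff', Nat.coe_ofDigits, Nat.coe_ofDigits] at h
    rw [Finset.mem_coe, Multiset.mem_toFinset, mem_roots hp0, IsRoot, hp, eval_sub, eval_ofDigits_X,
      eval_ofDigits_X, h, sub_self]
  · have h' := (ZMod.natCast_eq_natCast_iff' _ _ _).1 h
    rw [Nat.mod_eq_of_lt q.2, Nat.mod_eq_of_lt q'.2] at h'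
    exact Fin.ext h'

/-- A common one of two columns in block `q` is a point of agreement of their polynomials at `q`,
and `q` determines the row. -/
theorem isCoherent_devore (hP : P.Prime) (N : ℕ) : IsCoherent (devore P N) P (Nat.log P N) := by
  classical
  refine ⟨fun n => (columnOnes_devore hP.pos n).ge, fun j l hjl => ?_⟩
  refine le_trans ?_ (card_ofDigits_eq_le hP (fun h => hjl (Fin.ext h)) j.2 l.2)
  refine Finset.card_le_card_of_injOn Prod.fst (fun i hi => ?_) fun i hi i' hi' h => ?_
  · have h := (Finset.mem_filter.1 hi).2
    simp only [devore, decide_eq_true_eq] at h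
    exact Finset.mem_coe.2 (Finset.mem_filter.2 ⟨Finset.mem_univ _, h.1.trans h.2.symm⟩)
  · have e := (devore_apply_eq_true_iff hP.pos j i.1 i.2).1 (Finset.mem_filter.1 hi).2.1
    have e' := (devore_apply_eq_true_iff hP.pos j i'.1 i'.2).1 (Finset.mem_filter.1 hi').2.1
    exact Prod.ext h (by rw [e, e', h])

end DeVore

/-! ## Random coherent matrices -/

section Bernoulli

variable {m N : ℕ}

/-- The probability of `ω` when the entries are independent Bernoulli(`p`) variables. -/
noncomputable def bernWeight (p : ℝ) (ω : Fin m × Fin N → Bool) : ℝ :=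
  ∏ i, if ω i = true then p else 1 - p

open Classical in
/-- The number of rows in which all columns of `J` have a one. -/
noncomputable def commonOnes (J : Finset (Fin N)) (ω : Fin m × Fin N → Bool) : ℕ :=
  (Finset.univ.filter fun i => ∀ n ∈ J, ω (i, n) = true).card

theorem bernWeight_nonneg {p : ℝ} (hp : 0 ≤ p) (hp1 : p ≤ 1) (ω : Fin m × Fin N → Bool) :
    0 ≤ bernWeight p ω :=
  Finset.prod_nonneg fun i _ => by split_ifs <;> linarith

open Classical in
theorem bernLaw_apply {p : ℝ} (hp : 0 ≤ p) (hp1 : p ≤ 1) (E : Set (Fin m × Fin N → Bool)) :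
    bernLaw m N p E = ENNReal.ofReal (∑ ω ∈ Finset.univ.filter (· ∈ E), bernWeight p ω) := by
  have h1 : ∀ ω, bernLaw m N p {ω} = ENNReal.ofReal (bernWeight p ω) := by
    intro ω
    rw [bernLaw, Measure.pi_singleton, bernWeight, ENNReal.ofReal_prod_of_nonneg]
    · refine Finset.prod_congr rfl fun i _ => ?_
      have hproj : Set.projIcc (0 : ℝ) 1 zero_le_one p = ⟨p, hp, hp1⟩ :=
        Set.projIcc_of_mem _ ⟨hp, hp1⟩
      rw [hproj, bernoulliMeasure_apply _ (measurableSet_singleton _)]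
      cases hω : ω i
      · simp [ENNReal.ofReal, unitInterval.toNNReal, Real.toNNReal, hp1]
        rfl
      · simp [ENNReal.ofReal, unitInterval.toNNReal, Real.toNNReal, hp]
        rfl
    · intro i _
      split_ifs <;> linarith
  have hE : E = ⋃ ω ∈ Finset.univ.filter (· ∈ E), {ω} := by ext; simp
  rw [hE, measure_biUnion_finset (fun a _ b _ h => Set.disjoint_singleton.2 h)
    (fun _ _ => measurableSet_singleton _), ← hE, ENNReal.ofReal_sum_of_nonneg fun ω _ =>
    bernWeight_nonneg hp hp1 ω]
  exact Finset.sum_congr rfl fun ω _ => h1 ω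

/-- The rows are independent and identically distributed, so the expectation of a product over the
rows is the `m`-th power of the expectation for one row. -/
theorem sum_bernWeight_mul_prod (p : ℝ) (g : (Fin N → Bool) → ℝ) :
    ∑ ω : Fin m × Fin N → Bool, bernWeight p ω * ∏ i, g (fun n => ω (i, n)) =
      (∑ r : Fin N → Bool, (∏ n, if r n = true then p else 1 - p) * g r) ^ m := by
  rw [Fintype.sum_pow, ← (Equiv.curry (Fin m) (Fin N) Bool).sum_comp]
  refine Finset.sum_congr rfl fun ω _ => ?_
  rw [bernWeight, Fintype.prod_prod_type, ← Finset.prod_mul_distrib]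
  rfl

open Classical in
theorem sum_row_weight (p : ℝ) (J : Finset (Fin N)) :
    ∑ r : Fin N → Bool, (∏ n, if r n = true then p else 1 - p) *
      (if ∀ n ∈ J, r n = true then 1 else 0) = p ^ J.card := by
  have h1 : ∀ r : Fin N → Bool, (∏ n, if r n = true then p else 1 - p) *
      (if ∀ n ∈ J, r n = true then 1 else 0) =
      ∏ n, (if r n = true then p else if n ∈ J then 0 else 1 - p) := by
    intro r
    split_ifs with h
    · rw [mul_one]
      refine Finset.prod_congr rfl fun n _ => ?_
      by_cases hn : n ∈ J
      · simp [h n hn]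
      · simp [hn]
    · push Not at h
      obtain ⟨n, hn, hr⟩ := h
      rw [mul_zero]
      exact (Finset.prod_eq_zero (Finset.mem_univ n) (by simp [hn, hr])).symm
  simp only [h1]
  have h2 := Finset.prod_univ_sum (fun _ : Fin N => (Finset.univ : Finset Bool))
    (fun n b => if b = true then p else if n ∈ J then 0 else 1 - p)
  rw [Fintype.piFinset_univ] at h2
  rw [← h2]
  have h3 : ∀ n : Fin N, ∑ b : Bool, (if b = true then p else if n ∈ J then 0 else 1 - p) =
      if n ∈ J then p else 1 := by
    intro n
    split_ifs <;> simp
  simp only [h3, Finset.prod_ite_mem, Finset.univ_inter, Finset.prod_const]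

theorem sum_bernWeight (p : ℝ) : ∑ ω : Fin m × Fin N → Bool, bernWeight p ω = 1 := by
  have h := sum_bernWeight_mul_prod (m := m) (N := N) p fun _ => 1
  have h' := sum_row_weight (N := N) p ∅
  simp only [Finset.notMem_empty, false_imp_iff, implies_true, if_true, Finset.card_empty,
    pow_zero] at h'
  simp only [mul_one] at h'
  simpa only [Finset.prod_const_one, mul_one, h', one_pow] using h

/-- A row has ones in all columns of `J` with probability `p ^ J.card`, so `commonOnes J` is
binomial; this is its generating function. -/
theorem sum_bernWeight_mul_pow (p u : ℝ) (J : Finset (Fin N)) :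
    ∑ ω : Fin m × Fin N → Bool, bernWeight p ω * u ^ commonOnes J ω =
      (1 + (u - 1) * p ^ J.card) ^ m := by
  classical
  have h := sum_bernWeight_mul_prod (m := m) (N := N) p
    fun r => if ∀ n ∈ J, r n = true then u else 1
  have h1 : ∀ ω : Fin m × Fin N → Bool,
      (∏ i, if ∀ n ∈ J, ω (i, n) = true then u else 1) = u ^ commonOnes J ω := by
    intro ω
    rw [Finset.prod_ite]
    simp [commonOnes]
  simp only [h1] at h
  rw [h]
  congr 1
  have h2 : ∀ r : Fin N → Bool, (∏ n, if r n = true then p else 1 - p) *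
      (if ∀ n ∈ J, r n = true then u else 1) = (∏ n, if r n = true then p else 1 - p) *
      (if ∀ n ∈ (∅ : Finset (Fin N)), r n = true then 1 else 0) +
      (u - 1) * ((∏ n, if r n = true then p else 1 - p) *
      (if ∀ n ∈ J, r n = true then 1 else 0)) := by
    intro r
    simp only [Finset.notMem_empty, false_imp_iff, implies_true, if_true]
    split_ifs <;> ring
  simp only [h2, Finset.sum_add_distrib, ← Finset.mul_sum, sum_row_weight]
  simp

-- Markov's inequality for `u ^ commonOnes J`. One proof serves both tails: `u > 1` for too many
-- ones, `u < 1` for too few.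
open Classical in
theorem sum_bernWeight_tail_le {p u v : ℝ} (hp : 0 ≤ p) (hp1 : p ≤ 1) (hu : 0 < u)
    (J : Finset (Fin N)) (E : (Fin m × Fin N → Bool) → Prop)
    (hE : ∀ ω, E ω → Real.exp v ≤ u ^ commonOnes J ω) :
    ∑ ω ∈ Finset.univ.filter E, bernWeight p ω ≤
      Real.exp ((u - 1) * p ^ J.card * m - v) := by
  rw [Real.exp_sub, le_div_iff₀ (Real.exp_pos _)]
  calc (∑ ω ∈ Finset.univ.filter E, bernWeight p ω) * Real.exp v
      = ∑ ω ∈ Finset.univ.filter E, bernWeight p ω * Real.exp v := by rw [Finset.sum_mul]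
    _ ≤ ∑ ω ∈ Finset.univ.filter E, bernWeight p ω * u ^ commonOnes J ω :=
        Finset.sum_le_sum fun ω hω =>
          mul_le_mul_of_nonneg_left (hE ω (Finset.mem_filter.1 hω).2) (bernWeight_nonneg hp hp1 ω)
    _ ≤ ∑ ω, bernWeight p ω * u ^ commonOnes J ω :=
        Finset.sum_le_sum_of_subset_of_nonneg (Finset.filter_subset _ _) fun ω _ _ =>
          mul_nonneg (bernWeight_nonneg hp hp1 ω) (by positivity)
    _ = (1 + (u - 1) * p ^ J.card) ^ m := sum_bernWeight_mul_pow p u J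
    _ ≤ Real.exp ((u - 1) * p ^ J.card) ^ m := by
        refine pow_le_pow_left₀ ?_ (by linarith [Real.add_one_le_exp ((u - 1) * p ^ J.card)]) m
        have h1 : p ^ J.card ≤ 1 := pow_le_one₀ hp hp1
        have h2 : 0 ≤ p ^ J.card := by positivity
        nlinarith
    _ = _ := by rw [← Real.exp_nat_mul]; ring_nf

open Classical in
theorem sum_bernWeight_upper_le {p h : ℝ} (hp : 0 ≤ p) (hp1 : p ≤ 1) (J : Finset (Fin N)) :
    ∑ ω : Fin m × Fin N → Bool with h ≤ commonOnes J ω, bernWeight p ω ≤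
      Real.exp (p ^ J.card * m - h * Real.log 2) := by
  have := sum_bernWeight_tail_le (m := m) (u := 2) (v := h * Real.log 2) hp hp1 (by norm_num) J
    (fun ω => h ≤ commonOnes J ω) fun ω hω => by
      rw [← Real.rpow_natCast, Real.rpow_def_of_pos (by norm_num), Real.exp_le_exp, mul_comm]
      exact mul_le_mul_of_nonneg_left hω (Real.log_nonneg (by norm_num))
  norm_num at this ⊢
  exact this

-- The choice `u = exp (-s)` with `s = (μ - K) / μ` minimises the quadratic upper bound for the
-- exponent.
open Classical in
theorem sum_bernWeight_lower_le {p μ K : ℝ} (hp : 0 ≤ p) (hp1 : p ≤ 1) (hK : K ≤ μ) (hμ : 0 < μ)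
    (hm : μ ≤ m * p) (n : Fin N) :
    ∑ ω : Fin m × Fin N → Bool with commonOnes {n} ω ≤ K, bernWeight p ω ≤
      Real.exp (-((μ - K) ^ 2 / (2 * μ))) := by
  set s := (μ - K) / μ with hs
  have hs0 : 0 ≤ s := div_nonneg (by linarith) hμ.le
  have := sum_bernWeight_tail_le (m := m) (u := Real.exp (-s)) (v := -s * K) hp hp1 (Real.exp_pos _)
    {n} (fun ω => (commonOnes {n} ω : ℝ) ≤ K) fun ω hω => by
      rw [← Real.exp_nat_mul, Real.exp_le_exp]
      nlinarith
  refine this.trans (Real.exp_le_exp.2 ?_)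
  -- This follows from `exp s ≥ 1 + s + s²/2` and `(1 + s + s²/2) (1 - s + s²/2) = 1 + s⁴/4`.
  have h1 : Real.exp (-s) ≤ 1 - s + s ^ 2 / 2 := by
    have h2 : 0 < 1 + s + s ^ 2 / 2 := by positivity
    rw [Real.exp_neg]
    refine (inv_anti₀ h2 (Real.quadratic_le_exp_of_nonneg hs0)).trans ?_
    rw [inv_le_iff_one_le_mul₀ h2]
    nlinarith [sq_nonneg (s ^ 2)]
  have h3 : Real.exp (-s) ≤ 1 := Real.exp_le_one_iff.2 (by linarith)
  have e1 : (μ - K) ^ 2 / (2 * μ) = s * (μ - K) - s ^ 2 / 2 * μ := by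
    rw [hs]; field_simp; ring
  rw [e1, Finset.card_singleton, pow_one]
  have e2 : (Real.exp (-s) - 1) * p * m ≤ (Real.exp (-s) - 1) * μ := by nlinarith
  nlinarith

end Bernoulli

/-! ### Parameters of the random matrices -/

section BernoulliParameters

variable {N : ℕ} {τ κ t : ℝ}

theorem one_lt_log_three : 1 < Real.log 3 := by
  rw [Real.lt_log_iff_exp_lt (by norm_num)]
  linarith [Real.exp_one_lt_d9]

theorem log_four_div_exp : Real.log (4 / Real.exp 1) = 2 * Real.log 2 - 1 := by
  rw [Real.log_div (by norm_num) (Real.exp_pos _).ne', Real.log_exp,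
    show (4 : ℝ) = 2 ^ 2 by norm_num, Real.log_pow]
  norm_num

theorem log_four_div_exp_pos : 0 < Real.log (4 / Real.exp 1) := by
  rw [log_four_div_exp]
  linarith [Real.log_two_gt_d9]

theorem one_le_log_three_mul (hN : 1 ≤ N) (hτ : 0 ≤ τ) (hτ1 : τ < 1) :
    1 ≤ Real.log (3 * N / (1 - τ)) := by
  refine one_lt_log_three.le.trans (Real.log_le_log (by norm_num) ?_)
  have hN' : (1 : ℝ) ≤ N := by exact_mod_cast hN
  rw [le_div_iff₀ (by linarith)]
  nlinarith

theorem log_le_bernLogTerm (hN : 1 ≤ N) (hτ : 0 ≤ τ) (hτ1 : τ < 1) :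
    Real.log (3 * N / (1 - τ)) ≤ bernLogTerm N τ := by
  have hN' : (1 : ℝ) ≤ N := by exact_mod_cast hN
  have h1 : 0 < 1 - τ := by linarith
  have h2 : Real.log (3 * N / (1 - τ)) ≤ Real.log (3 * (N : ℝ) ^ 2 / (1 - τ)) := by
    refine Real.log_le_log (by positivity) ?_
    gcongr
    nlinarith
  have h3 := one_le_log_three_mul hN hτ hτ1
  rw [bernLogTerm, Real.logb, le_div_iff₀ log_four_div_exp_pos]
  have h4 : Real.log (4 / Real.exp 1) ≤ 1 := by
    rw [log_four_div_exp]
    linarith [Real.log_two_lt_d9]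
  nlinarith

theorem le_bernK (hκ : 0 ≤ κ) (ht : 0 ≤ t) : κ * t * (2 * bernLogTerm N τ) ≤ bernK κ t N τ :=
  (mul_le_mul_of_nonneg_left (Nat.le_ceil _) (mul_nonneg hκ ht)).trans (Nat.le_ceil _)

theorem bernLogTerm_le_bernK (hN : 1 ≤ N) (hτ : 0 ≤ τ) (hτ1 : τ < 1) (hκ : 10 ≤ κ) (ht : 1 ≤ t) :
    20 * bernLogTerm N τ ≤ bernK κ t N τ := by
  have h1 := log_le_bernLogTerm hN hτ hτ1
  have h2 := one_le_log_three_mul hN hτ hτ1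
  refine le_trans ?_ (le_bernK (by linarith) (by linarith))
  have h3 : 10 ≤ κ * t := by nlinarith
  nlinarith

theorem bernMean_le {K : ℕ} {N : ℕ} (hN : 1 ≤ N) (hτ : 0 ≤ τ) (hτ1 : τ < 1)
    (hK : Real.log (3 * N / (1 - τ)) ≤ K) : bernMean N K τ ≤ 4 * K := by
  have h2 := one_le_log_three_mul hN hτ hτ1
  have h3 : √(2 * K * Real.log (3 * N / (1 - τ)) + Real.log (3 * N / (1 - τ)) ^ 2) ≤ 2 * K := by
    refine Real.sqrt_le_iff.2 ⟨by positivity, ?_⟩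
    nlinarith
  rw [bernMean]
  linarith

theorem le_bernMean (K : ℕ) {N : ℕ} (hN : 1 ≤ N) (hτ : 0 ≤ τ) (hτ1 : τ < 1) :
    (K : ℝ) ≤ bernMean N K τ := by
  have h2 := one_le_log_three_mul hN hτ hτ1
  have := Real.sqrt_nonneg (2 * K * Real.log (3 * N / (1 - τ)) + Real.log (3 * N / (1 - τ)) ^ 2)
  rw [bernMean]
  linarith

/-- The mean `μ` is defined as a root of this equation so that the lower tail bound `exp (-(μ - K)²
/ (2 μ))` is exactly `(1 - τ) / (3 N)`. -/
theorem bernMean_sub_sq (K : ℕ) {N : ℕ} (hN : 1 ≤ N) (hτ : 0 ≤ τ) (hτ1 : τ < 1) :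
    (bernMean N K τ - K) ^ 2 = 2 * Real.log (3 * N / (1 - τ)) * bernMean N K τ := by
  have h2 := one_le_log_three_mul hN hτ hτ1
  have := Real.sq_sqrt (x := 2 * K * Real.log (3 * N / (1 - τ)) + Real.log (3 * N / (1 - τ)) ^ 2)
    (by positivity)
  rw [bernMean]
  nlinarith

/-- A column has `m p ≈ μ` ones on average and a pair of columns shares `m p² ≈ l` rows. Too few
ones in a column, too many ones in a column, and too many common ones in a pair each occur somewhere
with probability at most `(1 - τ) / 3`. -/
theorem ofReal_le_bernLaw (hN : 1 ≤ N) (hτ : 0 ≤ τ) (hτ1 : τ < 1) (hκ : 10 ≤ κ) (ht : 1 ≤ t)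
    {α K m : ℕ} (hα : α = bernAlpha N τ) (hK : K = bernK κ t N τ) (hm : m = bernRows N K τ) :
    ENNReal.ofReal τ ≤ bernLaw m N (bernProb N K τ)
      {ω | IsBalancedCoherent κ (Matrix.of fun i j => ω (i, j)) K α} := by
  classical
  set l := bernLogTerm N τ with hl
  set μ := bernMean N K τ with hμ
  set lam := Real.log (3 * N / (1 - τ)) with hlam
  have hN' : (1 : ℝ) ≤ N := by exact_mod_cast hN
  have hτ' : 0 < 1 - τ := by linarith
  have hlam1 : 1 ≤ lam := one_le_log_three_mul hN hτ hτ1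
  have hll : lam ≤ l := log_le_bernLogTerm hN hτ hτ1
  have hlK : 20 * l ≤ K := hK ▸ bernLogTerm_le_bernK hN hτ hτ1 hκ ht
  have hμK : μ ≤ 4 * K := bernMean_le hN hτ hτ1 (by linarith)
  have hKμ : (K : ℝ) ≤ μ := le_bernMean K hN hτ hτ1
  have hl0 : 0 < l := by linarith
  have hμ0 : 0 < μ := by linarith
  have hp : bernProb N K τ = l / μ := rfl
  set p := bernProb N K τ with hpdef
  have hp0 : 0 ≤ p := by rw [hp]; positivity
  have hp1 : p ≤ 1 / 20 := by rw [hp, div_le_iff₀ hμ0]; linarith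
  have hpμ : p * μ = l := by rw [hp]; field_simp
  have hm1 : μ ≤ m * p := by
    have h1 : μ ^ 2 / l ≤ m := by rw [hm]; exact Nat.le_ceil _
    have h2 := mul_le_mul_of_nonneg_right h1 hp0
    have e : μ ^ 2 / l * p = μ := by rw [hp]; field_simp
    linarith
  have hm2 : m * p ≤ μ + p := by
    have h1 : (m : ℝ) ≤ μ ^ 2 / l + 1 := by
      rw [hm]; exact (Nat.ceil_lt_add_one (by positivity)).le
    have h2 := mul_le_mul_of_nonneg_right h1 hp0
    have e : μ ^ 2 / l * p = μ := by rw [hp]; field_simp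
    linarith
  have hlog2 := Real.log_two_gt_d9
  have hcol : ∀ (ω : Fin m × Fin N → Bool) (j : Fin N),
      columnOnes (Matrix.of fun i j => ω (i, j)) j = commonOnes {j} ω := by
    intro ω j
    rw [columnOnes, commonOnes]
    congr 1
    ext i
    rw [Finset.mem_filter, Finset.mem_filter]
    simp
  have hpair : ∀ (ω : Fin m × Fin N → Bool) (j l : Fin N),
      (Finset.univ.filter (fun i => (Matrix.of fun i j => ω (i, j)) i j = true ∧
        (Matrix.of fun i j => ω (i, j)) i l = true)).card = commonOnes {j, l} ω := by
    intro ω j l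
    rw [commonOnes]
    congr 1
    ext i
    rw [Finset.mem_filter, Finset.mem_filter]
    simp
  have hA : ∀ j : Fin N, ∑ ω : Fin m × Fin N → Bool with (commonOnes {j} ω : ℝ) ≤ K,
      bernWeight p ω ≤ (1 - τ) / (3 * N) := by
    intro j
    refine (sum_bernWeight_lower_le hp0 (by linarith) hKμ hμ0 hm1 j).trans_eq ?_
    have e : (μ - K) ^ 2 / (2 * μ) = lam := by
      rw [bernMean_sub_sq K hN hτ hτ1, ← hμ, ← hlam]; field_simp
    rw [e, Real.exp_neg, hlam, Real.exp_log (by positivity), inv_div]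
  have hB : ∀ j : Fin N, ∑ ω : Fin m × Fin N → Bool with κ * K ≤ commonOnes {j} ω,
      bernWeight p ω ≤ (1 - τ) / (3 * N) := by
    intro j
    refine (sum_bernWeight_upper_le hp0 (by linarith) {j}).trans ?_
    have e : (1 - τ) / (3 * N) = Real.exp (-lam) := by
      rw [Real.exp_neg, hlam, Real.exp_log (by positivity), inv_div]
    rw [e, Real.exp_le_exp, Finset.card_singleton, pow_one]
    -- As `m p ≤ μ + p ≤ 4 K + 1/20`, a margin of almost `2 K` remains in the exponent, and `K ≥ 20
    -- l ≥ 20 lam`.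
    have h1 : 6 * K ≤ κ * K * Real.log 2 := by
      have : 6 ≤ κ * Real.log 2 := by nlinarith
      nlinarith
    linarith
  have hC : ∀ j l : Fin N, j ≠ l → ∑ ω : Fin m × Fin N → Bool with (α + 1 : ℝ) ≤ commonOnes {j, l} ω,
      bernWeight p ω ≤ (1 - τ) / (3 * N ^ 2) := by
    intro j i hji
    refine (sum_bernWeight_upper_le hp0 (by linarith) {j, i}).trans ?_
    have e : (1 - τ) / (3 * N ^ 2) = Real.exp (-(l * Real.log (4 / Real.exp 1))) := by
      rw [hl, bernLogTerm, Real.logb, div_mul_cancel₀ _ log_four_div_exp_pos.ne', Real.exp_neg,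
        Real.exp_log (by positivity), inv_div]
    rw [e, Real.exp_le_exp, Finset.card_pair hji, log_four_div_exp]
    -- The bound `exp (l - 2 l ln 2) = (4 / e) ^ (-l)` is what dictates the base `4 / e` of the
    -- logarithm. Exceeding `α` means at least `α + 1` common ones, and this extra one absorbs the
    -- rounding of `m`.
    have h1 : 2 * l ≤ α := by rw [hα]; exact Nat.le_ceil _
    have h2 : p ^ 2 * m ≤ l + p ^ 2 := by nlinarith
    nlinarith
  have hfail : ∑ ω : Fin m × Fin N → Bool with
      ω ∉ {ω | IsBalancedCoherent κ (Matrix.of fun i j => ω (i, j)) K α}, bernWeight p ω ≤ 1 - τ := by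
    have hpt : ∀ ω : Fin m × Fin N → Bool,
        (if ω ∉ {ω | IsBalancedCoherent κ (Matrix.of fun i j => ω (i, j)) K α}
          then bernWeight p ω else 0) ≤
        ∑ j : Fin N, (if (commonOnes {j} ω : ℝ) ≤ K then bernWeight p ω else 0) +
        ∑ j : Fin N, (if κ * K ≤ commonOnes {j} ω then bernWeight p ω else 0) +
        ∑ q : Fin N × Fin N with q.1 ≠ q.2,
          (if (α + 1 : ℝ) ≤ commonOnes {q.1, q.2} ω then bernWeight p ω else 0) := by
      intro ω
      have hw := bernWeight_nonneg hp0 (by linarith) ω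
      have h0 : ∀ (c : Prop), 0 ≤ if c then bernWeight p ω else 0 := fun c => by split_ifs <;> simp [hw]
      have s1 := Finset.sum_nonneg fun (j : Fin N) (_ : j ∈ Finset.univ) =>
        h0 ((commonOnes {j} ω : ℝ) ≤ K)
      have s2 := Finset.sum_nonneg fun (j : Fin N) (_ : j ∈ Finset.univ) =>
        h0 (κ * K ≤ commonOnes {j} ω)
      have s3 := Finset.sum_nonneg fun (q : Fin N × Fin N)
        (_ : q ∈ Finset.univ.filter fun q : Fin N × Fin N => q.1 ≠ q.2) =>
        h0 ((α + 1 : ℝ) ≤ commonOnes {q.1, q.2} ω)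
      by_cases hω : ω ∈ {ω | IsBalancedCoherent κ (Matrix.of fun i j => ω (i, j)) K α}
      · rw [if_neg (not_not.2 hω)]
        linarith
      · rw [if_pos hω]
        simp only [Set.mem_ofPred_eq, IsBalancedCoherent, IsCoherent, hcol, hpair] at hω
        by_cases c1 : ∀ j, K ≤ commonOnes {j} ω
        · by_cases c2 : ∀ j, (commonOnes {j} ω : ℝ) ≤ κ * K
          · have c3 : ¬ ∀ j l, j ≠ l → commonOnes {j, l} ω ≤ α := fun c3 => hω ⟨⟨c1, c3⟩, c2⟩
            push Not at c3
            obtain ⟨j, i, hji, hlt⟩ := c3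
            have := Finset.single_le_sum (s := Finset.univ.filter
              fun q : Fin N × Fin N => q.1 ≠ q.2) (f := fun q : Fin N × Fin N =>
              if (α + 1 : ℝ) ≤ commonOnes {q.1, q.2} ω then bernWeight p ω else 0)
              (fun q _ => h0 _) (Finset.mem_filter.2 ⟨Finset.mem_univ (j, i), hji⟩)
            rw [if_pos (by exact_mod_cast hlt)] at this
            linarith
          · push Not at c2
            obtain ⟨j, hj⟩ := c2
            have := Finset.single_le_sum (f := fun j : Fin N =>
              if κ * K ≤ commonOnes {j} ω then bernWeight p ω else 0)
              (fun q _ => h0 _) (Finset.mem_univ j)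
            rw [if_pos hj.le] at this
            linarith
        · push Not at c1
          obtain ⟨j, hj⟩ := c1
          have := Finset.single_le_sum (f := fun j : Fin N =>
            if (commonOnes {j} ω : ℝ) ≤ K then bernWeight p ω else 0)
            (fun q _ => h0 _) (Finset.mem_univ j)
          rw [if_pos (by exact_mod_cast hj.le)] at this
          linarith
    rw [Finset.sum_filter]
    refine (Finset.sum_le_sum fun ω _ => hpt ω).trans ?_
    have t1 := Finset.sum_le_sum fun (j : Fin N) (_ : j ∈ Finset.univ) => hA j
    have t2 := Finset.sum_le_sum fun (j : Fin N) (_ : j ∈ Finset.univ) => hB j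
    have t3 := Finset.sum_le_sum fun (q : Fin N × Fin N)
      (hq : q ∈ Finset.univ.filter fun q : Fin N × Fin N => q.1 ≠ q.2) =>
      hC q.1 q.2 (Finset.mem_filter.1 hq).2
    have t4 : ∑ q : Fin N × Fin N with q.1 ≠ q.2, (1 - τ) / (3 * (N : ℝ) ^ 2) ≤ (1 - τ) / 3 := by
      rw [Finset.sum_const, nsmul_eq_mul]
      have hc : ((Finset.univ.filter fun q : Fin N × Fin N => q.1 ≠ q.2).card : ℝ) ≤ N ^ 2 := by
        have := Finset.card_le_univ (Finset.univ.filter fun q : Fin N × Fin N => q.1 ≠ q.2)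
        rw [Fintype.card_prod, Fintype.card_fin] at this
        rw [sq]
        exact_mod_cast this
      calc _ ≤ (N : ℝ) ^ 2 * ((1 - τ) / (3 * (N : ℝ) ^ 2)) := by gcongr
        _ = _ := by field_simp
    have e : (N : ℝ) * ((1 - τ) / (3 * N)) = (1 - τ) / 3 := by field_simp
    simp only [Finset.sum_const, Finset.card_univ, Fintype.card_fin, nsmul_eq_mul, e] at t1 t2
    simp only [Finset.sum_filter _ (bernWeight p)] at t1 t2 t3
    rw [Finset.sum_add_distrib, Finset.sum_add_distrib]
    refine (add_le_add (add_le_add (Finset.sum_comm.trans_le t1) (Finset.sum_comm.trans_le t2))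
      (Finset.sum_comm.trans_le (t3.trans t4))).trans (by linarith)
  rw [bernLaw_apply hp0 (by linarith)]
  refine ENNReal.ofReal_le_ofReal ?_
  have := Finset.sum_filter_add_sum_filter_not Finset.univ
    (fun ω => ω ∈ {ω : Fin m × Fin N → Bool | IsBalancedCoherent κ (Matrix.of fun i j => ω (i, j)) K α})
    (bernWeight p)
  rw [sum_bernWeight] at this
  linarith

end BernoulliParameters

/-! ## Sizes of the parameters -/

section Parameters

variable {N : ℕ} {t σ τ c₀ : ℝ}

theorem half_le_log_two : 1 / 2 ≤ Real.log 2 := by linarith [Real.log_two_gt_d9]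

theorem half_le_log_natCast (hN : 2 ≤ N) : 1 / 2 ≤ Real.log N :=
  half_le_log_two.trans (Real.log_le_log (by norm_num) (by exact_mod_cast hN))

theorem one_le_log_one_div (hσ : 2 / 3 ≤ σ) (hσ1 : σ < 1) : 1 ≤ Real.log (1 / (1 - σ)) := by
  refine one_lt_log_three.le.trans (Real.log_le_log (by norm_num) ?_)
  rw [le_div_iff₀ (by linarith)]
  linarith

theorem log_div_one_sub {q : ℝ} (hq : 0 < q) (hσ1 : σ < 1) :
    Real.log (q / (1 - σ)) = Real.log q + Real.log (1 / (1 - σ)) := by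
  rw [← Real.log_mul hq.ne' (by have : 0 < 1 - σ := by linarith
                                positivity), mul_one_div]

theorem half_le_log_max (t : ℝ) : 1 / 2 ≤ Real.log (max 2 t) :=
  half_le_log_two.trans (Real.log_le_log (by norm_num) (le_max_left _ _))

theorem log_le_log_max (ht : 1 ≤ t) : Real.log t ≤ Real.log (max 2 t) :=
  Real.log_le_log (by linarith) (le_max_right _ _)

theorem log_max_le (ht : 1 ≤ t) : Real.log (max 2 t) ≤ t := by
  rcases le_total 2 t with h | h
  · rw [max_eq_right h]
    linarith [Real.log_le_sub_one_of_pos (show 0 < t by linarith)]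
  · rw [max_eq_left h]
    linarith [Real.log_two_lt_d9]

theorem log_max_mul_one_add_logBase (t σ : ℝ) :
    Real.log (max 2 t) * (1 + logBase t (1 / (1 - σ))) =
      Real.log (max 2 t) + Real.log (1 / (1 - σ)) := by
  have := half_le_log_max t
  rw [logBase, Real.logb]
  field_simp

theorem one_le_one_add_logBase (hσ : 2 / 3 ≤ σ) (hσ1 : σ < 1) :
    1 ≤ 1 + logBase t (1 / (1 - σ)) := by
  have h1 := half_le_log_max t
  have h2 := one_le_log_one_div hσ hσ1
  have : 0 ≤ logBase t (1 / (1 - σ)) := div_nonneg (by linarith) (by linarith)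
  linarith

theorem sampleSize_le {ρ q : ℝ} (hρ : 0 ≤ ρ) (hq : 1 ≤ q) (hσ : 2 / 3 ≤ σ) (hσ1 : σ < 1) :
    (sampleSize 100 ρ q σ : ℝ) ≤ 100 * ρ * (1 + Real.log (q / (1 - σ))) + 1 := by
  have h1 := log_two_mul_div_nonneg hσ hσ1 hq
  have h2 : Real.log (2 * q / (1 - σ)) = Real.log 2 + Real.log (q / (1 - σ)) := by
    have : 0 < 1 - σ := by linarith
    rw [← Real.log_mul (by norm_num) (by positivity), mul_div_assoc]
  refine (Nat.ceil_lt_add_one (by positivity)).le.trans ?_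
  rw [h2]
  have := Real.log_two_lt_d9
  gcongr
  linarith

theorem one_le_sampleSize {ρ q : ℝ} (hρ : 1 ≤ ρ) (hq : 1 ≤ q) (hσ : 2 / 3 ≤ σ) (hσ1 : σ < 1) :
    1 ≤ sampleSize 100 ρ q σ := by
  refine Nat.one_le_ceil_iff.2 ?_
  have : 0 < Real.log (2 * q / (1 - σ)) := by
    refine Real.log_pos ?_
    rw [lt_div_iff₀ (by linarith)]
    linarith
  positivity

theorem sampleSize_one_le (ht : 1 ≤ t) (hσ : 2 / 3 ≤ σ) (hσ1 : σ < 1) :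
    (sampleSize 100 1 t σ : ℝ) ≤ 300 * (Real.log (max 2 t) + Real.log (1 / (1 - σ))) := by
  have h1 := sampleSize_le zero_le_one ht hσ hσ1
  rw [log_div_one_sub (by linarith) hσ1] at h1
  have h2 := log_le_log_max ht
  have h3 := one_le_log_one_div hσ hσ1
  have h4 := half_le_log_max t
  linarith

/-! ### The primes -/

theorem le_prime {P : ℕ} (hP : devoreScale 100 t N ≤ P) :
    100 * t * Real.log N / Real.log (max 2 t) ≤ P := by
  refine le_trans ?_ (Nat.cast_le.2 hP)
  rw [mul_div_assoc]
  exact Nat.le_ceil _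

/-- Since `ln T ≤ t`, the scale is at least `1` before rounding. So the ceiling at most doubles it,
and the range allowed for `P` doubles it again. -/
theorem prime_le {P : ℕ} (hN : 2 ≤ N) (ht : 1 ≤ t) (hP : P ≤ 2 * devoreScale 100 t N) :
    (P : ℝ) ≤ 400 * t * Real.log N / Real.log (max 2 t) := by
  have h1 := half_le_log_natCast hN
  have h2 := half_le_log_max t
  have h3 := log_max_le ht
  have h4 : 1 ≤ 100 * t * Real.log N / Real.log (max 2 t) := by
    rw [le_div_iff₀ (by linarith)]
    nlinarith
  have h5 : (P : ℝ) ≤ 2 * devoreScale 100 t N := by exact_mod_cast hP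
  have h6 : (devoreScale 100 t N : ℝ) ≤ 100 * t * Real.log N / Real.log (max 2 t) + 1 := by
    have e : 100 * t * logBase t N = 100 * t * Real.log N / Real.log (max 2 t) := by
      rw [logBase, Real.logb, mul_div_assoc]
    rw [devoreScale, e]
    exact (Nat.ceil_lt_add_one (by linarith)).le
  have e : 400 * t * Real.log N / Real.log (max 2 t) =
    4 * (100 * t * Real.log N / Real.log (max 2 t)) := by ring
  linarith

/-- From `ln T ≤ 2 √T` and `T ≤ 2 t` follows `P ≥ √T`. Thus logarithms to base `P` exceed those to
base `T` by at most a factor 2, without any relation between `k` and `ln N`. -/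
theorem half_log_max_le_log_prime {P : ℕ} (hN : 2 ≤ N) (ht : 1 ≤ t)
    (hP : devoreScale 100 t N ≤ P) : Real.log (max 2 t) / 2 ≤ Real.log P := by
  have h1 := half_le_log_natCast hN
  have h2 := half_le_log_max t
  have hT : (0 : ℝ) < max 2 t := by positivity
  have h3 : √(max 2 t) ≤ P := by
    refine le_trans ?_ (le_prime hP)
    rw [le_div_iff₀ (by linarith)]
    have h4 : Real.log (max 2 t) ≤ 2 * √(max 2 t) := by
      have := Real.log_le_sub_one_of_pos (Real.sqrt_pos.2 hT)
      rw [Real.log_sqrt hT.le] at this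
      linarith
    have h5 : max 2 t ≤ 2 * t := max_le (by linarith) (by linarith)
    have h6 := Real.mul_self_sqrt hT.le
    have h7 := Real.sqrt_nonneg (max 2 t)
    nlinarith
  rw [← Real.log_sqrt hT.le]
  exact Real.log_le_log (Real.sqrt_pos.2 hT) h3

theorem natLog_prime_le {P : ℕ} (hN : 2 ≤ N) (ht : 1 ≤ t) (hP : devoreScale 100 t N ≤ P) :
    (Nat.log P N : ℝ) ≤ 2 * logBase t N := by
  have h1 := half_log_max_le_log_prime hN ht hP
  have h2 := half_le_log_max t
  have h3 := half_le_log_natCast hN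
  refine (Real.natLog_le_logb N P).trans ?_
  rw [logBase, Real.logb, Real.logb, div_le_iff₀ (by linarith), mul_div_assoc', div_mul_eq_mul_div,
    le_div_iff₀ (by linarith)]
  nlinarith

theorem clog_two_le {n : ℕ} (hn : 2 ≤ n) : (Nat.clog 2 n : ℝ) ≤ 4 * Real.log n := by
  have h1 := half_le_log_natCast hn
  have h2 := Nat.pow_pred_clog_lt_self (b := 2) (by norm_num) (show 1 < n by omega)
  have h3 : ((Nat.clog 2 n).pred : ℝ) * Real.log 2 ≤ Real.log n := by
    rw [← Real.log_pow]
    exact Real.log_le_log (by positivity) (by exact_mod_cast h2.le)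
  have h4 : 0 < Nat.clog 2 n := Nat.clog_pos (by norm_num) hn
  have h5 : ((Nat.clog 2 n).pred : ℝ) + 1 = Nat.clog 2 n := by
    exact_mod_cast Nat.succ_pred_eq_of_pos h4
  have h6 := half_le_log_two
  have h7 : (0 : ℝ) ≤ (Nat.clog 2 n).pred := Nat.cast_nonneg _
  nlinarith

theorem one_add_clog_two_le {n : ℕ} (hn : 2 ≤ n) : (1 + Nat.clog 2 n : ℝ) ≤ 6 * Real.log n := by
  linarith [clog_two_le hn, half_le_log_natCast hn]

/-- The number of blocks is of order `ln T + ln (1 / (1 - σ)) = ln T · f`, and the factor `ln T`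
cancels against the denominator in the bound for `P`. -/
theorem blocks_mul_prime_le {P : ℕ} (hN : 2 ≤ N) (ht : 1 ≤ t) (hσ : 2 / 3 ≤ σ) (hσ1 : σ < 1)
    (hP : P ≤ 2 * devoreScale 100 t N) :
    (sampleSize 100 1 t σ : ℝ) * P ≤
      120000 * t * Real.log N * (1 + logBase t (1 / (1 - σ))) := by
  have h1 := half_le_log_max t
  have h2 := half_le_log_natCast hN
  have h3 := one_le_one_add_logBase (t := t) hσ hσ1
  calc (sampleSize 100 1 t σ : ℝ) * P
      ≤ 300 * (Real.log (max 2 t) + Real.log (1 / (1 - σ))) *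
        (400 * t * Real.log N / Real.log (max 2 t)) :=
        mul_le_mul (sampleSize_one_le ht hσ hσ1) (prime_le hN ht hP) (by positivity)
          (by linarith [one_le_log_one_div hσ hσ1])
    _ = _ := by
        rw [← log_max_mul_one_add_logBase]
        field_simp
        ring

theorem log_one_add_logBase_le (hσ : 2 / 3 ≤ σ) (hσ1 : σ < 1) :
    Real.log (1 + logBase t (1 / (1 - σ))) ≤ 2 * Real.log (1 / (1 - σ)) := by
  have h1 := half_le_log_max t
  have h2 := one_le_log_one_div hσ hσ1
  have h3 := one_le_one_add_logBase (t := t) hσ hσ1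
  have h4 := Real.log_le_sub_one_of_pos (show 0 < 1 + logBase t (1 / (1 - σ)) by linarith)
  have h5 : logBase t (1 / (1 - σ)) ≤ 2 * Real.log (1 / (1 - σ)) := by
    rw [logBase, Real.logb, div_le_iff₀ (by linarith)]
    nlinarith
  linarith

/-- The assumption `c₀ ln N ≤ t` bounds `P` by a multiple of `t²`, so its logarithm no longer
involves `N`. -/
theorem exists_log_prime_le (hc : 0 < c₀) : ∃ C : ℝ, 0 < C ∧ ∀ (N P : ℕ) (t : ℝ), 2 ≤ N → 1 ≤ t →
    c₀ * Real.log N ≤ t → 2 ≤ P → P ≤ 2 * devoreScale 100 t N →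
    Real.log P ≤ C * Real.log (max 2 t) := by
  refine ⟨2 * |Real.log (800 / c₀)| + 2, by positivity, fun N P t hN ht hct hP2 hP => ?_⟩
  have h1 := half_le_log_max t
  have h2 := half_le_log_natCast hN
  have hP' : (0 : ℝ) < P := by exact_mod_cast (show 0 < P by omega)
  have h3 : (P : ℝ) ≤ 800 / c₀ * (t * t) := by
    refine (prime_le hN ht hP).trans ?_
    rw [div_le_iff₀ (by linarith), div_mul_eq_mul_div, div_mul_eq_mul_div, le_div_iff₀ hc]
    have : c₀ * Real.log N * t ≤ t * t := mul_le_mul_of_nonneg_right hct (by linarith)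
    nlinarith
  have h4 := Real.log_le_log hP' h3
  rw [Real.log_mul (by positivity) (by positivity), Real.log_mul (by linarith) (by linarith)] at h4
  have h5 := log_le_log_max ht
  have h6 := le_abs_self (Real.log (800 / c₀))
  have h7 := abs_nonneg (Real.log (800 / c₀))
  nlinarith

/-- The first phase has `O(t² f)` rows when `c₀ ln N ≤ t`, where `f = 1 + log_T (1 / (1 - σ))`. The
logarithm of this is of order `ln T + ln (1 / (1 - σ))`, because `ln f ≤ 2 ln (1 / (1 - σ))`. -/
theorem exists_blocks_le (hc : 0 < c₀) : ∃ C : ℝ, 0 < C ∧ ∀ (N P : ℕ) (t σ : ℝ), 2 ≤ N → 1 ≤ t →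
    c₀ * Real.log N ≤ t → 2 / 3 ≤ σ → σ < 1 → 1 ≤ P → P ≤ 2 * devoreScale 100 t N →
    (sampleSize 100 1 ((sampleSize 100 1 t σ : ℕ) * P) σ : ℝ) ≤
      C * (Real.log (max 2 t) + Real.log (1 / (1 - σ))) := by
  refine ⟨100 * |Real.log (120000 / c₀)| + 1000, by positivity,
    fun N P t σ hN ht hct hσ hσ1 hP1 hP => ?_⟩
  have h1 := half_le_log_max t
  have h2 := half_le_log_natCast hN
  have h3 := one_le_one_add_logBase (t := t) hσ hσ1
  have h4 : (1 : ℝ) ≤ (sampleSize 100 1 t σ : ℕ) * P := by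
    have := Nat.mul_pos (one_le_sampleSize le_rfl ht hσ hσ1) hP1
    exact_mod_cast this
  have h5 : ((sampleSize 100 1 t σ : ℕ) : ℝ) * P ≤
      120000 / c₀ * (t * t) * (1 + logBase t (1 / (1 - σ))) := by
    refine (blocks_mul_prime_le hN ht hσ hσ1 hP).trans (mul_le_mul_of_nonneg_right ?_ (by linarith))
    rw [div_mul_eq_mul_div, le_div_iff₀ hc]
    have : c₀ * Real.log N * t ≤ t * t := mul_le_mul_of_nonneg_right hct (by linarith)
    nlinarith
  have h6 := Real.log_le_log (by linarith) h5
  have e6 : Real.log (120000 / c₀ * (t * t) * (1 + logBase t (1 / (1 - σ)))) =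
      Real.log (120000 / c₀) + (Real.log t + Real.log t) +
        Real.log (1 + logBase t (1 / (1 - σ))) := by
    have : t ≠ 0 := by linarith
    rw [Real.log_mul (by positivity) (by linarith), Real.log_mul (by positivity) (by positivity),
      Real.log_mul this this]
  rw [e6] at h6
  have h7 := log_one_add_logBase_le (t := t) hσ hσ1
  have h8 := sampleSize_le zero_le_one h4 hσ hσ1
  rw [log_div_one_sub (by linarith) hσ1] at h8
  have h9 := one_le_log_one_div hσ hσ1
  have h10 := log_le_log_max ht
  have h11 := le_abs_self (Real.log (120000 / c₀))
  have h12 := abs_nonneg (Real.log (120000 / c₀))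
  nlinarith

/-! ### Cost of the DeVore matrices -/

theorem exists_devore_measurements_le (hc : 0 < c₀) : ∃ C : ℝ, 0 < C ∧
    ∀ (N P b₁ b₂ : ℕ) (t σ : ℝ), 2 ≤ N → 1 ≤ t →
    c₀ * Real.log N ≤ t → 2 / 3 ≤ σ → σ < 1 → 2 ≤ P → P ≤ 2 * devoreScale 100 t N →
    b₁ = sampleSize 100 1 t σ → b₂ = sampleSize 100 1 (b₁ * P) σ →
    (((1 + Nat.clog 2 N) * (b₁ * P) + b₂ * P : ℕ) : ℝ) ≤
      C * t * Real.log (N / (1 - σ)) * Real.log N * (1 + logBase t (1 / (1 - σ))) := by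
  obtain ⟨C, hC, hb₂⟩ := exists_blocks_le hc
  refine ⟨720000 + 400 * C, by positivity, fun N P b₁ b₂ t σ hN ht hct hσ hσ1 hP2 hP e₁ e₂ => ?_⟩
  subst e₁ e₂
  have h1 := half_le_log_max t
  have h2 := half_le_log_natCast hN
  have h3 := one_le_one_add_logBase (t := t) hσ hσ1
  have h4 := blocks_mul_prime_le hN ht hσ hσ1 hP
  have h5 := hb₂ N P t σ hN ht hct hσ hσ1 (by omega) hP
  have h6 := prime_le hN ht hP
  have h7 := one_add_clog_two_le hN
  have h8 := one_le_log_one_div hσ hσ1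
  rw [← log_max_mul_one_add_logBase] at h5
  have hA := log_div_one_sub (q := N) (σ := σ) (by positivity) hσ1
  set n := Real.log N
  set u := Real.log (max 2 t)
  set f := 1 + logBase t (1 / (1 - σ))
  set A := Real.log (N / (1 - σ))
  push_cast
  calc (1 + (Nat.clog 2 N : ℝ)) * ((sampleSize 100 1 t σ : ℝ) * P) +
        sampleSize 100 1 ((sampleSize 100 1 t σ : ℕ) * P) σ * P
      ≤ (6 * n) * (120000 * t * n * f) + (C * (u * f)) * (400 * t * n / u) := by
        gcongr
    _ = (720000 * n + 400 * C * 1) * (t * n * f) := by field_simp; ring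
    _ ≤ (720000 * A + 400 * C * A) * (t * n * f) := by
        gcongr <;> linarith
    _ = _ := by ring

theorem exists_random_bits_le (hc : 0 < c₀) : ∃ C : ℝ, 0 < C ∧
    ∀ (N P b₁ b₂ : ℕ) (t σ : ℝ), 2 ≤ N → 1 ≤ t →
    c₀ * Real.log N ≤ t → 2 / 3 ≤ σ → σ < 1 → 2 ≤ P → P ≤ 2 * devoreScale 100 t N →
    b₁ = sampleSize 100 1 t σ → b₂ = sampleSize 100 1 (b₁ * P) σ →
    (((b₁ + b₂) * Nat.clog 2 P : ℕ) : ℝ) ≤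
      C * Real.log (max 2 t) ^ 2 * (1 + logBase t (1 / (1 - σ))) := by
  obtain ⟨C, hC, hb₂⟩ := exists_blocks_le hc
  obtain ⟨C', hC', hP'⟩ := exists_log_prime_le hc
  refine ⟨(300 + C) * (4 * C'), by positivity, fun N P b₁ b₂ t σ hN ht hct hσ hσ1 hP2 hP e₁ e₂ => ?_⟩
  subst e₁ e₂
  have h1 := half_le_log_max t
  have h3 := one_le_one_add_logBase (t := t) hσ hσ1
  have h4 := sampleSize_one_le ht hσ hσ1
  have h5 := hb₂ N P t σ hN ht hct hσ hσ1 (by omega) hP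
  have h6 := hP' N P t hN ht hct hP2 hP
  have h7 := clog_two_le hP2
  rw [← log_max_mul_one_add_logBase] at h4 h5
  set u := Real.log (max 2 t)
  set f := 1 + logBase t (1 / (1 - σ))
  push_cast
  calc ((sampleSize 100 1 t σ : ℝ) + sampleSize 100 1 ((sampleSize 100 1 t σ : ℕ) * P) σ) *
        Nat.clog 2 P
      ≤ (300 * (u * f) + C * (u * f)) * (4 * (C' * u)) := by gcongr; linarith
    _ = _ := by ring

/-- If `t` exceeds `N`, then `N ln t = O(t ln N)`. -/
theorem mul_log_max_le (hN : 2 ≤ N) (h : (N : ℝ) < t) :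
    N * Real.log (max 2 t) ≤ 3 * t * Real.log N := by
  have h1 := half_le_log_natCast hN
  have hN' : (2 : ℝ) ≤ N := by exact_mod_cast hN
  rw [max_eq_right (by linarith)]
  have h2 : Real.log t ≤ Real.log N + t / N := by
    have h3 := Real.log_le_sub_one_of_pos (show 0 < t / N by apply div_pos <;> linarith)
    rw [Real.log_div (by linarith) (by linarith)] at h3
    linarith
  have h4 : (N : ℝ) * (t / N) = t := by field_simp
  nlinarith

/-- The cost of the estimates, when their number `S` is at most `N` and `R`. -/
theorem estimate_cost_le {S R b u n s f A q t : ℝ} (hS : 0 ≤ S) (hSN : S ≤ N) (hSR : S ≤ R)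
    (hN : 2 ≤ N) (ht : 1 ≤ t)
    (hn : n = Real.log N) (hu : u = Real.log (max 2 t)) (hs : 1 ≤ s) (hf : u * f = u + s)
    (hA : A = n + s) (hb : b ≤ q * (u * f)) (hq : 1 ≤ q) (htR : t ≤ R) {l : ℝ} (hl0 : 0 ≤ l)
    (hl : l ≤ 2 * (n / u)) : S * (b * (l + 3) + 1) ≤ 20 * q * R * A * f := by
  have hn1 : 1 / 2 ≤ n := hn ▸ half_le_log_natCast hN
  have hu1 : 1 / 2 ≤ u := hu ▸ half_le_log_max t
  have hf1 : 1 ≤ f := by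
    by_contra hlt
    nlinarith
  have hA0 : 1 ≤ A * f := by nlinarith
  have h1 : b * (l + 3) + 1 ≤ q * (2 * (n * f) + 3 * (u * f)) + 1 := by
    have h2 : b * (l + 3) ≤ q * (u * f) * (2 * (n / u) + 3) := by gcongr
    have h3 : q * (u * f) * (2 * (n / u) + 3) = q * (2 * (n * f) + 3 * (u * f)) := by
      field_simp
    linarith
  have hnA : n * f ≤ A * f := by gcongr; linarith
  have hR : 0 ≤ R := by linarith
  -- For `t ≤ N` one has `ln T ≤ ln N`, and `S ≤ R` suffices. For `t > N` the term with `ln T` would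
  -- be too large, but then `S ≤ N` and `N ln t = O(t ln N)`.
  rcases le_or_gt t N with htN | htN
  · have hun : u ≤ n := by
      rw [hu, hn]
      exact Real.log_le_log (by positivity) (max_le (by exact_mod_cast hN) htN)
    have h2 : u * f ≤ A * f := by gcongr; linarith
    have h3 : q * (2 * (n * f) + 3 * (u * f)) + 1 ≤ 20 * q * (A * f) := by
      have : q * (2 * (n * f) + 3 * (u * f)) ≤ q * (2 * (A * f) + 3 * (A * f)) := by gcongr
      nlinarith
    calc S * (b * (l + 3) + 1) ≤ R * (20 * q * (A * f)) :=
          (mul_le_mul_of_nonneg_left (h1.trans h3) hS).trans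
            (mul_le_mul_of_nonneg_right hSR (by positivity))
      _ = _ := by ring
  · have h2 : N * u ≤ 3 * t * n := by rw [hu, hn]; exact mul_log_max_le hN htN
    have h0 : 0 ≤ q * (2 * (n * f) + 3 * (u * f)) + 1 := by positivity
    have hnf : 1 / 2 ≤ n * f := by nlinarith
    calc S * (b * (l + 3) + 1) ≤ N * (q * (2 * (n * f) + 3 * (u * f)) + 1) :=
          (mul_le_mul_of_nonneg_left h1 hS).trans (mul_le_mul_of_nonneg_right hSN h0)
      _ = q * (2 * (N * (n * f)) + 3 * (N * u * f)) + N := by ring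
      _ ≤ q * (2 * (t * (n * f)) + 3 * (3 * t * n * f)) + t := by gcongr
      _ = 11 * q * (t * (n * f)) + t * 1 := by ring
      _ ≤ 11 * q * (t * (n * f)) + t * (q * (2 * (n * f))) := by gcongr; nlinarith
      _ = 13 * q * (t * (n * f)) := by ring
      _ ≤ 20 * q * (R * (A * f)) := by gcongr; norm_num
      _ = _ := by ring

theorem exists_devore_time_le (hc : 0 < c₀) : ∃ C : ℝ, 0 < C ∧
    ∀ (N P b₁ b₂ S : ℕ) (t σ : ℝ), 2 ≤ N → 1 ≤ t →
    c₀ * Real.log N ≤ t → 2 / 3 ≤ σ → σ < 1 → 2 ≤ P → devoreScale 100 t N ≤ P →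
    P ≤ 2 * devoreScale 100 t N →
    b₁ = sampleSize 100 1 t σ → b₂ = sampleSize 100 1 (b₁ * P) σ → S ≤ N → S ≤ b₁ * P →
    ((400 * ((b₁ * P + 1) * (Nat.clog 2 N + 1)) +
      30000 * (S * (b₂ * (Nat.log P N + 3) + 1)) + 2000 : ℕ) : ℝ) ≤
      C * t * Real.log (N / (1 - σ)) ^ 2 * (1 + logBase t (1 / (1 - σ))) ^ 2 := by
  obtain ⟨C, hC, hb₂⟩ := exists_blocks_le hc
  refine ⟨400 * (121000 * 6) + 30000 * (20 * (C + 1) * 120000) + 2000, by positivity,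
    fun N P b₁ b₂ S t σ hN ht hct hσ hσ1 hP2 hP hP' e₁ e₂ hSN hSR => ?_⟩
  have h1 := half_le_log_max t
  have h2 := half_le_log_natCast hN
  have h3 := one_le_one_add_logBase (t := t) hσ hσ1
  have h4 := blocks_mul_prime_le hN ht hσ hσ1 hP'
  have h5 := hb₂ N P t σ hN ht hct hσ hσ1 (by omega) hP'
  rw [← e₁] at h4 h5
  rw [← e₂] at h5
  have h7 := one_add_clog_two_le hN
  have h8 := one_le_log_one_div hσ hσ1
  have huf := log_max_mul_one_add_logBase t σ
  rw [← huf] at h5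
  have hA := log_div_one_sub (q := N) (σ := σ) (by positivity) hσ1
  have hl := natLog_prime_le hN ht hP
  rw [logBase, Real.logb] at hl
  have hSN' : (S : ℝ) ≤ N := by exact_mod_cast hSN
  have hSR' : (S : ℝ) ≤ b₁ * P := by exact_mod_cast hSR
  set n := Real.log N with hn
  set u := Real.log (max 2 t) with hu
  set f := 1 + logBase t (1 / (1 - σ)) with hf
  set A := Real.log (N / (1 - σ)) with hAdef
  have hcost := estimate_cost_le (S := S) (R := 120000 * t * n * f) (b := b₂) (q := C + 1) (l := Nat.log P N)
    (Nat.cast_nonneg _) hSN' (hSR'.trans h4) hN ht hn hu h8 huf hA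
    (h5.trans (by gcongr; linarith)) (by linarith) (by nlinarith [mul_le_mul h2 h3 zero_le_one (by linarith)])
    (Nat.cast_nonneg _) hl
  have hnA : n ≤ A := by linarith
  have hA1 : 1 ≤ A := by linarith
  have htnf : 1 / 2 ≤ t * n * f := by
    have : 1 / 2 ≤ t * n := by nlinarith
    nlinarith
  have hAf : 1 ≤ A ^ 2 * f ^ 2 := one_le_mul_of_one_le_of_one_le (one_le_pow₀ hA1) (one_le_pow₀ h3)
  push_cast
  have s1 : ((b₁ * P : ℝ) + 1) * ((Nat.clog 2 N : ℝ) + 1) ≤ 121000 * 6 * (t * A ^ 2 * f ^ 2) := by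
    calc ((b₁ * P : ℝ) + 1) * ((Nat.clog 2 N : ℝ) + 1) ≤ (121000 * (t * n * f)) * (6 * n) := by
          gcongr
          · linarith
          · linarith
      _ = 121000 * 6 * (t * n ^ 2 * (f * 1)) := by ring
      _ ≤ 121000 * 6 * (t * A ^ 2 * (f * f)) := by gcongr
      _ = _ := by ring
  have s2 : (S : ℝ) * (b₂ * (Nat.log P N + 3) + 1) ≤
      20 * (C + 1) * 120000 * (t * A ^ 2 * f ^ 2) := by
    refine hcost.trans ?_
    calc 20 * (C + 1) * (120000 * t * n * f) * A * f = 20 * (C + 1) * 120000 * (t * (n * A) * f ^ 2) := by ring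
      _ ≤ 20 * (C + 1) * 120000 * (t * (A * A) * f ^ 2) := by gcongr
      _ = _ := by ring
  have s3 : 1 ≤ t * A ^ 2 * f ^ 2 := by nlinarith
  calc _ ≤ 400 * (121000 * 6 * (t * A ^ 2 * f ^ 2)) +
      30000 * (20 * (C + 1) * 120000 * (t * A ^ 2 * f ^ 2)) + 2000 * (t * A ^ 2 * f ^ 2) := by
        gcongr
        linarith
    _ = _ := by ring

/-! ### Cost of the random coherent matrices -/

/-- From `μ ≤ 4 K` the ratio is about `16 K / l` at most, and `K ≤ 301 t l`; note `16 · 301 < 5000`.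
-/
theorem bernRows_div_bernK_le {K m : ℕ} (hN : 1 ≤ N) (hτ : 0 ≤ τ) (hτ1 : τ < 1) (ht : 1 ≤ t)
    (hK : K = bernK 100 t N τ) (hm : m = bernRows N K τ) : (m / K : ℝ) ≤ 5000 * t ∧ 1 ≤ (m / K : ℝ) := by
  have h1 := one_le_log_three_mul hN hτ hτ1
  have h2 := log_le_bernLogTerm hN hτ hτ1
  have h3 : 20 * bernLogTerm N τ ≤ K := hK ▸ bernLogTerm_le_bernK hN hτ hτ1 (by norm_num) ht
  have h4 := bernMean_le (K := K) hN hτ hτ1 (by linarith)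
  have h5 := le_bernMean K hN hτ hτ1
  set l := bernLogTerm N τ with hl
  set μ := bernMean N K τ with hμ
  have hK0 : (0 : ℝ) < K := by linarith
  have h6 : μ ^ 2 / l ≤ m := by rw [hm]; exact Nat.le_ceil _
  have h7 : (m : ℝ) ≤ μ ^ 2 / l + 1 := by
    rw [hm]; exact (Nat.ceil_lt_add_one (div_nonneg (sq_nonneg _) (by linarith))).le
  have h8 : (K : ℝ) ≤ 301 * t * l := by
    have h9 : (bernAlpha N τ : ℝ) ≤ 2 * l + 1 := (Nat.ceil_lt_add_one (by linarith)).le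
    have h10 : (K : ℝ) ≤ 100 * t * bernAlpha N τ + 1 := by
      rw [hK]; exact (Nat.ceil_lt_add_one (by positivity)).le
    have h11 : 100 * t * (bernAlpha N τ : ℝ) ≤ 100 * t * (2 * l + 1) := by gcongr
    nlinarith
  constructor
  · rw [div_le_iff₀ hK0]
    have h9 : μ ^ 2 / l ≤ 16 * 301 * t * K := by
      rw [div_le_iff₀ (by linarith)]
      nlinarith
    nlinarith
  · rw [le_div_iff₀ hK0, one_mul]
    refine le_trans ?_ h6
    rw [le_div_iff₀ (by linarith)]
    nlinarith

theorem sampleSize_rows_le {ρ q : ℝ} (hρ0 : 0 ≤ ρ) (hρ : ρ ≤ 5000 * t) (ht : 1 ≤ t) (hq : 1 ≤ q)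
    (hσ : 2 / 3 ≤ σ) (hσ1 : σ < 1) :
    (sampleSize 100 ρ q σ : ℝ) ≤ 2000000 * t * Real.log (q / (1 - σ)) := by
  have h1 := sampleSize_le hρ0 hq hσ hσ1
  have h2 := log_div_one_sub (by linarith : 0 < q) hσ1
  have h3 := one_le_log_one_div hσ hσ1
  have h4 := Real.log_nonneg hq
  have h5 : 1 ≤ Real.log (q / (1 - σ)) := by linarith
  have h6 : 100 * ρ * (1 + Real.log (q / (1 - σ))) ≤
      100 * (5000 * t) * (2 * Real.log (q / (1 - σ))) := by
    gcongr
    linarith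
  nlinarith

/-- The number of identification rows is `O(t ln (t / (1 - σ)))`, so its logarithm is of order `ln
(t / (1 - σ))`, whatever the size of `N`. -/
theorem sampleSize_identified_le {ρ : ℝ} (hρ1 : 1 ≤ ρ) (hρ : ρ ≤ 5000 * t) (ht : 1 ≤ t)
    (hσ : 2 / 3 ≤ σ) (hσ1 : σ < 1) :
    (sampleSize 100 1 (sampleSize 100 ρ t σ : ℕ) σ : ℝ) ≤ 2000 * Real.log (t / (1 - σ)) := by
  have h1 := sampleSize_rows_le (by linarith) hρ ht ht hσ hσ1
  have h2 : (1 : ℝ) ≤ sampleSize 100 ρ t σ := by exact_mod_cast one_le_sampleSize hρ1 ht hσ hσ1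
  have h3 := sampleSize_le zero_le_one h2 hσ hσ1
  rw [log_div_one_sub (by linarith) hσ1] at h3
  have h4 := Real.log_le_log (by linarith) h1
  have h5 := log_div_one_sub (by linarith : 0 < t) hσ1
  have h6 := one_le_log_one_div hσ hσ1
  have h7 := Real.log_nonneg ht
  set D := Real.log (t / (1 - σ))
  rw [Real.log_mul (by positivity) (by linarith), Real.log_mul (by norm_num) (by linarith)] at h4
  have h8 := Real.log_le_sub_one_of_pos (show 0 < D by linarith)
  have h9 : Real.log 2000000 ≤ 15 := by
    have : (2000000 : ℝ) ≤ 2 ^ 21 := by norm_num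
    have h10 := Real.log_le_log (by norm_num) this
    rw [Real.log_pow] at h10
    push_cast at h10
    linarith [Real.log_two_lt_d9]
  linarith

theorem rows_measurements_le {P : ℕ} {ρ : ℝ} (hN : 2 ≤ N) (ht : 1 ≤ t) (hρ1 : 1 ≤ ρ)
    (hρ : ρ ≤ 5000 * t) (hσ : 2 / 3 ≤ σ) (hσ1 : σ < 1) (hP : P ≤ 2 * devoreScale 100 t N)
    {γ b : ℕ} (hγ : γ = sampleSize 100 ρ t σ) (hb : b = sampleSize 100 1 γ σ) :
    (((1 + Nat.clog 2 N) * γ + b * P : ℕ) : ℝ) ≤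
      14000000 * t * Real.log (t / (1 - σ)) * Real.log N := by
  have h1 : (γ : ℝ) ≤ _ := hγ ▸ sampleSize_rows_le (by linarith) hρ ht ht hσ hσ1
  have h2 : (b : ℝ) ≤ 2000 * Real.log (t / (1 - σ)) := by
    rw [hb, hγ]; exact sampleSize_identified_le hρ1 hρ ht hσ hσ1
  have h3 := prime_le hN ht hP
  have h4 := one_add_clog_two_le hN
  have h5 := half_le_log_max t
  have h6 := half_le_log_natCast hN
  have h7 := log_div_one_sub (by linarith : 0 < t) hσ1
  have h8 := one_le_log_one_div hσ hσ1
  have h9 := Real.log_nonneg ht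
  have h10 : (P : ℝ) ≤ 800 * t * Real.log N := by
    refine h3.trans ?_
    rw [div_le_iff₀ (by linarith)]
    have : 0 < t * Real.log N := by apply mul_pos <;> linarith
    nlinarith
  set D := Real.log (t / (1 - σ))
  have hD : 0 ≤ D := by linarith
  push_cast
  calc (1 + (Nat.clog 2 N : ℝ)) * γ + b * P
      ≤ (6 * Real.log N) * (2000000 * t * D) + (2000 * D) * (800 * t * Real.log N) := by gcongr
    _ = 13600000 * (t * D * Real.log N) := by ring
    _ ≤ 14000000 * (t * D * Real.log N) := by gcongr; norm_num
    _ = _ := by ring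

theorem rows_time_le {P : ℕ} {ρ : ℝ} (hN : 2 ≤ N) (ht : 1 ≤ t) (hρ1 : 1 ≤ ρ)
    (hρ : ρ ≤ 5000 * t) (hσ : 2 / 3 ≤ σ) (hσ1 : σ < 1) (hP : devoreScale 100 t N ≤ P)
    {γ b S : ℕ} (hγ : γ = sampleSize 100 ρ t σ) (hb : b = sampleSize 100 1 γ σ)
    (hSN : S ≤ N) (hSR : S ≤ γ) :
    ((400 * ((γ + 1) * (Nat.clog 2 N + 1)) +
      30000 * (S * (b * (Nat.log P N + 3) + 1)) + 2000 : ℕ) : ℝ) ≤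
      10 ^ 16 * t * Real.log (t / (1 - σ)) * Real.log (N / (1 - σ)) *
        (1 + logBase t (1 / (1 - σ))) := by
  have h1 : (γ : ℝ) ≤ _ := hγ ▸ sampleSize_rows_le (by linarith) hρ ht ht hσ hσ1
  have h2 : (b : ℝ) ≤ 2000 * Real.log (t / (1 - σ)) := by
    rw [hb, hγ]; exact sampleSize_identified_le hρ1 hρ ht hσ hσ1
  have h3 := one_le_one_add_logBase (t := t) hσ hσ1
  have h4 := one_add_clog_two_le hN
  have h5 := half_le_log_max t
  have h6 := half_le_log_natCast hN
  have h7 := log_div_one_sub (by linarith : 0 < t) hσ1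
  have h8 := one_le_log_one_div hσ hσ1
  have h9 := Real.log_nonneg ht
  have h10 := log_le_log_max ht
  have huf := log_max_mul_one_add_logBase t σ
  have hA := log_div_one_sub (q := N) (σ := σ) (by positivity) hσ1
  have hl := natLog_prime_le hN ht hP
  rw [logBase, Real.logb] at hl
  have hSN' : (S : ℝ) ≤ N := by exact_mod_cast hSN
  have hSR' : (S : ℝ) ≤ γ := by exact_mod_cast hSR
  set n := Real.log N with hn
  set u := Real.log (max 2 t) with hu
  set f := 1 + logBase t (1 / (1 - σ)) with hf
  set A := Real.log (N / (1 - σ)) with hAdef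
  set D := Real.log (t / (1 - σ)) with hDdef
  have hD : 1 ≤ D := by linarith
  have htD : 1 ≤ t * D := by nlinarith
  have hcost := estimate_cost_le (S := S) (R := 2000000 * t * D) (b := b) (q := 2000) (l := Nat.log P N)
    (Nat.cast_nonneg _) hSN' (hSR'.trans h1) hN ht hn hu h8 huf hA
    (h2.trans (by rw [huf]; gcongr; linarith)) (by norm_num) (by nlinarith) (Nat.cast_nonneg _) hl
  have hA1 : 1 ≤ A := by linarith
  have hAf : 1 ≤ A * f := by nlinarith
  have s1 : ((γ : ℝ) + 1) * ((Nat.clog 2 N : ℝ) + 1) ≤ 18000000 * (t * D * A * f) := by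
    calc ((γ : ℝ) + 1) * ((Nat.clog 2 N : ℝ) + 1) ≤ (3000000 * (t * D)) * (6 * A) := by
          gcongr
          · linarith
          · linarith
      _ = 18000000 * (t * D * (A * 1)) := by ring
      _ ≤ 18000000 * (t * D * (A * f)) := by gcongr
      _ = _ := by ring
  have s3 : 1 ≤ t * D * A * f := by nlinarith
  push_cast
  calc _ ≤ 400 * (18000000 * (t * D * A * f)) +
      30000 * (20 * 2000 * (2000000 * t * D) * A * f) + 2000 * (t * D * A * f) := by
        gcongr
        linarith
    _ = (400 * 18000000 + 30000 * 20 * 2000 * 2000000 + 2000) * (t * D * A * f) := by ring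
    _ ≤ 10 ^ 16 * (t * D * A * f) := by gcongr; norm_num
    _ = _ := by ring

end Parameters

/-! ## The success probabilities -/

section Success

variable {N k : ℕ} {ε σ τ t δ : ℝ} {x xk xt : Fin N → ℝ}

theorem isSampledMatrix_of_isCoherent {m K α b : ℕ} {A : Matrix (Fin m) (Fin N) Bool}
    (hA : IsCoherent A K α) (hK : 100 * t * α ≤ K) (hm : 0 < m) (hδ : 0 ≤ δ)
    (U : Finset (Fin N)) (hU : (U.card : ℝ) ≤ t) (hx : ∑ l ∈ Uᶜ, |x l| ≤ δ * t) :
    IsSampledMatrix (fun s : Fin b → Fin m => sampleRows A s) x δ (K / (4 * m)) := by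
  have h := isSampledMatrix_sampleRows (b := b) hA.1 x (δ := δ) (fun n => ?_) (by simpa using hm)
  · simpa using h
  · have h1 := badCount_le hA x hδ U hU hx n
    have h2 : 0 ≤ t := (Nat.cast_nonneg _).trans hU
    have h3 : 0 ≤ t * α := by positivity
    linarith

/-- Coherence gives at most `2 t log_P N ≤ 4 t log_T N` bad rows, while `P` is at least `100 t log_T
N`. -/
theorem badCount_devore_le {P : ℕ} (hP : P.Prime) (hN : 2 ≤ N) (ht : 1 ≤ t)
    (hPs : devoreScale 100 t N ≤ P) (hδ : 0 ≤ δ) (U : Finset (Fin N)) (hU : (U.card : ℝ) ≤ t)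
    (hx : ∑ l ∈ Uᶜ, |x l| ≤ δ * t) (n : Fin N) : (badCount (devore P N) x δ n : ℝ) ≤ P / 25 := by
  have h1 := badCount_le (isCoherent_devore hP N) x hδ U hU hx n
  have h2 := natLog_prime_le hN ht hPs
  have h3 := le_prime hPs
  have h4 : 2 * (Nat.log P N : ℝ) * t ≤ 2 * (2 * logBase t N) * t := by gcongr
  have e : 100 * t * Real.log N / Real.log (max 2 t) = 100 * (logBase t N * t) := by
    rw [logBase, Real.logb]; ring
  linarith

theorem isSampledMatrix_devoreBlocks_uniform {P b : ℕ} (hP : P.Prime)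
    (hbad : ∀ n, (badCount (devore P N) x δ n : ℝ) ≤ P / 25) :
    IsSampledMatrix (fun s : Fin b → Fin P => devoreBlocks N s) x δ (1 / 4) := by
  refine isSampledMatrix_devoreBlocks hP.pos id (c := 1) (fun q => ?_) x fun n => ?_
  · simp [Finset.filter_eq']
  · have := hbad n
    have hP0 : (0 : ℝ) ≤ P := Nat.cast_nonneg _
    simp only [Fintype.card_fin, Nat.cast_one, one_mul]
    linarith

/-- Each block has at most two bit patterns, so at most `2 P / 25` of the at least `P` patterns are
bad, still less than a tenth. -/
theorem isSampledMatrix_devoreBlocks_bits {P b : ℕ} (hP : P.Prime)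
    (hbad : ∀ n, (badCount (devore P N) x δ n : ℝ) ≤ P / 25) :
    IsSampledMatrix (fun s : Fin b → Fin (Nat.clog 2 P) → Bool =>
      devoreBlocks N fun i => blockOfBits hP.pos (s i)) x δ (1 / 4) := by
  refine isSampledMatrix_devoreBlocks hP.pos (blockOfBits hP.pos) (c := 2)
    (card_blockOfBits_fiber_le hP.pos) x fun n => ?_
  have h1 := hbad n
  have h2 : (P : ℝ) ≤ 2 ^ Nat.clog 2 P := by exact_mod_cast Nat.le_pow_clog (by norm_num) P
  have hP0 : (0 : ℝ) ≤ P := Nat.cast_nonneg _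
  simp only [Fintype.card_fun, Fintype.card_bool, Fintype.card_fin]
  push_cast
  linarith

open Classical in
theorem columnOnes_sampleRows {m b : ℕ} (A : Matrix (Fin m) (Fin N) Bool) (s : Fin b → Fin m)
    (n : Fin N) : columnOnes (sampleRows A s) n =
      (Finset.univ.filter fun j => s j ∈ Finset.univ.filter fun i => A i n = true).card := by
  unfold columnOnes
  congr 1
  ext j
  rw [Finset.mem_filter, Finset.mem_filter, Finset.mem_filter]
  simp [sampleRows]

open Classical in
theorem ofReal_le_uniformOn_univ_and {Ω : Type*} [Fintype Ω] [Nonempty Ω] [MeasurableSpace Ω]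
    [MeasurableSingletonClass Ω] {E : Set Ω} (E₁ E₂ : Ω → Prop)
    (h₁ : ((Finset.univ.filter fun ω => ¬ E₁ ω).card : ℝ) ≤ (1 - σ) / 2 * Fintype.card Ω)
    (h₂ : ((Finset.univ.filter fun ω => ¬ E₂ ω).card : ℝ) ≤ (1 - σ) / 2 * Fintype.card Ω)
    (h : ∀ ω, E₁ ω → E₂ ω → ω ∈ E) : ENNReal.ofReal σ ≤ uniformOn Set.univ E := by
  apply ofReal_le_uniformOn_univ
  have hsub : (Finset.univ.filter fun ω => ω ∉ E) ⊆
      (Finset.univ.filter fun ω => ¬ E₁ ω) ∪ Finset.univ.filter fun ω => ¬ E₂ ω := by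
    intro ω hω
    simp only [Finset.mem_union, Finset.mem_filter, Finset.mem_univ, true_and] at hω ⊢
    by_contra hcon
    push Not at hcon
    exact hω (h ω hcon.1 hcon.2)
  have := (Finset.card_le_card hsub).trans (Finset.card_union_le _ _)
  have h3 : ((Finset.univ.filter fun ω => ω ∉ E).card : ℝ) ≤
      (Finset.univ.filter fun ω => ¬ E₁ ω).card + (Finset.univ.filter fun ω => ¬ E₂ ω).card := by
    exact_mod_cast this
  linarith

open Classical in
/-- With high probability no column of a sampled matrix has more than `20000 ln (2N/(1-σ))` ones. -/
theorem card_columnOnes_gt_le {m K b : ℕ} {A : Matrix (Fin m) (Fin N) Bool}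
    (hA : ∀ j, (columnOnes A j : ℝ) ≤ 100 * K) (hK : 0 < K) (hKm : K ≤ m) (hN : 1 ≤ N)
    (hσ : 2 / 3 ≤ σ) (hσ1 : σ < 1) (hb : b = sampleSize 100 (m / K) N σ)
    (E : (Fin b → Fin m) → Prop) (hE : ∀ s, (∀ n, (columnOnes (sampleRows A s) n : ℝ) ≤
      20000 * Real.log (2 * N / (1 - σ))) → E s) :
    ((Finset.univ.filter fun s : Fin b → Fin m => ¬ E s).card : ℝ) ≤
      (1 - σ) / 2 * Fintype.card (Fin b → Fin m) := by
  have hN' : (1 : ℝ) ≤ N := by exact_mod_cast hN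
  have hK' : (0 : ℝ) < K := by exact_mod_cast hK
  have hKm' : (K : ℝ) ≤ m := by exact_mod_cast hKm
  have hm' : (0 : ℝ) < m := by linarith
  set L := Real.log (2 * N / (1 - σ)) with hL
  have hL1 : 1 ≤ L := by
    refine one_lt_log_three.le.trans (Real.log_le_log (by norm_num) ?_)
    rw [le_div_iff₀ (by linarith)]
    linarith
  have hone : ∀ n, ((Finset.univ.filter fun s : Fin b → Fin m =>
      20000 * L < columnOnes (sampleRows A s) n).card : ℝ) ≤
      (m : ℝ) ^ b * Real.exp (-(2 * L)) := by
    intro n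
    -- On average a sampled column has at most `10000 L + 100` ones. The exponent is at most `10000
    -- L + 100 - 20000 L ln 2`, which is below `-2 L` because `L ≥ 1`.
    have h := card_hits_gt_le (b := b) (Finset.univ.filter fun i => A i n = true)
      (a := 100 * K / m) (h := 20000 * L) (by
        have := hA n
        rw [Fintype.card_fin, div_mul_cancel₀ _ hm'.ne']
        rw [columnOnes] at this
        convert this)
    rw [Fintype.card_fin] at h
    refine le_trans (le_of_eq ?_) (h.trans (?_ : _ ≤ _))
    · simp only [columnOnes_sampleRows]
      congr!
    refine (mul_le_mul_of_nonneg_left (Real.exp_le_exp.2 ?_) (by positivity))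
    have h1 : (b : ℝ) ≤ 100 * (m / K) * L + 1 := by
      rw [hb]
      exact (Nat.ceil_lt_add_one (by positivity)).le
    have h2 : (b : ℝ) * (100 * K / m) ≤ 10000 * L + 100 * (K / m) := by
      calc (b : ℝ) * (100 * K / m) ≤ (100 * (m / K) * L + 1) * (100 * K / m) := by gcongr
        _ = _ := by field_simp; ring
    have h3 : (K / m : ℝ) ≤ 1 := (div_le_one hm').2 hKm'
    have h4 := half_le_log_two
    have h5 := Real.log_two_gt_d9
    nlinarith
  have hsub : (Finset.univ.filter fun s : Fin b → Fin m => ¬ E s) ⊆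
      Finset.univ.biUnion fun n => Finset.univ.filter fun s =>
        20000 * L < columnOnes (sampleRows A s) n := by
    intro s hs
    have hs' := mt (hE s) (Finset.mem_filter.1 hs).2
    push Not at hs'
    obtain ⟨n, hn⟩ := hs'
    exact Finset.mem_biUnion.2 ⟨n, Finset.mem_univ _, Finset.mem_filter.2 ⟨Finset.mem_univ _, hn⟩⟩
  calc _ ≤ ((∑ n : Fin N, (Finset.univ.filter fun s : Fin b → Fin m =>
        20000 * L < columnOnes (sampleRows A s) n).card : ℕ) : ℝ) := by
        exact_mod_cast (Finset.card_le_card hsub).trans Finset.card_biUnion_le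
    _ ≤ ∑ n : Fin N, (m : ℝ) ^ b * Real.exp (-(2 * L)) := by
        push_cast
        exact Finset.sum_le_sum fun n _ => hone n
    _ = (N * Real.exp (-(2 * L))) * (m : ℝ) ^ b := by
        rw [Finset.sum_const, Finset.card_univ, Fintype.card_fin, nsmul_eq_mul]; ring
    _ ≤ (1 - σ) / 2 * (m : ℝ) ^ b := by
        gcongr
        exact one_sub_div_sq_mul_le hσ hσ1 hN' (by linarith)
    _ = _ := by simp

/-- Both the error guarantee and the running time hold with failure probability at most `(1 - σ) /
2`; the time depends on the sample, through the numbers of ones in the sampled columns. -/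
theorem ofReal_le_uniformOn_estimationSucceeds {m K α b : ℕ} {A : Matrix (Fin m) (Fin N) Bool}
    (hA : IsBalancedCoherent 100 A K α) (hk : 1 ≤ k) (hN : 2 ≤ N) (hε : 0 < ε)
    (hσ : 2 / 3 ≤ σ) (hσ1 : σ < 1) (hxk : nonzeroCount xk ≤ k)
    (hxt : (nonzeroCount xt : ℝ) ≤ k / ε) (hK : 100 * (k / ε) * α ≤ K) (hK0 : 0 < K) (hKm : K ≤ m)
    (hb : b = sampleSize 100 (m / K) N σ) :
    ENNReal.ofReal σ ≤ uniformOn Set.univ {s : Fin b → Fin m |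
      EstimationSucceeds (sampleRows A s) x xk xt k ε ∧
      ∃ (z : Fin N → ℝ) (T : ℕ),
        estimationProgram.Runs
          (estimationInput k (sampleRows A s) (estMeasurements (sampleRows A s) x)) T z ∧
        IsEstimate (sampleRows A s) (estMeasurements (sampleRows A s) x) Finset.univ k z ∧
        (T : ℝ) ≤ 10 ^ 9 * N * Real.log (N / (1 - σ))} := by
  classical
  have hm : 0 < m := by omega
  have := Fin.pos_iff_nonempty.1 hm
  have hK' : (0 : ℝ) < K := by exact_mod_cast hK0
  have hm' : (0 : ℝ) < m := by exact_mod_cast hm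
  have hN' : (2 : ℝ) ≤ N := by exact_mod_cast hN
  have hS : IsSampledMatrix (fun s : Fin b → Fin m => sampleRows A s) x (noiseLevel x xt k ε)
      (K / (4 * m)) :=
    isSampledMatrix_of_isCoherent hA.1 hK hm (noiseLevel_nonneg x xt k hε) _ hxt
      (sum_compl_abs_le_noiseLevel x xt hk hε)
  have h₁ := hS.card_fail_le (κ := 100) (ρ := m / K) (q := N) hσ hσ1 (by linarith) (by positivity)
    (by field_simp; norm_num) hb Finset.univ
    (by rw [Finset.card_univ, Fintype.card_fin]; linarith) _ fun _ h => h
  have h₂ := card_columnOnes_gt_le hA.2 hK0 hKm (by omega) hσ hσ1 hb _ fun _ h => h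
  refine ofReal_le_uniformOn_univ_and _ _ h₁ h₂ fun s c1 c2 => ?_
  refine ⟨estimationSucceeds_of_counts hk hε hxk fun n => c1 n (Finset.mem_univ n), ?_⟩
  obtain ⟨z, T, hr, hz, hT⟩ := estimationProgram_spec hk (sampleRows A s)
    (estMeasurements (sampleRows A s) x)
  refine ⟨z, T, hr, hz, ?_⟩
  have hT' : (T : ℝ) ≤ ∑ n : Fin N, (21000 * (columnOnes (sampleRows A s) n : ℝ) + 22000) + 1100 := by
    exact_mod_cast hT
  have hsum : ∑ n : Fin N, (21000 * (columnOnes (sampleRows A s) n : ℝ) + 22000) ≤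
      N * (21000 * (20000 * Real.log (2 * N / (1 - σ))) + 22000) := by
    refine (Finset.sum_le_card_nsmul _ _ _ fun n _ => ?_).trans_eq
      (by rw [Finset.card_univ, Fintype.card_fin, nsmul_eq_mul])
    linarith [c2 n]
  have e : Real.log (2 * N / (1 - σ)) = Real.log 2 + Real.log (N / (1 - σ)) := by
    have : 0 < 1 - σ := by linarith
    rw [← Real.log_mul (by norm_num) (by positivity), mul_div_assoc]
  have hA1 : 1 ≤ Real.log (N / (1 - σ)) := by
    rw [log_div_one_sub (by linarith) hσ1]
    linarith [half_le_log_natCast hN, one_le_log_one_div hσ hσ1]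
  have h2 := Real.log_two_lt_d9
  rw [e] at hsum
  -- The leading term is `21000 · 20000 · (ln 2 + ln (N / (1 - σ)))` per column, and `ln 2` is less
  -- than `ln (N / (1 - σ))`.
  nlinarith

end Success

/-! ### Assembly of the main theorem -/

theorem ofReal_le_uniformOn_devore_bits {N k P b₁ b₂ : ℕ} {ε σ : ℝ} {x xk xt : Fin N → ℝ}
    (hk : 1 ≤ k) (hε : 0 < ε) (hε1 : ε ≤ 1) (hσ : 2 / 3 ≤ σ) (hσ1 : σ < 1)
    (hxk : nonzeroCount xk ≤ k) (hxt : (nonzeroCount xt : ℝ) ≤ k / ε) (hP : P.Prime)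
    (hbad : ∀ n, (badCount (devore P N) x (noiseLevel x xt k ε) n : ℝ) ≤ P / 25)
    (hb₁ : b₁ = sampleSize 100 1 (k / ε) σ) (hb₂ : b₂ = sampleSize 100 1 (b₁ * P) σ)
    (hr : 1 ≤ b₁ * P) :
    ENNReal.ofReal σ ≤ uniformOn Set.univ
        {v : (Fin b₁ → Fin (Nat.clog 2 P) → Bool) × (Fin b₂ → Fin (Nat.clog 2 P) → Bool) |
          RecoverySucceeds (devoreBlocks N fun i => blockOfBits hP.pos (v.1 i))
            (devoreBlocks N fun i => blockOfBits hP.pos (v.2 i)) x xk xt k ε} := by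
  have h₁ := isSampledMatrix_devoreBlocks_bits (b := b₁) hP hbad
  have h₂ := isSampledMatrix_devoreBlocks_bits (b := b₂) hP hbad
  have h := ofReal_le_uniformOn_recoverySucceeds (xk := xk) hk hε hε1 hσ hσ1 hxk hxt h₁ h₂
      (by norm_num) (by norm_num) hb₁ (by norm_num) (by norm_num) hb₂ (by push_cast; rfl) hr
  exact h

theorem mainTheorem1 :
    ∃ (κ : ℝ) (progEst progRec : RamProgram), 29 ≤ κ ∧
    ∀ c₀ : ℝ, 0 < c₀ → ∃ C : ℝ, 0 < C ∧
    ∀ (N k : ℕ) (ε σ τ : ℝ) (x xk xt : Fin N → ℝ),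
      1 ≤ k → k < N → 0 < ε → ε ≤ 1 → 2 / 3 ≤ σ → σ < 1 → 0 ≤ τ → τ < 1 →
      IsBestApprox x k xk → IsBestApprox x (k / ε) xt →
    ∀ α K m : ℕ, α = bernAlpha N τ → K = bernK κ (k / ε) N τ → m = bernRows N K τ →
    -- the random matrices are coherent with the required parameters with probability at least `τ`
    ENNReal.ofReal τ ≤ bernLaw m N (bernProb N K τ)
        {ω | IsBalancedCoherent κ (Matrix.of fun i j => ω (i, j)) K α} ∧
    -- 1. estimation only, with sampled rows of such a matrix
    (∀ A : Matrix (Fin m) (Fin N) Bool, IsBalancedCoherent κ A K α →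
      ∀ β : ℕ, β = sampleSize κ (m / K) N σ →
      (β : ℝ) ≤ C * (k / ε) * Real.log (N / (1 - σ)) ∧
      ENNReal.ofReal σ ≤ uniformOn Set.univ {s : Fin β → Fin m |
        EstimationSucceeds (sampleRows A s) x xk xt k ε ∧
        ∃ (z : Fin N → ℝ) (T : ℕ),
          progEst.Runs
            (estimationInput k (sampleRows A s) (estMeasurements (sampleRows A s) x)) T z ∧
          IsEstimate (sampleRows A s) (estMeasurements (sampleRows A s) x) Finset.univ k z ∧
          (T : ℝ) ≤ C * N * Real.log (N / (1 - σ))}) ∧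
    ∀ (P : ℕ) (hP : P.Prime),
      devoreScale κ (k / ε) N ≤ P → P ≤ 2 * devoreScale κ (k / ε) N →
    IsCoherent (devore P N) P (Nat.log P N) ∧
    (Nat.log P N : ℝ) ≤ C * logBase (k / ε) N ∧
    -- 2. identification and estimation with sampled blocks of a DeVore matrix
    (∀ b₁ b₂ : ℕ, b₁ = sampleSize κ 1 (k / ε) σ → b₂ = sampleSize κ 1 (b₁ * P) σ →
      -- uniform random blocks
      ENNReal.ofReal σ ≤ uniformOn Set.univ {s : (Fin b₁ → Fin P) × (Fin b₂ → Fin P) |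
        RecoverySucceeds (devoreBlocks N s.1) (devoreBlocks N s.2) x xk xt k ε} ∧
      -- blocks generated from independent fair bits
      ENNReal.ofReal σ ≤ uniformOn Set.univ
        {v : (Fin b₁ → Fin (Nat.clog 2 P) → Bool) × (Fin b₂ → Fin (Nat.clog 2 P) → Bool) |
          RecoverySucceeds (devoreBlocks N fun i => blockOfBits hP.pos (v.1 i))
            (devoreBlocks N fun i => blockOfBits hP.pos (v.2 i)) x xk xt k ε} ∧
      -- running time
      (∀ (s₁ : Fin b₁ → Fin P) (s₂ : Fin b₂ → Fin P), ∃ (z : Fin N → ℝ) (T : ℕ),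
        progRec.Runs (recoveryInput N k s₂ (idMeasurements (devoreBlocks N s₁) x)
          (estMeasurements (devoreBlocks N s₂) x)) T z ∧
        IsRecovery (devoreBlocks N s₂) (estMeasurements (devoreBlocks N s₂) x)
          (idMeasurements (devoreBlocks N s₁) x) k z ∧
        (c₀ * Real.log N ≤ k → (T : ℝ) ≤ C * (k / ε) * Real.log (N / (1 - σ)) ^ 2 *
          (1 + logBase (k / ε) (1 / (1 - σ))) ^ 2)) ∧
      -- numbers of measurements and of random bits
      (c₀ * Real.log N ≤ k →
        (((1 + Nat.clog 2 N) * (b₁ * P) + b₂ * P : ℕ) : ℝ) ≤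
          C * (k / ε) * Real.log (N / (1 - σ)) * Real.log N *
            (1 + logBase (k / ε) (1 / (1 - σ))) ∧
        (((b₁ + b₂) * Nat.clog 2 P : ℕ) : ℝ) ≤
          C * Real.log (max 2 (k / ε)) ^ 2 * (1 + logBase (k / ε) (1 / (1 - σ))))) ∧
    -- 3. identification with sampled rows of a random coherent matrix, estimation with sampled
    -- blocks of a DeVore matrix
    (∀ A : Matrix (Fin m) (Fin N) Bool, IsBalancedCoherent κ A K α →
      ∀ γ b : ℕ, γ = sampleSize κ (m / K) (k / ε) σ → b = sampleSize κ 1 γ σ →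
      ENNReal.ofReal σ ≤ uniformOn Set.univ {s : (Fin γ → Fin m) × (Fin b → Fin P) |
        RecoverySucceeds (sampleRows A s.1) (devoreBlocks N s.2) x xk xt k ε} ∧
      (∀ (s₁ : Fin γ → Fin m) (s₂ : Fin b → Fin P), ∃ (z : Fin N → ℝ) (T : ℕ),
        progRec.Runs (recoveryInput N k s₂ (idMeasurements (sampleRows A s₁) x)
          (estMeasurements (devoreBlocks N s₂) x)) T z ∧
        IsRecovery (devoreBlocks N s₂) (estMeasurements (devoreBlocks N s₂) x)
          (idMeasurements (sampleRows A s₁) x) k z ∧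
        (c₀ * Real.log N ≤ k → (T : ℝ) ≤ C * (k / ε) * Real.log (k / ε / (1 - σ)) *
          Real.log (N / (1 - σ)) * (1 + logBase (k / ε) (1 / (1 - σ))))) ∧
      (c₀ * Real.log N ≤ k → (((1 + Nat.clog 2 N) * γ + b * P : ℕ) : ℝ) ≤
        C * (k / ε) * Real.log (k / ε / (1 - σ)) * Real.log N)) := by
  -- With `κ = 100` at most `K / 50` rows of a coherent matrix and `P / 25` blocks of a DeVore
  -- matrix are bad for an index. The resulting advantage satisfies `θ ρ = 1/4`, so `θ κ ρ = 25`,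
  -- more than the required 2.
  refine ⟨100, estimationProgram, recoveryProgram, by norm_num, fun c₀ hc₀ => ?_⟩
  obtain ⟨C₁, hC₁, hmeas⟩ := exists_devore_measurements_le hc₀
  obtain ⟨C₂, hC₂, hbits⟩ := exists_random_bits_le hc₀
  obtain ⟨C₃, hC₃, htime⟩ := exists_devore_time_le hc₀
  -- Only `C₁`, `C₂`, `C₃` depend on `c₀`; the last term dominates all absolute constants, the
  -- largest being that of the running time in the third case.
  set C := C₁ + C₂ + C₃ + 10 ^ 16 with hC
  have hC10 : (10 : ℝ) ^ 16 ≤ C := by linarith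
  refine ⟨C, by positivity, ?_⟩
  intro N k ε σ τ x xk xt hk hkN hε hε1 hσ hσ1 hτ hτ1 hxk hxt α K m hα hK hm
  have hN : 2 ≤ N := by omega
  have hN1 : 1 ≤ N := by omega
  have hN' : (2 : ℝ) ≤ N := by exact_mod_cast hN
  have hk' : (1 : ℝ) ≤ k := by exact_mod_cast hk
  -- Because of this, the assumption `c₀ ln N ≤ k` gives `c₀ ln N ≤ t`, the form used in the size
  -- estimates.
  have hkt : (k : ℝ) ≤ k / ε := le_div_self (by linarith) hε hε1
  have hxk' : nonzeroCount xk ≤ k := by exact_mod_cast hxk.1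
  have hxt' := hxt.1
  have hδ := noiseLevel_nonneg x xt k hε
  have hsum := sum_compl_abs_le_noiseLevel x xt hk hε
  set t : ℝ := k / ε with ht
  have ht1 : 1 ≤ t := hk'.trans hkt
  have hs := one_le_log_one_div hσ hσ1
  have hn := half_le_log_natCast hN
  have hA := log_div_one_sub (q := N) (σ := σ) (by linarith) hσ1
  have hD := log_div_one_sub (q := t) (σ := σ) (by linarith) hσ1
  have hlt := Real.log_nonneg ht1
  have hf := one_le_one_add_logBase (t := t) hσ hσ1
  have hu := half_le_log_max t
  have hA0 : 0 ≤ Real.log (N / (1 - σ)) := by linarith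
  have hD0 : 0 ≤ Real.log (t / (1 - σ)) := by linarith
  have hn0 : 0 ≤ Real.log N := by linarith
  have hf0 : 0 ≤ 1 + logBase t (1 / (1 - σ)) := by linarith
  have hKα : 100 * t * α ≤ K := by rw [hK, hα]; exact Nat.le_ceil _
  have hK0 : 0 < K := by
    have h1 := bernLogTerm_le_bernK hN1 hτ hτ1 (by norm_num : (10 : ℝ) ≤ 100) ht1
    have h2 := log_le_bernLogTerm hN1 hτ hτ1
    have h3 := one_le_log_three_mul hN1 hτ hτ1
    rw [← hK] at h1
    exact_mod_cast (show (0 : ℝ) < K by linarith)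
  have hK0' : (0 : ℝ) < K := by exact_mod_cast hK0
  obtain ⟨hρ, hρ1⟩ := bernRows_div_bernK_le hN1 hτ hτ1 ht1 hK hm
  have hKm : K ≤ m := by
    rw [le_div_iff₀ hK0', one_mul] at hρ1
    exact_mod_cast hρ1
  have hm0 : 0 < m := by omega
  have hm0' : (0 : ℝ) < m := by exact_mod_cast hm0
  have := Fin.pos_iff_nonempty.1 hm0
  have hrow : ∀ (A : Matrix (Fin m) (Fin N) Bool), IsBalancedCoherent 100 A K α → ∀ b : ℕ,
      IsSampledMatrix (fun s : Fin b → Fin m => sampleRows A s) x (noiseLevel x xt k ε)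
        (K / (4 * m)) := fun A hA b =>
    isSampledMatrix_of_isCoherent hA.1 hKα hm0 hδ _ hxt' hsum
  refine ⟨ofReal_le_bernLaw hN1 hτ hτ1 (by norm_num) ht1 hα hK hm, fun A hAc β hβ => ⟨?_, ?_⟩, ?_⟩
  · rw [hβ]
    refine (sampleSize_rows_le (by linarith) hρ ht1 (by linarith) hσ hσ1).trans ?_
    gcongr
    linarith
  · have h := ofReal_le_uniformOn_estimationSucceeds (x := x) hAc hk hN hε hσ hσ1 hxk' hxt' hKα hK0
      hKm hβ
    refine h.trans (measure_mono ?_)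
    rintro s ⟨h1, z, T, h2, h3, h4⟩
    refine ⟨h1, z, T, h2, h3, h4.trans ?_⟩
    gcongr
    linarith
  intro P hP hPs hPs2
  have hP2 := hP.two_le
  have hbad := badCount_devore_le hP hN ht1 hPs hδ _ hxt' hsum
  have := Fin.pos_iff_nonempty.1 hP.pos
  refine ⟨isCoherent_devore hP N, ?_, fun b₁ b₂ hb₁ hb₂ => ⟨?_, ?_, fun s₁ s₂ => ?_, fun hkc => ⟨?_, ?_⟩⟩,
    fun A hAc γ b hγ hb => ⟨?_, fun s₁ s₂ => ?_, fun _ => ?_⟩⟩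
  · refine (natLog_prime_le hN ht1 hPs).trans ?_
    have : 0 ≤ logBase t N := div_nonneg hn0 (by linarith)
    gcongr
    linarith
  · exact ofReal_le_uniformOn_recoverySucceeds hk hε hε1 hσ hσ1 hxk' hxt'
      (isSampledMatrix_devoreBlocks_uniform hP hbad) (isSampledMatrix_devoreBlocks_uniform hP hbad)
      (by norm_num) (by norm_num) hb₁ (by norm_num) (by norm_num) hb₂ (by push_cast; rfl)
      (Nat.mul_pos (hb₁ ▸ one_le_sampleSize le_rfl ht1 hσ hσ1) hP.pos)
  · exact ofReal_le_uniformOn_devore_bits hk hε hε1 hσ hσ1 hxk' hxt' hP hbad hb₁ hb₂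
      (Nat.mul_pos (hb₁ ▸ one_le_sampleSize le_rfl ht1 hσ hσ1) hP.pos)
  · obtain ⟨z, T, hr, hz, hT⟩ := recoveryProgram_spec hk hP.one_lt hN1 s₂
      (idMeasurements (devoreBlocks N s₁) x) (estMeasurements (devoreBlocks N s₂) x)
    refine ⟨z, T, hr, hz, fun hkc => (Nat.cast_le.2 hT).trans ((htime N P b₁ b₂ _ t σ hN ht1
      (hkc.trans hkt) hσ hσ1 hP2 hPs hPs2 hb₁ hb₂ (card_finset_fin_le _)
      (card_identified_le _)).trans ?_)⟩
    gcongr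
    linarith
  · refine (hmeas N P b₁ b₂ t σ hN ht1 (hkc.trans hkt) hσ hσ1 hP2 hPs2 hb₁ hb₂).trans ?_
    gcongr
    linarith
  · refine (hbits N P b₁ b₂ t σ hN ht1 (hkc.trans hkt) hσ hσ1 hP2 hPs2 hb₁ hb₂).trans ?_
    gcongr
    linarith
  · exact ofReal_le_uniformOn_recoverySucceeds hk hε hε1 hσ hσ1 hxk' hxt' (hrow A hAc γ)
      (isSampledMatrix_devoreBlocks_uniform hP hbad) (by positivity)
      (by field_simp; norm_num) hγ (by norm_num) (by norm_num) hb rfl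
      (hγ ▸ one_le_sampleSize hρ1 ht1 hσ hσ1)
  · obtain ⟨z, T, hr, hz, hT⟩ := recoveryProgram_spec hk hP.one_lt hN1 s₂
      (idMeasurements (sampleRows A s₁) x) (estMeasurements (devoreBlocks N s₂) x)
    refine ⟨z, T, hr, hz, fun _ => (Nat.cast_le.2 hT).trans ((rows_time_le hN ht1 hρ1 hρ hσ hσ1 hPs
      hγ hb (card_finset_fin_le _) (card_identified_le _)).trans ?_)⟩
    gcongr
  · refine (rows_measurements_le hN ht1 hρ1 hρ hσ hσ1 hPs2 hγ hb).trans ?_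
    gcongr
    linarith
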